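/- **Theorem 2.6.** Let $k\ge 2$ and $r\ge 1$ be fixed. For $n\ge 1$ let $v_1,\dots,v_r\in\mathbb R^n$ be orthonormal and let $\beta_1,\dots,\beta_r$ be nonzero reals with $|\beta_j|\le|\beta_1|$ for all $j$. Let $X=\sum_{j=1}^r\beta_j v_j^{\otimes k}+Z$, where the $n^k$ entries of $Z$ are i.i.d. $N(0,1/n)$. For a tensor $\tau$ of order $k$, let $\tau[v^{\otimes k}]=\langle\tau,v^{\otimes k}\rangle$, and let $\tau[v^{\otimes(k-1)}]\in\mathbb R^n$ be the vector with $i$-th entry $\sum_{i_1,\dots,i_{k-1}}\tau_{i i_1\cdots i_{k-1}}v(i_1)\cdots v(i_{k-1})$. Let $u$ be uniform on the unit sphere of $\mathbb R^n$, independent of $Z$, and let $u_0=u$, $u_{t+1}=X[u_t^{\otimes(k-1)}]/\|X[u_t^{\otimes(k-1)}]\|$. Put $$p_i=\mathbb P\big(|\beta_i\langle u,v_i\rangle^{k-2}|\ge|\beta_j\langle u,v_j\rangle^{k-2}|\text{ for all }j\big).$$ There is a constant $C=C(k,r)$ such that for every $\kappa\ge 1$ there is $\varepsilon_0>0$ such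 that for every $0<\varepsilon\le\varepsilon_0$ there are $K>0$, $N$ and $\delta_n\to 0$ (depending only on $k,r,\kappa,\varepsilon$) such that the following holds for all $n\ge N$ and all $v_j,\beta_j$ as above with $|\beta_1|\ge n^{(k-2)/2+\varepsilon}$ and, when $k=2$, $|\beta_j|\le(1-1/\kappa)|\beta_1|$ for all $j\ne 1$. We say that $(X[u_t^{\otimes k}],u_t)$ *converges to* $(b,w)$ if $|X[u_t^{\otimes k}]-b|\le\delta_n$ and $\|u_t-w\|\le\delta_n$ for all sufficiently large $t$, and that it *alternates between* $(b,w)$ and $(b,-w)$ if, for $w'=w$ or for $w'=-w$, $|X[u_t^{\otimes k}]-b|\le\delta_n$ and $\|u_t-(-1)^tw'\|\le\delta_n$ for all sufficiently large $t$. "With probability $p+O(1/\sqrt\kappa)$" means that the probability of the event differs from $p$ by at most $C/\sqrt\kappa$. Let $1\le i\le r$. If $k\ge 3$, then $$p_i=\int_0^\infty\sqrt{\tfrac2\pi}\,e^{-x^2/2}\prod_{\ell\ne i}\left(\int_0^{(|\beta_i|/|\beta_\ell|)^{1/(k-2)}x}\sqrt{\tfrac2\pi}\,e^{-y^2/2}\,dy\right)dx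 .$$ 1. If $k$ is odd and $\beta_i>0$, then with probability $p_i+O(1/\sqrt\kappa)$, $(X[u_t^{\otimes k}],u_t)$ converges to $(\beta_i,v_i)$. 2. If $k$ is odd and $\beta_i<0$, then with probability $p_i+O(1/\sqrt\kappa)$ it converges to $(-\beta_i,-v_i)$. 3. If $k$ is even and $\beta_i>0$, then with probability $p_i/2+O(1/\sqrt\kappa)$ it converges to $(\beta_i,v_i)$, and with probability $p_i/2+O(1/\sqrt\kappa)$ it converges to $(\beta_i,-v_i)$. 4. If $k$ is even and $\beta_i<0$, then with probability $p_i+O(1/\sqrt\kappa)$ it alternates between $(\beta_i,v_i)$ and $(\beta_i,-v_i)$. Moreover, for $w=\pm v_i$ the vector $Z[w^{\otimes(k-1)}]$ has i.i.d. $N(0,1/n)$ entries. Finally, let $k\ge3$, let $a\in\mathbb R^n$ be a unit vector, and let $T$ be an integer with $$T\ge 1+\frac1\varepsilon\left(\frac12+\frac{2\log|\beta_1|}{\log n}\right)+\frac{\log\log(\sqrt n|\beta_1|)}{\log(k-1)}.$$ Then in each of the cases 1–4 the statement remains true, with the same probabilities up to $O(1/\sqrt\kappa)$, for the event that the stated convergence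 (or alternation) takes place and, in addition, with $(b,w)$ the limit in question (in case 4, the one of the two points $(\beta_i,\pm v_i)$ that is visited at time $T$, that is, $w=(-1)^Tw'$) and $\xi=Z[w^{\otimes(k-1)}]$, $$\Big|\langle a,u_T\rangle-\Big(1-\frac1{2b^2}\Big)\langle a,w\rangle-\frac{\langle a,\xi\rangle-\langle a,w\rangle\langle w,\xi\rangle}{b}\Big|\le K\left(\frac{\log n}{\sqrt n}\Big(\frac{\log n}{\sqrt n|\beta_1|}\Big)^{k-1}+\frac{\log n}{|\beta_1|^2\sqrt n}+\frac{(\log n)^{3/2}}{|\beta_1|^{3/2}n^{3/4}}+\frac1{|\beta_1|^4}\right)$$ and $$\Big|X[u_T^{\otimes k}]-b-\langle\xi,w\rangle+\frac{k/2-1}{b}\Big|\le K\left(\frac{\log n}{\sqrt n}\Big(\frac{\log n}{\sqrt n|\beta_1|}\Big)^{k-1}+\frac{\log n}{|\beta_1|\sqrt n}+\frac{(\log n)^{3/2}}{|\beta_1|^{1/2}n^{3/4}}+\frac1{|\beta_1|^3}\right).$$ -/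

import Mathlib

open MeasureTheory ProbabilityTheory Filter Topology
open scoped NNReal ENNReal

namespace SpikedTensor

noncomputable section

/-- The Euclidean space `ℝⁿ`. -/
abbrev Vec (n : ℕ) : Type := EuclideanSpace ℝ (Fin n)

/-- Real tensors of order `k ≥ 1` over `ℝⁿ`, as arrays of `n ^ k` entries
`τ_{i i₁ ⋯ i_{k-1}}`, written `τ (i, (i₁, …, i_{k-1}))`. -/
abbrev Tensor (k n : ℕ) : Type := Fin n × (Fin (k - 1) → Fin n) → ℝ

/-- The inner product of two tensors of order `k`. -/
def tinner {k n : ℕ} (τ η : Tensor k n) : ℝ := ∑ I, τ I * η I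

/-- The `k`-th tensor power `v^{⊗k}`. -/
def tpow (k : ℕ) {n : ℕ} (v : Vec n) : Tensor k n :=
  fun I => v I.1 * ∏ s, v (I.2 s)

/-- The vector `τ[v^{⊗(k-1)}]`, with `i`-th entry
`∑_{i₁,…,i_{k-1}} τ_{i i₁ ⋯ i_{k-1}} v(i₁) ⋯ v(i_{k-1})`. -/
def contract {k n : ℕ} (τ : Tensor k n) (v : Vec n) : Vec n :=
  WithLp.toLp 2 fun i => ∑ J : Fin (k - 1) → Fin n, τ (i, J) * ∏ s, v (J s)

/-- The rank-`r` spiked tensor `X = ∑ⱼ βⱼ vⱼ^{⊗k} + Z`. -/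
def spiked (k : ℕ) {n r : ℕ} (β : Fin r → ℝ) (v : Fin r → Vec n) (Z : Tensor k n) :
    Tensor k n :=
  (∑ j, β j • tpow k (v j)) + Z

/-- Power iteration: `u₀ = u` and `u_{t+1} = X[u_t^{⊗(k-1)}] / ‖X[u_t^{⊗(k-1)}]‖`. -/
def powerIter {k n : ℕ} (X : Tensor k n) (u : Vec n) : ℕ → Vec n
  | 0 => u
  | t + 1 => ‖contract X (powerIter X u t)‖⁻¹ • contract X (powerIter X u t)

/-- The value `X[u_t^{⊗k}] = ⟨X, u_t^{⊗k}⟩` along power iteration. -/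
def powerVal {k n : ℕ} (X : Tensor k n) (u : Vec n) (t : ℕ) : ℝ :=
  tinner X (tpow k (powerIter X u t))

/-- The law of the noise tensor: i.i.d. entries `N(0, 1/n)`. -/
def noise (k n : ℕ) : Measure (Tensor k n) :=
  Measure.pi fun _ => gaussianReal 0 ((n : ℝ≥0)⁻¹)

/-- The uniform distribution on the unit sphere of `ℝⁿ`: normalized surface measure. -/
def unifSphere (n : ℕ) : Measure (Metric.sphere (0 : Vec n) 1) :=
  ((volume : Measure (Vec n)).toSphere Set.univ)⁻¹ • (volume : Measure (Vec n)).toSphere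

/-- The sample space of pairs `(u, Z)`. -/
abbrev Sample (k n : ℕ) : Type := Metric.sphere (0 : Vec n) 1 × Tensor k n

/-- The joint law of `(u, Z)`: `u` is uniform on the sphere, and independent of the noise `Z`. -/
def law (k n : ℕ) : Measure (Sample k n) := (unifSphere n).prod (noise k n)

/-- `p_i`: the probability that `i` attains the maximum of `|βⱼ ⟨u, vⱼ⟩^{k-2}|` over `j`,
when `u` is uniform on the sphere. -/
def argmaxProb (k : ℕ) {n r : ℕ} (β : Fin r → ℝ) (v : Fin r → Vec n) (i : Fin r) : ℝ :=
  (unifSphere n).real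
    {u | ∀ j, |β j * (inner ℝ (u : Vec n) (v j)) ^ (k - 2)|
      ≤ |β i * (inner ℝ (u : Vec n) (v i)) ^ (k - 2)|}

/-- The density `√(2/π) e^{-x²/2}` of the absolute value of a standard Gaussian. -/
def halfGauss (x : ℝ) : ℝ := Real.sqrt (2 / Real.pi) * Real.exp (-x ^ 2 / 2)

/-- The explicit Gaussian integral for `p_i` (for `k ≥ 3`). -/
def gaussProb (k : ℕ) {r : ℕ} (β : Fin r → ℝ) (i : Fin r) : ℝ :=
  ∫ x in Set.Ioi (0 : ℝ), halfGauss x *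
    ∏ l ∈ Finset.univ.erase i,
      ∫ y in (0 : ℝ)..((|β i| / |β l|) ^ (1 / ((k : ℝ) - 2)) * x), halfGauss y

/-- At time `t`, the pair `(X[u_t^{⊗k}], u_t)` is within `δ` of `(b, w)`. -/
def Near {k n : ℕ} (X : Tensor k n) (u : Vec n) (δ b : ℝ) (w : Vec n) (t : ℕ) : Prop :=
  |powerVal X u t - b| ≤ δ ∧ ‖powerIter X u t - w‖ ≤ δ

/-- `(X[u_t^{⊗k}], u_t)` converges to `(b, w)` up to the precision `δ`. -/
def Converges {k n : ℕ} (X : Tensor k n) (u : Vec n) (δ b : ℝ) (w : Vec n) : Prop :=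
  ∀ᶠ t in atTop, Near X u δ b w t

/-- `(X[u_t^{⊗k}], u_t)` alternates, up to the precision `δ`, between `(b, w)` at even times
and `(b, -w)` at odd times. -/
def Alternates {k n : ℕ} (X : Tensor k n) (u : Vec n) (δ b : ℝ) (w : Vec n) : Prop :=
  ∀ᶠ t in atTop, Near X u δ b ((-1 : ℝ) ^ t • w) t

/-- The error rate of the expansion of `⟨a, u_T⟩`; here `B = |β₁|`. -/
def rateVec (k n : ℕ) (B : ℝ) : ℝ :=
  Real.log n / Real.sqrt n * (Real.log n / (Real.sqrt n * B)) ^ (k - 1)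
    + Real.log n / (B ^ 2 * Real.sqrt n)
    + (Real.log n) ^ (3 / 2 : ℝ) / (B ^ (3 / 2 : ℝ) * (n : ℝ) ^ (3 / 4 : ℝ))
    + 1 / B ^ 4

/-- The error rate of the expansion of `X[u_T^{⊗k}]`; here `B = |β₁|`. -/
def rateVal (k n : ℕ) (B : ℝ) : ℝ :=
  Real.log n / Real.sqrt n * (Real.log n / (Real.sqrt n * B)) ^ (k - 1)
    + Real.log n / (B * Real.sqrt n)
    + (Real.log n) ^ (3 / 2 : ℝ) / (B ^ (1 / 2 : ℝ) * (n : ℝ) ^ (3 / 4 : ℝ))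
    + 1 / B ^ 3

/-- The expansions of `⟨a, u_T⟩` and of `X[u_T^{⊗k}]` around the limit `(b, w)`, in terms of
`ξ = Z[w^{⊗(k-1)}]`, with errors at most `K` times the two rates. -/
def Expansion {k n : ℕ} (X Z : Tensor k n) (u a : Vec n) (B K : ℝ) (T : ℕ) (b : ℝ) (w : Vec n) :
    Prop :=
  |inner ℝ a (powerIter X u T)
      - ((1 - 1 / (2 * b ^ 2)) * inner ℝ a w
        + (inner ℝ a (contract Z w) - inner ℝ a w * inner ℝ w (contract Z w)) / b)|
      ≤ K * rateVec k n B ∧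
  |powerVal X u T - (b + inner ℝ (contract Z w) w - ((k : ℝ) / 2 - 1) / b)|
      ≤ K * rateVal k n B

/-- The lower bound on the number `T` of iterations; here `B = |β₁|`. -/
def timeBound (k n : ℕ) (ε B : ℝ) : ℝ :=
  1 + (1 / ε) * (1 / 2 + 2 * Real.log B / Real.log n)
    + Real.log (Real.log (Real.sqrt n * B)) / Real.log ((k : ℝ) - 1)

/-- The event that power iteration converges to `(b, w)`. -/
def convEvent (k : ℕ) {n r : ℕ} (β : Fin r → ℝ) (v : Fin r → Vec n) (δ b : ℝ) (w : Vec n) :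
    Set (Sample k n) :=
  {ω | Converges (spiked k β v ω.2) ω.1 δ b w}

/-- The event that power iteration alternates between `(b, w)` and `(b, -w)`. -/
def altEvent (k : ℕ) {n r : ℕ} (β : Fin r → ℝ) (v : Fin r → Vec n) (δ b : ℝ) (w : Vec n) :
    Set (Sample k n) :=
  {ω | Alternates (spiked k β v ω.2) ω.1 δ b w ∨ Alternates (spiked k β v ω.2) ω.1 δ b (-w)}

/-- The event that power iteration converges to `(b, w)` and that the expansions around `(b, w)`
hold at time `T`. -/
def convExpEvent (k : ℕ) {n r : ℕ} (β : Fin r → ℝ) (v : Fin r → Vec n) (δ : ℝ)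
    (a : Vec n) (B K : ℝ) (T : ℕ) (b : ℝ) (w : Vec n) : Set (Sample k n) :=
  {ω | Converges (spiked k β v ω.2) ω.1 δ b w ∧
    Expansion (spiked k β v ω.2) ω.2 ω.1 a B K T b w}

/-- The event that power iteration alternates between `(b, w)` and `(b, -w)` and that, at time
`T`, the expansions hold around that one of the two points that is visited at time `T`. -/
def altExpEvent (k : ℕ) {n r : ℕ} (β : Fin r → ℝ) (v : Fin r → Vec n) (δ : ℝ)
    (a : Vec n) (B K : ℝ) (T : ℕ) (b : ℝ) (w : Vec n) : Set (Sample k n) :=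
  {ω | ∃ w', (w' = w ∨ w' = -w) ∧ Alternates (spiked k β v ω.2) ω.1 δ b w' ∧
    Expansion (spiked k β v ω.2) ω.2 ω.1 a B K T b ((-1 : ℝ) ^ T • w')}

end

end SpikedTensor

/-! Let `m_j` be the coordinate of the current iterate along `v_j`. Since the spikes are
orthonormal, the signal part of `X[u^{⊗(k-1)}]` has coordinate `β_j m_j^{k-1}` along `v_j`
(`inner_contract_spiked`). Without noise, one step multiplies the ratio `m_j / m_i` by `β_j
m_j^{k-2} / (β_i m_i^{k-2})`, which has modulus less than one as soon as `i` is the strict maximiser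
of `|β_j m_j^{k-2}|`. The order at time `0` therefore reinforces itself, and the initial maximiser
wins. The condition of being the maximiser is a cone condition, so its probability can be computed
for a Gaussian vector instead of a uniform point of the sphere (`unifSphere_coord_cone`), which
yields the integral formula (`gpi_argmaxCone`).

The noise has to be controlled in two regimes. With `δ = 1 / (2 √κ)`, outside an event of
probability `O(δ)` the initial coordinates are at least `δ² n^{-1/2}`, mutually comparable, and, for
`k ≥ 3`, the maximum is attained with a relative gap `δ` (`unifSphere_initGood_compl`). At this
scale the crude bound `‖Z[u^{⊗(k-1)}]‖ = O(1)` is useless; the noise must be of size about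
`n^{-1/2}` in the directions `v_j`, although the iterates depend on `Z`. This is obtained by
revealing `Z` only on the queried directions: the part of a query orthogonal to the earlier ones
meets fresh Gaussian noise (`gpi_resample`, `noise_effNoise_exceeds_le`). The number of steps for
which this is needed depends on `ε` alone, because the coordinate along `v_i` gains a factor
`n^{ε/2}` in each step (`TrapData.iterate`). Once that coordinate is of order one, the injective
norm of `Z`, bounded by a net argument (`noise_injNorm_le`), is negligible against `|β_1|`, for all
later times at once.

From then on the tangent of the angle between iterate and spike contracts geometrically and, for `k
≥ 3`, superlinearly, until it is `O(1 / |β_1|)`. The lower bound on `T` is the sum of the lengths of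
these phases and of two final steps (`tanRatio_powerIter_le`).

For the expansions, homogeneity gives an exact recursion for the tangent vector at the spike
(`tanVec_powerStep`). The first of the two final steps turns it into `ξ^⊥ / β_i` up to
`O(|β_1|^{-2})`, where `ξ^⊥` is the part of `ξ = Z[v_i^{⊗(k-1)}]` orthogonal to `v_i`. The second
improves the error in the fixed direction `a` by the factor `log n / √n`, because the derivative of
the noise map, applied to `ξ`, is small in that direction (`noise_second_order_le`). Expanding the
cosine of the angle in the squared tangent, which is close to `β_i^{-2}`, then gives both formulas
(`NearSpike.expansion`).

Finally, the sign `σ_t` of the coordinate along `v_i` satisfies `σ_{t+1} = sign(β_i) σ_t^{k-1}`,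
which separates the four cases (`Follows`). On the good event some spike attains the maximum and is
followed; since the points `± v_j` are far apart, approaching the line of `v_i` is there equivalent
to `i` being a maximiser. The probabilities thus differ from `p_i` or `p_i / 2` by at most that of
the bad event (`Tracking`). -/

namespace SpikedTensor

/-! ### Linear images of isotropic Gaussian vectors and their tails -/

section GaussianTools

variable {ι κ : Type*} [Fintype ι] [Fintype κ]

/-- The product measure of centred Gaussians of variance `s`. -/
noncomputable abbrev gpi (ι : Type*) [Fintype ι] (s : ℝ≥0) : Measure (ι → ℝ) :=
  Measure.pi fun _ => gaussianReal 0 s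

lemma charFun_gpi (s : ℝ≥0) (c : EuclideanSpace ℝ ι) :
    charFun ((gpi ι s).map (WithLp.toLp 2)) c = Complex.exp (-(s * ∑ i, c i ^ 2 : ℝ) / 2) := by
  rw [charFun_pi]
  simp_rw [charFun_gaussianReal, ← Complex.exp_sum]
  congr 1
  push_cast
  rw [Finset.mul_sum, neg_div, Finset.sum_div, ← Finset.sum_neg_distrib]
  refine Finset.sum_congr rfl fun i _ => ?_
  simp

/-- A linear map with orthonormal rows maps a product of centred Gaussians of variance `s` to a
product of centred Gaussians of variance `s`. -/
lemma gpi_map_orthonormal [DecidableEq κ] (s : ℝ≥0) (A : Matrix κ ι ℝ)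
    (hA : ∀ k l, ∑ i, A k i * A l i = if k = l then 1 else 0) :
    (gpi ι s).map (fun x => A.mulVec x) = gpi κ s := by
  have hm : Measurable fun x : ι → ℝ => A.mulVec x := by
    refine measurable_pi_lambda _ fun k => ?_
    simp only [Matrix.mulVec, dotProduct]
    fun_prop
  have : IsProbabilityMeasure ((gpi ι s).map (fun x => A.mulVec x)) :=
    Measure.isProbabilityMeasure_map hm.aemeasurable
  refine charFun_eq_pi_iff.1 fun t => ?_
  have h1 : charFun (((gpi ι s).map (fun x => A.mulVec x)).map (WithLp.toLp 2)) t
      = charFun ((gpi ι s).map (WithLp.toLp 2))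
        (WithLp.toLp 2 fun i => ∑ k, t k * A k i : EuclideanSpace ℝ ι) := by
    simp_rw [charFun, ← MeasurableEquiv.coe_toLp, integral_map_equiv]
    rw [integral_map hm.aemeasurable]
    · congr with x
      congr 3
      simp only [MeasurableEquiv.coe_toLp, PiLp.inner_apply, Matrix.mulVec, dotProduct,
        RCLike.inner_apply, conj_trivial, Finset.mul_sum, Finset.sum_mul]
      rw [Finset.sum_comm]
      exact Finset.sum_congr rfl fun i _ => Finset.sum_congr rfl fun k _ => by ring
    · refine Measurable.aestronglyMeasurable ?_
      fun_prop
  have h2 := charFun_gpi s t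
  rw [charFun_pi] at h2
  -- The transpose of `A` is an isometry, and the characteristic function of an isotropic centred
  -- Gaussian sees only the norm of its argument.
  have h3 : ∑ i, (∑ k, t k * A k i) ^ 2 = ∑ k, t k ^ 2 := by
    calc ∑ i, (∑ k, t k * A k i) ^ 2
        = ∑ i, ∑ k, ∑ l, t k * t l * (A k i * A l i) := by
          refine Finset.sum_congr rfl fun i _ => ?_
          rw [sq, Finset.sum_mul_sum]
          exact Finset.sum_congr rfl fun k _ => Finset.sum_congr rfl fun l _ => by ring
      _ = ∑ k, ∑ l, t k * t l * ∑ i, A k i * A l i := by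
          rw [Finset.sum_comm]
          refine Finset.sum_congr rfl fun k _ => ?_
          rw [Finset.sum_comm]
          exact Finset.sum_congr rfl fun l _ => by rw [Finset.mul_sum]
      _ = _ := by
          simp [hA, sq]
  rw [h1, charFun_gpi, h2]
  simp only [h3]

/-- A linear functional of a product of centred Gaussians is a centred Gaussian. -/
lemma gpi_map_linear (s : ℝ≥0) (a : ι → ℝ) :
    (gpi ι s).map (fun x => ∑ i, a i * x i)
      = gaussianReal 0 (s * (∑ i, a i ^ 2).toNNReal) := by
  have hm : Measurable fun x : ι → ℝ => ∑ i, a i * x i := by fun_prop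
  have : IsProbabilityMeasure ((gpi ι s).map (fun x => ∑ i, a i * x i)) :=
    Measure.isProbabilityMeasure_map hm.aemeasurable
  refine Measure.ext_of_charFun (funext fun t => ?_)
  have h1 : charFun ((gpi ι s).map (fun x => ∑ i, a i * x i)) t
      = charFun ((gpi ι s).map (WithLp.toLp 2))
        (WithLp.toLp 2 fun i => t * a i : EuclideanSpace ℝ ι) := by
    rw [charFun, charFun, ← MeasurableEquiv.coe_toLp, integral_map_equiv,
      integral_map hm.aemeasurable]
    · congr with x
      congr 3
      simp only [MeasurableEquiv.coe_toLp, PiLp.inner_apply, RCLike.inner_apply, conj_trivial,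
        Finset.mul_sum]
      exact Finset.sum_congr rfl fun i _ => by ring
    · refine Measurable.aestronglyMeasurable ?_
      fun_prop
  rw [h1, charFun_gpi, charFun_gaussianReal]
  congr 1
  have h0 : 0 ≤ ∑ i, a i ^ 2 := Finset.sum_nonneg fun i _ => sq_nonneg _
  simp only [NNReal.coe_mul, Real.coe_toNNReal _ h0, mul_pow, ← Finset.mul_sum]
  push_cast
  ring

/-- Chebyshev's inequality for a linear functional of a product of centred Gaussians. -/
lemma gpi_chebyshev (s : ℝ≥0) (a : ι → ℝ) {t : ℝ} (ht : 0 < t) :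
    gpi ι s {x | t < |∑ i, a i * x i|} ≤ ENNReal.ofReal (s * (∑ i, a i ^ 2) / t ^ 2) := by
  have hm : Measurable fun x : ι → ℝ => ∑ i, a i * x i := by fun_prop
  have h0 : 0 ≤ ∑ i, a i ^ 2 := Finset.sum_nonneg fun i _ => sq_nonneg _
  have h1 : gpi ι s {x | t < |∑ i, a i * x i|}
      ≤ gaussianReal 0 (s * (∑ i, a i ^ 2).toNNReal) {y | t ≤ |y|} := by
    rw [← gpi_map_linear, Measure.map_apply hm (measurableSet_le measurable_const (by fun_prop))]
    exact measure_mono fun x (hx : t < _) => le_of_lt hx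
  refine h1.trans ?_
  have h2 := meas_ge_le_variance_div_sq
    (memLp_id_gaussianReal (μ := 0) (v := s * (∑ i, a i ^ 2).toNNReal) 2) ht
  simpa [variance_id_gaussianReal, integral_id_gaussianReal, Real.coe_toNNReal _ h0] using h2

/-- The Gaussian tail bound for a linear functional of norm at most one. -/
lemma gpi_tail {s : ℝ≥0} (hs : 0 < s) (a : ι → ℝ) (ha : ∑ i, a i ^ 2 ≤ 1) {t : ℝ} (ht : 0 ≤ t) :
    gpi ι s {x | t ≤ ∑ i, a i * x i} ≤ ENNReal.ofReal (Real.exp (-t ^ 2 / (2 * s))) := by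
  have hm : Measurable fun x : ι → ℝ => ∑ i, a i * x i := by fun_prop
  have h0 : 0 ≤ ∑ i, a i ^ 2 := Finset.sum_nonneg fun i _ => sq_nonneg _
  set μ := gaussianReal 0 (s * (∑ i, a i ^ 2).toNNReal) with hμ
  have h1 : gpi ι s {x | t ≤ ∑ i, a i * x i} = μ {y | t ≤ y} := by
    rw [hμ, ← gpi_map_linear, Measure.map_apply hm (measurableSet_le measurable_const (by fun_prop))]
    rfl
  have hs' : (0 : ℝ) < s := hs
  -- `t / s` optimises the Chernoff bound for variance `s`; the actual variance is at most `s`.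
  have h2 := measure_ge_le_exp_mul_mgf (μ := μ) (X := id) t (t := t / s) (by positivity)
    (integrable_exp_mul_gaussianReal _)
  rw [h1, ← ofReal_measureReal]
  refine ENNReal.ofReal_le_ofReal (h2.trans ?_)
  rw [hμ, mgf_id_gaussianReal, ← Real.exp_add]
  refine Real.exp_le_exp.2 ?_
  simp only [NNReal.coe_mul, Real.coe_toNNReal _ h0]
  have h3 : (s : ℝ) * (∑ i, a i ^ 2) * (t / s) ^ 2 / 2 ≤ s * 1 * (t / s) ^ 2 / 2 := by gcongr
  have h4 : (s : ℝ) * 1 * (t / s) ^ 2 / 2 = t ^ 2 / (2 * s) := by field_simp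
  have h5 : -(t / s) * t = - (2 * (t ^ 2 / (2 * s))) := by field_simp
  have h6 : -t ^ 2 / (2 * (s : ℝ)) = - (t ^ 2 / (2 * s)) := by ring
  rw [h5, h6]
  linarith

end GaussianTools

/-! ### Replacing the image of one direction by an independent copy -/

section Resample

variable {ι κ : Type*} [Fintype ι] [Fintype κ]

/-- The matrix of an array indexed by pairs. -/
def unfold {ι κ : Type*} (Z : ι × κ → ℝ) : Matrix ι κ ℝ := fun i j => Z (i, j)

/-- Replacing the image `Z e` of a unit vector `e` by an independent copy does not change the law
of a Gaussian matrix `Z`. -/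
lemma gpi_resample [DecidableEq ι] [DecidableEq κ] (s : ℝ≥0) (e : κ → ℝ) (he : ∑ j, e j ^ 2 = 1) :
    ((gpi (ι × κ) s).prod (gpi ι s)).map
      (fun p => fun I => p.1 I + (p.2 I.1 - (unfold p.1).mulVec e I.1) * e I.2)
      = gpi (ι × κ) s := by
  classical
  have h1 := measurePreserving_sumPiEquivProdPi (X := fun _ : (ι × κ) ⊕ ι => ℝ)
    (fun _ => gaussianReal 0 s)
  -- In matrix form the map is `(Z, y) ↦ Z (1 - e eᵀ) + y eᵀ`. Its rows are orthonormal because `1 -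
  -- e eᵀ` and `e eᵀ` are complementary projections.
  set A : Matrix (ι × κ) ((ι × κ) ⊕ ι) ℝ := fun I x =>
    Sum.elim (fun I' => if I.1 = I'.1 then (if I.2 = I'.2 then 1 else 0) - e I'.2 * e I.2 else 0)
      (fun i => if I.1 = i then e I.2 else 0) x with hA
  have h2 := gpi_map_orthonormal s A ?_
  · have h3 : ((gpi (ι × κ) s).prod (gpi ι s))
        = Measure.map (MeasurableEquiv.sumPiEquivProdPi fun _ : (ι × κ) ⊕ ι => ℝ)
          (gpi ((ι × κ) ⊕ ι) s) := h1.map_eq.symm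
    refine Eq.trans ?_ h2
    rw [h3, Measure.map_map]
    · congr 1
      funext x I
      obtain ⟨i, j⟩ := I
      simp only [Function.comp, hA, Matrix.mulVec, dotProduct, Fintype.sum_sum_type,
        Sum.elim_inl, Sum.elim_inr, Fintype.sum_prod_type, MeasurableEquiv.coe_sumPiEquivProdPi,
        Equiv.sumPiEquivProdPi, Equiv.coe_fn_mk, unfold]
      simp only [ite_mul, zero_mul, Finset.sum_ite_irrel, Finset.sum_const_zero,
        Finset.sum_ite_eq, Finset.mem_univ, if_true, sub_mul, one_mul, Finset.sum_sub_distrib]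
      rw [Finset.sum_mul]
      have : ∑ j', e j' * e j * x (Sum.inl (i, j')) = ∑ j', x (Sum.inl (i, j')) * e j' * e j :=
        Finset.sum_congr rfl fun _ _ => by ring
      rw [this]
      ring
    · refine measurable_pi_lambda _ fun I => ?_
      simp only [Matrix.mulVec, dotProduct, unfold]
      fun_prop
    · exact h1.measurable
  · rintro ⟨i, j⟩ ⟨i', j'⟩
    simp only [hA, Fintype.sum_sum_type, Sum.elim_inl, Sum.elim_inr, Fintype.sum_prod_type,
      Prod.mk.injEq]
    by_cases hi : i = i'
    · subst hi
      have h3 : ∀ x : ι, (∑ y, (if i = x then (if j = y then (1 : ℝ) else 0) - e y * e j else 0)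
          * (if i = x then (if j' = y then 1 else 0) - e y * e j' else 0))
          = if i = x then (∑ y, ((if j = y then (1 : ℝ) else 0) - e y * e j)
          * ((if j' = y then 1 else 0) - e y * e j')) else 0 := by
        intro x
        split_ifs <;> simp
      have h4 : ∑ y, ((if j = y then (1 : ℝ) else 0) - e y * e j)
          * ((if j' = y then 1 else 0) - e y * e j')
          = (if j = j' then 1 else 0) - e j * e j' := by
        have : ∀ y, ((if j = y then (1 : ℝ) else 0) - e y * e j)
          * ((if j' = y then 1 else 0) - e y * e j')
          = (if j = y then (if j' = y then 1 else 0) else 0) - (if j = y then e y * e j' else 0)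
            - (if j' = y then e y * e j else 0) + e y ^ 2 * (e j * e j') := by
          intro y
          split_ifs <;> ring
        simp only [this, Finset.sum_add_distrib, Finset.sum_sub_distrib, ← Finset.sum_mul, he,
          Finset.sum_ite_eq, Finset.mem_univ, if_true]
        simp only [eq_comm (a := j') (b := j)]
        ring
      simp only [Finset.sum_ite_eq, Finset.mem_univ, if_true, true_and, mul_ite, mul_zero,
        ite_mul, zero_mul, Finset.sum_ite_irrel, Finset.sum_const_zero] at h3 ⊢
      rw [h4]
      ring
    · have h3 : ∀ x y, (if i = x then (if j = y then (1 : ℝ) else 0) - e y * e j else 0)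
          * (if i' = x then (if j' = y then 1 else 0) - e y * e j' else 0) = 0 := by
        intro x y
        split_ifs with h h' <;> simp_all
      have h4 : ∀ x, (if i = x then e j else 0) * (if i' = x then e j' else 0) = 0 := by
        intro x
        split_ifs with h h' <;> simp_all
      simp [h3, h4, hi]

end Resample

/-! ### Tensors as multilinear maps, and the action of the spiked tensor -/

section TensorMap

variable {k n : ℕ}

/-- The multilinear map `(x₁, …, x_{k-1}) ↦ τ[·, x₁, …, x_{k-1}]`. -/
noncomputable def tensorMap (τ : Tensor k n) :
    ContinuousMultilinearMap ℝ (fun _ : Fin (k - 1) => Vec n) (Vec n) where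
  toFun x := WithLp.toLp 2 fun i => ∑ J : Fin (k - 1) → Fin n, τ (i, J) * ∏ s, x s (J s)
  map_update_add' m s x y := by
    ext i
    simp only [PiLp.add_apply, ← Finset.sum_add_distrib, ← mul_add]
    refine Finset.sum_congr rfl fun J _ => ?_
    congr 1
    classical
    rw [← Finset.mul_prod_erase _ _ (Finset.mem_univ s), ← Finset.mul_prod_erase _ _ (Finset.mem_univ s),
      ← Finset.mul_prod_erase _ _ (Finset.mem_univ s)]
    simp only [Function.update_self, PiLp.add_apply, add_mul]
    congr 2 <;>
    · refine Finset.prod_congr rfl fun s' hs' => ?_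
      rw [Function.update_of_ne (Finset.ne_of_mem_erase hs'),
        Function.update_of_ne (Finset.ne_of_mem_erase hs')]
  map_update_smul' m s c x := by
    ext i
    simp only [PiLp.smul_apply, smul_eq_mul, Finset.mul_sum]
    refine Finset.sum_congr rfl fun J _ => ?_
    classical
    rw [← Finset.mul_prod_erase _ _ (Finset.mem_univ s), ← Finset.mul_prod_erase _ _ (Finset.mem_univ s)]
    simp only [Function.update_self, PiLp.smul_apply, smul_eq_mul]
    have : ∏ x_1 ∈ Finset.univ.erase s, (Function.update m s (c • x) x_1).ofLp (J x_1)
        = ∏ x_1 ∈ Finset.univ.erase s, (Function.update m s x x_1).ofLp (J x_1) := by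
      refine Finset.prod_congr rfl fun s' hs' => ?_
      rw [Function.update_of_ne (Finset.ne_of_mem_erase hs'),
        Function.update_of_ne (Finset.ne_of_mem_erase hs')]
    rw [this]
    ring
  cont := by
    refine (PiLp.continuous_toLp 2 _).comp (continuous_pi fun i => ?_)
    fun_prop

lemma tensorMap_apply (τ : Tensor k n) (x : Fin (k - 1) → Vec n) (i : Fin n) :
    tensorMap τ x i = ∑ J : Fin (k - 1) → Fin n, τ (i, J) * ∏ s, x s (J s) := rfl

lemma contract_eq (τ : Tensor k n) (v : Vec n) : contract τ v = tensorMap τ fun _ => v := rfl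

/-- The coordinates of `x₁ ⊗ ⋯ ⊗ x_{k-1}`. -/
def tprodVec {m n : ℕ} (x : Fin m → Vec n) : (Fin m → Fin n) → ℝ := fun J => ∏ s, x s (J s)

lemma tensorMap_eq_mulVec (τ : Tensor k n) (x : Fin (k - 1) → Vec n) :
    tensorMap τ x = WithLp.toLp 2 ((unfold τ).mulVec (tprodVec x)) := rfl

/-- A sum over multi-indices of a product is a product of sums, so inner products of rank-one arrays
factorise; in particular unit vectors give unit arrays. -/
lemma sum_tprodVec_mul {m n : ℕ} (x y : Fin m → Vec n) :
    ∑ J, tprodVec x J * tprodVec y J = ∏ s, inner ℝ (x s) (y s) := by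
  simp only [tprodVec, ← Finset.prod_mul_distrib, PiLp.inner_apply, RCLike.inner_apply,
    conj_trivial]
  rw [Finset.prod_univ_sum]
  simp [Fintype.piFinset_univ, mul_comm]

lemma sum_tprodVec_sq {m n : ℕ} (x : Fin m → Vec n) :
    ∑ J, tprodVec x J ^ 2 = ∏ s, ‖x s‖ ^ 2 := by
  have := sum_tprodVec_mul x x
  simp only [← sq, real_inner_self_eq_norm_sq] at this
  exact this

lemma tensorMap_add (τ η : Tensor k n) (x : Fin (k - 1) → Vec n) :
    tensorMap (τ + η) x = tensorMap τ x + tensorMap η x := by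
  ext i
  simp [tensorMap_apply, add_mul, Finset.sum_add_distrib]

lemma inner_tensorMap (τ : Tensor k n) (a : Vec n) (x : Fin (k - 1) → Vec n) :
    inner ℝ a (tensorMap τ x) = ∑ I : Fin n × (Fin (k - 1) → Fin n), (a I.1 * tprodVec x I.2) * τ I := by
  simp only [PiLp.inner_apply, RCLike.inner_apply, conj_trivial, tensorMap_apply, tprodVec,
    Fintype.sum_prod_type, Finset.sum_mul]
  exact Finset.sum_congr rfl fun i _ => Finset.sum_congr rfl fun J _ => by ring

lemma sum_sq_coeff (a : Vec n) (x : Fin (k - 1) → Vec n) :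
    ∑ I : Fin n × (Fin (k - 1) → Fin n), (a I.1 * tprodVec x I.2) ^ 2
      = ‖a‖ ^ 2 * ∏ s, ‖x s‖ ^ 2 := by
  simp only [mul_pow, Fintype.sum_prod_type, ← Finset.mul_sum, ← Finset.sum_mul, sum_tprodVec_sq]
  rw [EuclideanSpace.real_norm_sq_eq]

lemma contract_tpow (v u : Vec n) :
    contract (tpow k v) u = (inner ℝ u v) ^ (k - 1) • v := by
  ext i
  have h := sum_tprodVec_mul (fun _ : Fin (k - 1) => v) (fun _ => u)
  simp only [Finset.prod_const, Finset.card_univ, Fintype.card_fin, tprodVec] at h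
  rw [contract_eq, tensorMap_apply]
  simp only [tpow, PiLp.smul_apply, smul_eq_mul, mul_assoc, ← Finset.mul_sum, h]
  rw [real_inner_comm, mul_comm]

lemma contract_sum {r : ℕ} (c : Fin r → ℝ) (τ : Fin r → Tensor k n) (u : Vec n) :
    contract (∑ j, c j • τ j) u = ∑ j, c j • contract (τ j) u := by
  ext i
  simp only [contract, Finset.sum_apply, Pi.smul_apply, smul_eq_mul, Finset.sum_mul,
    WithLp.ofLp_sum, PiLp.smul_apply, Finset.mul_sum]
  rw [Finset.sum_comm]
  exact Finset.sum_congr rfl fun j _ => Finset.sum_congr rfl fun J _ => by ring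

lemma contract_spiked {r : ℕ} (β : Fin r → ℝ) (v : Fin r → Vec n) (Z : Tensor k n) (u : Vec n) :
    contract (spiked k β v Z) u
      = ∑ j, (β j * (inner ℝ u (v j)) ^ (k - 1)) • v j + contract Z u := by
  rw [spiked, contract_eq, tensorMap_add, ← contract_eq, ← contract_eq, contract_sum]
  simp only [contract_tpow, smul_smul]

lemma tinner_tpow (τ : Tensor k n) (u : Vec n) :
    tinner τ (tpow k u) = inner ℝ u (contract τ u) := by
  rw [contract_eq, inner_tensorMap, tinner]
  exact Finset.sum_congr rfl fun I _ => by rw [mul_comm]; rfl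

lemma noise_eq (k n : ℕ) : noise k n = gpi (Fin n × (Fin (k - 1) → Fin n)) (n : ℝ≥0)⁻¹ := rfl

instance (k n : ℕ) : IsProbabilityMeasure (noise k n) := by rw [noise_eq]; infer_instance

/-- The vector `Z[w^{⊗(k-1)}]` has i.i.d. entries `N(0, 1/n)` for a unit vector `w`. -/
lemma noise_map_contract (w : Vec n) (hw : ‖w‖ = 1) :
    (noise k n).map (fun Z => WithLp.ofLp (contract Z w)) = gpi (Fin n) (n : ℝ≥0)⁻¹ := by
  -- The rows are the arrays `eᵢ ⊗ w^{⊗(k-1)}`, orthonormal since `w` is a unit vector.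
  have h := gpi_map_orthonormal (ι := Fin n × (Fin (k - 1) → Fin n)) (κ := Fin n) (n : ℝ≥0)⁻¹
    (fun i I => if i = I.1 then tprodVec (fun _ => w) I.2 else 0) ?_
  · rw [← h, noise_eq]
    congr 1
    funext Z i
    simp only [contract, Matrix.mulVec, dotProduct, Fintype.sum_prod_type, ite_mul, zero_mul,
      Finset.sum_ite_irrel, Finset.sum_const_zero, Finset.sum_ite_eq, Finset.mem_univ, if_true,
      tprodVec]
    exact Finset.sum_congr rfl fun J _ => by ring
  · intro i j
    have h1 := sum_tprodVec_sq (fun _ : Fin (k - 1) => w)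
    simp only [hw, sq, mul_one, Finset.prod_const_one] at h1
    simp only [Fintype.sum_prod_type, ite_mul, zero_mul, mul_ite, mul_zero]
    by_cases hij : i = j
    · subst hij
      simp [h1]
    · rw [if_neg hij]
      refine Finset.sum_eq_zero fun x _ => Finset.sum_eq_zero fun y _ => ?_
      split_ifs with h h' <;> simp_all

end TensorMap

/-! ### Elementary properties of power iteration -/

section Iteration

variable {k n : ℕ}

/-- One step of power iteration. -/
noncomputable def powerStep (X : Tensor k n) (u : Vec n) : Vec n :=
  ‖contract X u‖⁻¹ • contract X u

lemma powerIter_succ (X : Tensor k n) (u : Vec n) (t : ℕ) :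
    powerIter X u (t + 1) = powerStep X (powerIter X u t) := rfl

/-- Splits off the first step rather than the last, for inductions that treat the remaining run as a
new one from a different starting point. -/
lemma powerIter_succ' (X : Tensor k n) (u : Vec n) (t : ℕ) :
    powerIter X u (t + 1) = powerIter X (powerStep X u) t := by
  induction t with
  | zero => rfl
  | succ t ih => rw [powerIter_succ, ih, powerIter_succ]

/-- Equality may fail only when the contraction vanishes, where the convention for the inverse of
zero makes the step zero. The inequality is all that the adaptive argument needs. -/
lemma norm_powerStep_le (X : Tensor k n) (u : Vec n) : ‖powerStep X u‖ ≤ 1 := by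
  rw [powerStep, norm_smul, norm_inv, norm_norm]
  exact inv_mul_le_one

lemma measurable_contract : Measurable fun p : Tensor k n × Vec n => contract p.1 p.2 := by
  refine Continuous.measurable ?_
  refine (PiLp.continuous_toLp 2 _).comp (continuous_pi fun i => ?_)
  fun_prop

lemma measurable_powerIter (t : ℕ) :
    Measurable fun p : Tensor k n × Vec n => powerIter p.1 p.2 t := by
  induction t with
  | zero => exact measurable_snd
  | succ t ih =>
    have h : Measurable fun p : Tensor k n × Vec n => contract p.1 (powerIter p.1 p.2 t) :=
      measurable_contract.comp (measurable_fst.prodMk ih)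
    exact (h.norm.inv).smul h

end Iteration

/-! ### Noise along adaptively chosen iterates -/

section Adaptive

variable {k n : ℕ}

/-- The tensor with matrix `L + Z Q`. -/
def effNoise (L : Tensor k n)
    (Q : Matrix (Fin (k - 1) → Fin n) (Fin (k - 1) → Fin n) ℝ) (Z : Tensor k n) : Tensor k n :=
  fun I => L I + (unfold Z * Q) I.1 I.2

lemma measurable_effNoise (L : Tensor k n)
    (Q : Matrix (Fin (k - 1) → Fin n) (Fin (k - 1) → Fin n) ℝ) : Measurable (effNoise L Q) := by
  refine measurable_pi_lambda _ fun I => ?_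
  simp only [effNoise, Matrix.mul_apply, unfold]
  fun_prop

lemma unfold_effNoise (L : Tensor k n)
    (Q : Matrix (Fin (k - 1) → Fin n) (Fin (k - 1) → Fin n) ℝ) (Z : Tensor k n) :
    unfold (effNoise L Q Z) = unfold L + unfold Z * Q := rfl

/-- Within `T` steps of power iteration, the noise in one of the directions `v j` exceeds `A`. -/
def noiseExceeds {r : ℕ} (v : Fin r → Vec n) (S : Tensor k n) (A : ℝ) (T : ℕ) (u : Vec n) :
    Set (Tensor k n) :=
  {Z | ∃ t < T, ∃ j, A < |inner ℝ (v j) (contract Z (powerIter (S + Z) u t))|}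

lemma measurableSet_noiseExceeds {r : ℕ} (v : Fin r → Vec n) (S : Tensor k n) (A : ℝ) (T : ℕ) :
    MeasurableSet {p : Vec n × Tensor k n | p.2 ∈ noiseExceeds v S A T p.1} := by
  simp only [noiseExceeds, Set.mem_ofPred_eq, measurableSet_setOfPred]
  refine Measurable.exists fun t => (measurable_const.and (Measurable.exists fun j => ?_))
  refine measurableSet_setOfPred.1 (measurableSet_lt measurable_const ?_)
  have h1 : Measurable fun p : Vec n × Tensor k n => powerIter (S + p.2) p.1 t :=
    (measurable_powerIter t).comp ((measurable_snd.const_add S).prodMk measurable_fst)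
  have h2 : Measurable fun p : Vec n × Tensor k n => contract p.2 (powerIter (S + p.2) p.1 t) :=
    measurable_contract.comp (measurable_snd.prodMk h1)
  exact (measurable_const.inner h2).abs

lemma sum_mul_mulVec_le {κ : Type*} [Fintype κ] {e x : κ → ℝ} (he : ∑ j, e j ^ 2 = 1)
    (hx : ∑ j, x j ^ 2 ≤ 1) : |∑ j, e j * x j| ≤ 1 := by
  have := Finset.sum_mul_sq_le_sq_mul_sq Finset.univ e x
  rw [he, one_mul] at this
  exact abs_le_one_iff_mul_self_le_one.2 (by rw [← sq]; exact this.trans hx)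

/-- A first step with small noise can be discarded, which lets the induction on the number of steps
restart from the next iterate. -/
lemma noiseExceeds_succ_subset {r : ℕ} {v : Fin r → Vec n} {S : Tensor k n} {A : ℝ} {T : ℕ}
    {u : Vec n} {Z : Tensor k n} (h0 : ∀ j, |inner ℝ (v j) (contract Z u)| ≤ A)
    (hZ : Z ∈ noiseExceeds v S A (T + 1) u) :
    Z ∈ noiseExceeds v S A T (powerStep (S + Z) u) := by
  obtain ⟨t, ht, j, hj⟩ := hZ
  cases t with
  | zero => exact absurd hj (not_lt.2 (h0 j))
  | succ t =>
    refine ⟨t, by omega, j, ?_⟩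
    rwa [powerIter_succ'] at hj

lemma contract_add (τ η : Tensor k n) (u : Vec n) :
    contract (τ + η) u = contract τ u + contract η u := by
  simp only [contract_eq, tensorMap_add]

/-- Adaptive noise bound: if part of the noise tensor is known to be `L`, and the
unknown part is `Z Q` for a projection `Q`, then along `T` steps of power
iteration the noise in the directions `v j` grows at most linearly. -/
lemma noise_effNoise_exceeds_le {r : ℕ} {v : Fin r → Vec n} (hv : ∀ j, ‖v j‖ = 1)
    (S : Tensor k n) {h : ℝ} (hh : 0 < h) {A : ℝ} (T : ℕ) :
    ∀ (u : Vec n) (L : Tensor k n)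
      (Q : Matrix (Fin (k - 1) → Fin n) (Fin (k - 1) → Fin n) ℝ) (ℓ : ℝ), ‖u‖ ≤ 1 →
      Q.transpose = Q → Q * Q = Q → ℓ + T * h ≤ A →
      (∀ j, ∀ x : (Fin (k - 1) → Fin n) → ℝ, ∑ J, x J ^ 2 ≤ 1 →
        |∑ i, v j i * (unfold L).mulVec x i| ≤ ℓ) →
      noise k n (effNoise L Q ⁻¹' noiseExceeds v S A T u)
        ≤ T * (r * ENNReal.ofReal ((n : ℝ)⁻¹ / h ^ 2)) := by
  induction T with
  | zero =>
    intro u L Q ℓ _ _ _ _ _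
    simp [noiseExceeds]
  | succ T ih =>
    intro u L Q ℓ hu hQt hQQ hA hL
    set p := ENNReal.ofReal ((n : ℝ)⁻¹ / h ^ 2) with hp
    push_cast at hA
    set x := tprodVec (fun _ : Fin (k - 1) => u) with hx
    have hx1 : ∑ J, x J ^ 2 ≤ 1 := by
      rw [hx, sum_tprodVec_sq]
      simp only [Finset.prod_const]
      exact pow_le_one₀ (by positivity) (pow_le_one₀ (norm_nonneg _) hu)
    have hcon : ∀ Z : Tensor k n, contract Z u = WithLp.toLp 2 ((unfold Z).mulVec x) :=
      fun Z => rfl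
    have hinner : ∀ (w : Vec n) (y : Fin n → ℝ),
        inner ℝ w (WithLp.toLp 2 y : Vec n) = ∑ i, w i * y i := by
      intro w y
      simp [PiLp.inner_apply, mul_comm]
    -- The component `Q x` of the query is the only one whose response is still random; the rest of
    -- the response is determined by `L`.
    set a := Q.mulVec x with ha
    have hQa : Q.mulVec a = a := by rw [ha, Matrix.mulVec_mulVec, hQQ]
    have hQdot : ∀ y z, Q.mulVec y ⬝ᵥ z = y ⬝ᵥ Q.mulVec z := by
      intro y z
      rw [Matrix.dotProduct_mulVec, ← Matrix.mulVec_transpose, hQt]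
    have hax : ∑ J, a J ^ 2 = ∑ J, a J * x J := by
      have : a ⬝ᵥ a = a ⬝ᵥ x := by
        conv_lhs => rw [ha]
        rw [hQdot, hQa, dotProduct_comm]
      simpa [dotProduct, sq] using this
    have hTrp : (T : ℝ≥0∞) * (r * p) ≤ ((T + 1 : ℕ) : ℝ≥0∞) * (r * p) := by
      gcongr
      omega
    by_cases hzero : ∑ J, a J ^ 2 = 0
    · -- the query is already known
      have ha0 : a = 0 := by
        funext J
        have := (Finset.sum_eq_zero_iff_of_nonneg fun J _ => sq_nonneg (a J)).1 hzero J
          (Finset.mem_univ J)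
        exact pow_eq_zero_iff two_ne_zero |>.1 this
      have hc : ∀ Z, contract (effNoise L Q Z) u = contract L u := by
        intro Z
        rw [hcon, unfold_effNoise, Matrix.add_mulVec, ← Matrix.mulVec_mulVec, ← ha, ha0,
          Matrix.mulVec_zero, add_zero, hcon]
      refine le_trans (measure_mono fun Z hZ => ?_) ((ih (powerStep (S + L) u) L Q ℓ
        (norm_powerStep_le _ _) hQt hQQ (by linarith) hL).trans hTrp)
      have h1 := noiseExceeds_succ_subset (Z := effNoise L Q Z) (T := T) (u := u) (fun j => ?_)
        (Set.mem_preimage.1 hZ)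
      · have h2 : powerStep (S + effNoise L Q Z) u = powerStep (S + L) u := by
          simp only [powerStep, contract_add, hc]
        rwa [h2] at h1
      · rw [hc, hcon, hinner]
        refine (hL j x hx1).trans ?_
        have : 0 ≤ (T : ℝ) * h := by positivity
        linarith
    · set N := Real.sqrt (∑ J, a J ^ 2) with hN
      have hpos : 0 < ∑ J, a J ^ 2 :=
        lt_of_le_of_ne (Finset.sum_nonneg fun J _ => sq_nonneg _) (Ne.symm hzero)
      have hN0 : 0 < N := Real.sqrt_pos.2 hpos
      have hN2 : N ^ 2 = ∑ J, a J ^ 2 := Real.sq_sqrt hpos.le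
      have hN1 : N ≤ 1 := by
        have h1 := Finset.sum_mul_sq_le_sq_mul_sq Finset.univ a x
        rw [← hax, ← hN2] at h1
        have h2 : N ^ 2 ≤ ∑ J, x J ^ 2 := by
          have : 0 < N ^ 2 := by positivity
          nlinarith
        exact (sq_le_one_iff₀ hN0.le).1 (h2.trans hx1)
      set e : (Fin (k - 1) → Fin n) → ℝ := N⁻¹ • a with he
      have he1 : ∑ J, e J ^ 2 = 1 := by
        simp only [he, Pi.smul_apply, smul_eq_mul, mul_pow, ← Finset.mul_sum, ← hN2]
        field_simp
      have hQe : Q.mulVec e = e := by rw [he, Matrix.mulVec_smul, hQa]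
      have hex : e ⬝ᵥ x = N := by
        have h1 : a ⬝ᵥ x = N ^ 2 := by rw [hN2, hax]; rfl
        rw [he, smul_dotProduct, h1, smul_eq_mul]
        field_simp
      have hee : e ⬝ᵥ e = 1 := by simpa [dotProduct, sq] using he1
      -- Revealing the image `y` of `e` adds `y eᵀ` to the known part and removes `e` from the range
      -- of the projection.
      set Q' := Q - Matrix.vecMulVec e e with hQ'
      set L' : (Fin n → ℝ) → Tensor k n := fun y I => L I + y I.1 * e I.2 with hL'
      have hunL' : ∀ y, unfold (L' y) = unfold L + Matrix.vecMulVec y e := fun y => rfl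
      have hQ't : Q'.transpose = Q' := by
        rw [hQ', Matrix.transpose_sub, hQt, Matrix.transpose_vecMulVec]
      have hvQ : Matrix.vecMulVec e e * Q = Matrix.vecMulVec e e := by
        rw [Matrix.vecMulVec_mul, ← Matrix.mulVec_transpose, hQt, hQe]
      have hQv : Q * Matrix.vecMulVec e e = Matrix.vecMulVec e e := by
        rw [Matrix.mul_vecMulVec, hQe]
      have hvv : Matrix.vecMulVec e e * Matrix.vecMulVec e e = Matrix.vecMulVec e e := by
        rw [Matrix.mul_vecMulVec, Matrix.vecMulVec_mulVec, hee]
        simp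
      have hQ'Q' : Q' * Q' = Q' := by
        rw [hQ', Matrix.sub_mul, Matrix.mul_sub, Matrix.mul_sub, hQQ, hvQ, hQv, hvv]
        abel
      -- Given `y`, the response to the current query is no longer random, so the next iterate is a
      -- function of `y` alone.
      have hQ'x : Q'.mulVec x = 0 := by
        rw [hQ', Matrix.sub_mulVec, Matrix.vecMulVec_mulVec, hex, ← ha, he]
        funext J
        simp only [Pi.sub_apply, Pi.smul_apply, smul_eq_mul, Pi.zero_apply,
          MulOpposite.smul_eq_mul_unop, MulOpposite.unop_op]
        field_simp
        ring
      set R : Tensor k n × (Fin n → ℝ) → Tensor k n := fun q I =>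
        q.1 I + (q.2 I.1 - (unfold q.1).mulVec e I.1) * e I.2 with hR
      have hRm : Measurable R := by
        refine measurable_pi_lambda _ fun I => ?_
        simp only [hR, Matrix.mulVec, dotProduct, unfold]
        fun_prop
      have hRlaw : ((noise k n).prod (gpi (Fin n) (n : ℝ≥0)⁻¹)).map R = noise k n :=
        gpi_resample (n : ℝ≥0)⁻¹ e he1
      -- The resampled matrix sends `e` to the fresh vector `y`, independent of `Z`. Conditioning on
      -- `y` leaves a problem of the same form with `L'` and `Q'`, to which the induction hypothesis
      -- applies.
      have hReff : ∀ q, effNoise L Q (R q) = effNoise (L' q.2) Q' q.1 := by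
        intro q
        have h1 : unfold (R q) = unfold q.1
            + Matrix.vecMulVec (q.2 - (unfold q.1).mulVec e) e := rfl
        have h2 : unfold (effNoise L Q (R q)) = unfold (effNoise (L' q.2) Q' q.1) := by
          rw [unfold_effNoise, unfold_effNoise, h1, hunL', hQ', Matrix.add_mul, Matrix.mul_sub,
            Matrix.mul_vecMulVec, Matrix.vecMulVec_mul, ← Matrix.mulVec_transpose, hQt, hQe,
            Matrix.sub_vecMulVec]
          abel
        funext I
        exact congrFun (congrFun h2 I.1) I.2
      have hc : ∀ q : Tensor k n × (Fin n → ℝ), contract (effNoise (L' q.2) Q' q.1) u = contract (L' q.2) u := by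
        intro q
        rw [hcon, unfold_effNoise, Matrix.add_mulVec, ← Matrix.mulVec_mulVec, hQ'x,
          Matrix.mulVec_zero, add_zero, hcon]
      have hLval : ∀ y j (z : (Fin (k - 1) → Fin n) → ℝ),
          ∑ i, v j i * (unfold (L' y)).mulVec z i
          = ∑ i, v j i * (unfold L).mulVec z i + (∑ i, v j i * y i) * (e ⬝ᵥ z) := by
        intro y j z
        rw [hunL', Matrix.add_mulVec, Matrix.vecMulVec_mulVec, Finset.sum_mul,
          ← Finset.sum_add_distrib]
        refine Finset.sum_congr rfl fun i _ => ?_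
        simp only [Pi.add_apply, Pi.smul_apply, MulOpposite.smul_eq_mul_unop,
          MulOpposite.unop_op]
        ring
      have hmeas : MeasurableSet (effNoise L Q ⁻¹' noiseExceeds v S A (T + 1) u) :=
        measurable_effNoise L Q
          ((measurable_const.prodMk measurable_id) (measurableSet_noiseExceeds v S A (T + 1)))
      rw [← hRlaw, Measure.map_apply hRm hmeas, Measure.prod_apply_symm (hRm hmeas)]
      -- Outside this event the known noise level in the directions `v j` rises by at most `h`, from
      -- `ℓ` to `ℓ + h`.
      set Bad : Set (Fin n → ℝ) := ⋃ j, {y | h < |∑ i, v j i * y i|} with hBad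
      have hBadm : MeasurableSet Bad :=
        MeasurableSet.iUnion fun j => measurableSet_lt measurable_const (by fun_prop)
      have hBadle : gpi (Fin n) (n : ℝ≥0)⁻¹ Bad ≤ r * p := by
        refine (measure_iUnion_fintype_le _ _).trans ?_
        calc ∑ j, gpi (Fin n) (n : ℝ≥0)⁻¹ {y | h < |∑ i, v j i * y i|}
            ≤ ∑ j : Fin r, p := by
              refine Finset.sum_le_sum fun j _ => (gpi_chebyshev _ _ hh).trans ?_
              have : ∑ i, v j i ^ 2 = 1 := by
                rw [← EuclideanSpace.real_norm_sq_eq, hv, one_pow]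
              rw [this, hp]
              simp
          _ = r * p := by simp
      calc ∫⁻ y, noise k n ((fun Z => (Z, y)) ⁻¹' (R ⁻¹' (effNoise L Q ⁻¹'
              noiseExceeds v S A (T + 1) u))) ∂gpi (Fin n) (n : ℝ≥0)⁻¹
          ≤ ∫⁻ y, (Bad.indicator 1 y + T * (r * p)) ∂gpi (Fin n) (n : ℝ≥0)⁻¹ := by
            refine lintegral_mono fun y => ?_
            by_cases hy : y ∈ Bad
            · rw [Set.indicator_of_mem hy]
              exact prob_le_one.trans le_self_add
            · rw [Set.indicator_of_notMem hy, zero_add]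
              have hy' : ∀ j, |∑ i, v j i * y i| ≤ h := by
                simpa [hBad] using hy
              have hL'b : ∀ j, ∀ z : (Fin (k - 1) → Fin n) → ℝ, ∑ J, z J ^ 2 ≤ 1 →
                  |∑ i, v j i * (unfold (L' y)).mulVec z i| ≤ ℓ + h := by
                intro j z hz
                rw [hLval]
                refine (abs_add_le _ _).trans (add_le_add (hL j z hz) ?_)
                rw [abs_mul]
                exact (mul_le_of_le_one_right (abs_nonneg _)
                  (sum_mul_mulVec_le he1 hz)).trans (hy' j)
              refine le_trans (measure_mono fun Z hZ => ?_)
                (ih (powerStep (S + L' y) u) (L' y) Q' (ℓ + h) (norm_powerStep_le _ _)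
                  hQ't hQ'Q' (by linarith) hL'b)
              rw [Set.mem_preimage, Set.mem_preimage, Set.mem_preimage, hReff] at hZ
              have h1 := noiseExceeds_succ_subset (Z := effNoise (L' y) Q' Z) (fun j => ?_) hZ
              · have h2 : powerStep (S + effNoise (L' y) Q' Z) u = powerStep (S + L' y) u := by
                  simp only [powerStep, contract_add, hc (Z, y)]
                rwa [h2] at h1
              · rw [hc (Z, y), hcon, hinner]
                refine (hL'b j x hx1).trans ?_
                have : 0 ≤ (T : ℝ) * h := by positivity
                linarith
        _ = gpi (Fin n) (n : ℝ≥0)⁻¹ Bad + T * (r * p) := by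
            rw [lintegral_add_right _ measurable_const, lintegral_indicator_one hBadm]
            simp
        _ ≤ r * p + T * (r * p) := by gcongr
        _ = ((T + 1 : ℕ) : ℝ≥0∞) * (r * p) := by
            push_cast
            ring

/-- Along the first `T` steps of power iteration, the noise in the directions `v j` is at most
`T h`, up to a small probability. -/
lemma noise_exceeds_le {r : ℕ} {v : Fin r → Vec n} (hv : ∀ j, ‖v j‖ = 1) (S : Tensor k n)
    {h : ℝ} (hh : 0 < h) (T : ℕ) {u : Vec n} (hu : ‖u‖ ≤ 1) :
    noise k n (noiseExceeds v S (T * h) T u)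
      ≤ T * (r * ENNReal.ofReal ((n : ℝ)⁻¹ / h ^ 2)) := by
  have h1 := noise_effNoise_exceeds_le hv S hh (A := T * h) T u 0 1 0 hu (by simp) (by simp)
    (by simp) (by intro j x _; simp [unfold, Matrix.mulVec, dotProduct])
  have h2 : effNoise (k := k) (n := n) 0 1 = id := by
    funext Z I
    simp [effNoise, unfold]
  rwa [h2, Set.preimage_id] at h1

end Adaptive

/-! ### Nets of the unit ball and norms of multilinear maps -/

section Nets

variable {E : Type*} [NormedAddCommGroup E] [NormedSpace ℝ E]

/-- The unit ball has a `1/2`-net of cardinality at most `5 ^ dim`. -/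
lemma exists_half_net [FiniteDimensional ℝ E] :
    ∃ N : Finset E, N.card ≤ 5 ^ Module.finrank ℝ E ∧ (∀ c ∈ N, ‖c‖ ≤ 1) ∧
      ∀ x : E, ‖x‖ ≤ 1 → ∃ c ∈ N, ‖x - c‖ ≤ 1 / 2 := by
  classical
  -- `Besicovitch.card_le_of_separated` concerns 1-separated subsets of the ball of radius 2, so the
  -- net is built at twice its scale and halved at the end. A separated set of maximal cardinality
  -- is a net.
  set P : ℕ → Prop := fun m => ∃ s : Finset E, (∀ c ∈ s, ‖c‖ ≤ 2) ∧
    (∀ c ∈ s, ∀ d ∈ s, c ≠ d → 1 ≤ ‖c - d‖) ∧ s.card = m with hP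
  have h0 : P 0 := ⟨∅, by simp, by simp, rfl⟩
  obtain ⟨s, hs2, hsep, hcard⟩ := Nat.findGreatest_spec (P := P)
    (Nat.zero_le (5 ^ Module.finrank ℝ E)) h0
  have hmax : ∀ s' : Finset E, (∀ c ∈ s', ‖c‖ ≤ 2) →
      (∀ c ∈ s', ∀ d ∈ s', c ≠ d → 1 ≤ ‖c - d‖) → s'.card ≤ s.card := by
    intro s' h1 h2
    rw [hcard]
    exact Nat.le_findGreatest (Besicovitch.card_le_of_separated s' h1 h2) ⟨s', h1, h2, rfl⟩
  refine ⟨s.image fun c => (1 / 2 : ℝ) • c,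
    Finset.card_image_le.trans (Besicovitch.card_le_of_separated s hs2 hsep), ?_, ?_⟩
  · intro c hc
    obtain ⟨d, hd, rfl⟩ := Finset.mem_image.1 hc
    rw [norm_smul]
    have := hs2 d hd
    norm_num
    linarith
  · intro x hx
    have h2x : ‖(2 : ℝ) • x‖ ≤ 2 := by
      rw [norm_smul]
      norm_num
      linarith
    by_cases hmem : ∃ d ∈ s, ‖(2 : ℝ) • x - d‖ < 1
    · obtain ⟨d, hd, hlt⟩ := hmem
      refine ⟨(1 / 2 : ℝ) • d, Finset.mem_image_of_mem _ hd, ?_⟩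
      have : x - (1 / 2 : ℝ) • d = (1 / 2 : ℝ) • ((2 : ℝ) • x - d) := by
        rw [smul_sub, smul_smul]
        norm_num
      rw [this, norm_smul]
      norm_num
      linarith
    · push Not at hmem
      have hnot : (2 : ℝ) • x ∉ s := fun h => by
        have := hmem _ h
        rw [sub_self, norm_zero] at this
        linarith
      have := hmax (insert ((2 : ℝ) • x) s) ?_ ?_
      · rw [Finset.card_insert_of_notMem hnot] at this
        omega
      · intro c hc
        rcases Finset.mem_insert.1 hc with rfl | hc
        · exact h2x
        · exact hs2 c hc
      · intro c hc d hd hcd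
        rcases Finset.mem_insert.1 hc with rfl | hc <;> rcases Finset.mem_insert.1 hd with rfl | hd
        · exact absurd rfl hcd
        · exact hmem d hd
        · rw [norm_sub_rev]
          exact hmem c hc
        · exact hsep c hc d hd hcd

/-- Moving a unit vector to the net changes the value by at most `‖f‖ / 2`, and this can be absorbed
into the left side. -/
lemma norm_le_of_half_net {N : Finset E} (hN : ∀ x : E, ‖x‖ ≤ 1 → ∃ c ∈ N, ‖x - c‖ ≤ 1 / 2)
    (f : E →L[ℝ] ℝ) {A : ℝ} (hA : ∀ c ∈ N, |f c| ≤ A) : ‖f‖ ≤ 2 * A := by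
  have hA0 : 0 ≤ A := by
    obtain ⟨c, hc, _⟩ := hN 0 (by simp)
    exact (abs_nonneg _).trans (hA c hc)
  have h : ‖f‖ ≤ A + ‖f‖ / 2 := by
    refine f.opNorm_le_of_unit_norm (by positivity) fun x hx => ?_
    obtain ⟨c, hc, hxc⟩ := hN x hx.le
    have h1 : f x = f c + f (x - c) := by rw [← map_add]; congr 1; abel
    rw [h1]
    refine (norm_add_le _ _).trans (add_le_add (hA c hc) ((f.le_opNorm _).trans ?_))
    have := mul_le_mul_of_nonneg_left hxc (norm_nonneg f)
    linarith
  linarith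

/-- The slots are released from the net one at a time. With the other slots frozen the map is a
linear functional, so each release costs a factor 2; `S` is the set of released slots. -/
lemma multilinear_le_of_half_net {ι : Type*} [Fintype ι] [DecidableEq ι] {N : Finset E}
    (hN1 : ∀ c ∈ N, ‖c‖ ≤ 1) (hN : ∀ x : E, ‖x‖ ≤ 1 → ∃ c ∈ N, ‖x - c‖ ≤ 1 / 2)
    (f : ContinuousMultilinearMap ℝ (fun _ : ι => E) ℝ) {A : ℝ}
    (hA : ∀ x : ι → E, (∀ s, x s ∈ N) → |f x| ≤ A) (S : Finset ι) :
    ∀ x : ι → E, (∀ s, ‖x s‖ ≤ 1) → (∀ s, s ∉ S → x s ∈ N) → |f x| ≤ 2 ^ S.card * A := by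
  induction S using Finset.induction_on with
  | empty =>
    intro x _ hx
    simpa using hA x fun s => hx s (by simp)
  | insert s S hs ih =>
    intro x hx1 hx
    have h1 : ‖f.toContinuousLinearMap x s‖ ≤ 2 * (2 ^ S.card * A) := by
      refine norm_le_of_half_net hN _ fun c hc => ?_
      refine ih (Function.update x s c) (fun s' => ?_) (fun s' hs' => ?_)
      · by_cases h : s' = s
        · subst h
          simpa using hN1 c hc
        · simpa [h] using hx1 s'
      · by_cases h : s' = s
        · subst h
          simpa using hc
        · simpa [h] using hx s' (by simp [h, hs'])
    have h2 := (f.toContinuousLinearMap x s).le_opNorm (x s)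
    have h3 : f.toContinuousLinearMap x s (x s) = f x := by
      simp
    rw [h3, Real.norm_eq_abs] at h2
    rw [Finset.card_insert_of_notMem hs]
    calc |f x| ≤ ‖f.toContinuousLinearMap x s‖ * ‖x s‖ := h2
      _ ≤ ‖f.toContinuousLinearMap x s‖ * 1 := by gcongr; exact hx1 s
      _ ≤ 2 * (2 ^ S.card * A) := by rw [mul_one]; exact h1
      _ = 2 ^ (S.card + 1) * A := by ring

/-- Each nonzero slot is normalised; if some slot is zero, so is the value. -/
lemma opNorm_le_of_unit_ball {ι : Type*} [Fintype ι] {G : Type*} [NormedAddCommGroup G]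
    [NormedSpace ℝ G] (f : ContinuousMultilinearMap ℝ (fun _ : ι => E) G) {C : ℝ} (hC : 0 ≤ C)
    (h : ∀ x : ι → E, (∀ s, ‖x s‖ ≤ 1) → ‖f x‖ ≤ C) : ‖f‖ ≤ C := by
  refine ContinuousMultilinearMap.opNorm_le_bound hC fun x => ?_
  by_cases h0 : ∃ s, x s = 0
  · obtain ⟨s, hs⟩ := h0
    rw [f.map_coord_zero s hs, norm_zero]
    positivity
  · push Not at h0
    have h1 : x = fun s => ‖x s‖ • (‖x s‖⁻¹ • x s) := by
      funext s
      rw [smul_smul, mul_inv_cancel₀ (norm_ne_zero_iff.2 (h0 s)), one_smul]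
    conv_lhs => rw [h1]
    rw [f.map_smul_univ, norm_smul, Real.norm_eq_abs,
      abs_of_nonneg (Finset.prod_nonneg fun s _ => norm_nonneg _), mul_comm]
    refine mul_le_mul_of_nonneg_right (h _ fun s => ?_)
      (Finset.prod_nonneg fun s _ => norm_nonneg _)
    rw [norm_smul, norm_inv, norm_norm]
    exact inv_mul_le_one

end Nets

/-! ### The injective norm of the noise tensor -/

section InjectiveNorm

variable {k n : ℕ}

/-- A bound for the injective norm of the noise tensor. -/
def injBound (k : ℕ) : ℝ := 2 ^ (k + 1) * (2 * k + 2)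

lemma injBound_pos (k : ℕ) : 0 < injBound k := by
  unfold injBound
  positivity

/-- The input slots are released from the net by multilinearity, and the output direction `a`
afterwards as a linear functional. -/
lemma norm_tensorMap_le_of_net {N : Finset (Vec n)}
    (hN1 : ∀ c ∈ N, ‖c‖ ≤ 1) (hN : ∀ x : Vec n, ‖x‖ ≤ 1 → ∃ c ∈ N, ‖x - c‖ ≤ 1 / 2)
    (Z : Tensor k n) {A : ℝ} (hA0 : 0 ≤ A)
    (hA : ∀ a ∈ N, ∀ x : Fin (k - 1) → Vec n, (∀ s, x s ∈ N) →
      |inner ℝ a (tensorMap Z x)| ≤ A) : ‖tensorMap Z‖ ≤ 2 ^ k * A * 2 := by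
  refine opNorm_le_of_unit_ball _ (by positivity) fun x hx => ?_
  have h1 : ∀ c ∈ N, |innerSL ℝ (tensorMap Z x) c| ≤ 2 ^ k * A := by
    intro c hc
    have h2 := multilinear_le_of_half_net hN1 hN
      ((innerSL ℝ c).compContinuousMultilinearMap (tensorMap Z)) (A := A)
      (fun x hx => hA c hc x hx) Finset.univ x hx (by simp)
    rw [innerSL_apply_apply, real_inner_comm]
    refine h2.trans ?_
    rw [Finset.card_univ, Fintype.card_fin]
    have : (2 : ℝ) ^ (k - 1) ≤ 2 ^ k := pow_le_pow_right₀ (by norm_num) (Nat.sub_le _ _)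
    gcongr
  have h3 := norm_le_of_half_net hN _ h1
  rw [innerSL_apply_norm] at h3
  linarith

/-- The injective norm of the noise tensor is bounded, up to an exponentially small
probability. -/
lemma noise_injNorm_le (hk : 1 ≤ k) (hn : 0 < n) :
    noise k n {Z | injBound k < ‖tensorMap Z‖} ≤ ENNReal.ofReal (2 * Real.exp (-n)) := by
  classical
  obtain ⟨N, hcard, hN1, hN⟩ := exists_half_net (E := Vec n)
  rw [finrank_euclideanSpace_fin] at hcard
  -- With this threshold the Gaussian exponent `n A² / 2 = 2 n (k + 1)²` exceeds the entropy `2 n k`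
  -- of the `k`-fold product of the net by at least `n`.
  set A : ℝ := 2 * k + 2 with hA
  have hA0 : 0 ≤ A := by positivity
  set I := N ×ˢ Fintype.piFinset (fun _ : Fin (k - 1) => N) with hI
  have hIcard : (I.card : ℝ) ≤ Real.exp (2 * n * k) := by
    rw [hI, Finset.card_product, Fintype.card_piFinset]
    simp only [Finset.prod_const, Finset.card_univ, Fintype.card_fin]
    rw [← pow_succ', Nat.sub_add_cancel hk]
    push_cast
    have h5 : (5 : ℝ) ≤ Real.exp 2 := by
      have h1 := Real.add_one_le_exp (1 : ℝ)
      have h2 := Real.exp_one_gt_d9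
      have h3 : Real.exp 2 = Real.exp 1 * Real.exp 1 := by rw [← Real.exp_add]; norm_num
      rw [h3]
      nlinarith
    calc (N.card : ℝ) ^ k ≤ ((5 : ℝ) ^ n) ^ k := by
          gcongr
          exact_mod_cast hcard
      _ ≤ (Real.exp 2 ^ n) ^ k := by gcongr
      _ = Real.exp (2 * n * k) := by
          rw [← Real.exp_nat_mul, ← Real.exp_nat_mul]
          congr 1
          ring
  have hsub : {Z : Tensor k n | injBound k < ‖tensorMap Z‖} ⊆
      ⋃ p ∈ I, ({Z : Tensor k n | A ≤ inner ℝ p.1 (tensorMap Z p.2)} ∪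
        {Z | A ≤ inner ℝ (-p.1) (tensorMap Z p.2)}) := by
    intro Z hZ
    by_contra hcon
    simp only [Set.mem_iUnion, not_exists, Set.mem_union, Set.mem_ofPred_eq, not_or, not_le,
      inner_neg_left] at hcon
    refine absurd hZ (not_lt.2 ((norm_tensorMap_le_of_net hN1 hN Z hA0 ?_).trans
      (by unfold injBound; rw [hA, pow_succ]; linarith)))
    intro a ha x hx
    have := hcon (a, x) (Finset.mem_product.2 ⟨ha, Fintype.mem_piFinset.2 hx⟩)
    exact abs_le.2 ⟨by linarith [this.2], this.1.le⟩
  have htail : ∀ (a : Vec n) (x : Fin (k - 1) → Vec n), ‖a‖ ≤ 1 → (∀ s, ‖x s‖ ≤ 1) →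
      noise k n {Z | A ≤ inner ℝ a (tensorMap Z x)}
        ≤ ENNReal.ofReal (Real.exp (-(n * A ^ 2 / 2))) := by
    intro a x ha hx
    simp only [inner_tensorMap]
    have h1 := gpi_tail (ι := Fin n × (Fin (k - 1) → Fin n)) (s := (n : ℝ≥0)⁻¹) (by positivity)
      (fun I => a I.1 * tprodVec x I.2) ?_ hA0
    · refine h1.trans (ENNReal.ofReal_le_ofReal (Real.exp_le_exp.2 (le_of_eq ?_)))
      simp only [NNReal.coe_inv, NNReal.coe_natCast]
      have : (n : ℝ) ≠ 0 := by positivity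
      field_simp
    · rw [sum_sq_coeff]
      refine mul_le_one₀ (pow_le_one₀ (norm_nonneg _) ha) (by positivity) ?_
      exact Finset.prod_le_one (fun s _ => by positivity)
        fun s _ => pow_le_one₀ (norm_nonneg _) (hx s)
  calc noise k n {Z | injBound k < ‖tensorMap Z‖}
      ≤ ∑ p ∈ I, noise k n ({Z : Tensor k n | A ≤ inner ℝ p.1 (tensorMap Z p.2)} ∪
        {Z | A ≤ inner ℝ (-p.1) (tensorMap Z p.2)}) :=
        (measure_mono hsub).trans (measure_biUnion_finset_le _ _)
    _ ≤ ∑ p ∈ I, (ENNReal.ofReal (Real.exp (-(n * A ^ 2 / 2)))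
          + ENNReal.ofReal (Real.exp (-(n * A ^ 2 / 2)))) := by
        refine Finset.sum_le_sum fun p hp => (measure_union_le _ _).trans ?_
        have hp1 := Finset.mem_product.1 hp
        have hp2 := Fintype.mem_piFinset.1 hp1.2
        exact add_le_add (htail _ _ (hN1 _ hp1.1) fun s => hN1 _ (hp2 s))
          (htail _ _ (by rw [norm_neg]; exact hN1 _ hp1.1) fun s => hN1 _ (hp2 s))
    _ = ENNReal.ofReal (I.card * (2 * Real.exp (-(n * A ^ 2 / 2)))) := by
        rw [Finset.sum_const, nsmul_eq_mul, ENNReal.ofReal_mul (by positivity),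
          ENNReal.ofReal_natCast, ← ENNReal.ofReal_add (by positivity) (by positivity), two_mul]
    _ ≤ ENNReal.ofReal (2 * Real.exp (-n)) := by
        refine ENNReal.ofReal_le_ofReal ?_
        calc (I.card : ℝ) * (2 * Real.exp (-(n * A ^ 2 / 2)))
            ≤ Real.exp (2 * n * k) * (2 * Real.exp (-(n * A ^ 2 / 2))) := by gcongr
          _ = 2 * Real.exp (2 * n * k + -(n * A ^ 2 / 2)) := by rw [Real.exp_add]; ring
          _ ≤ 2 * Real.exp (-n) := by
            have hk' : (1 : ℝ) ≤ k := by exact_mod_cast hk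
            have hn' : (1 : ℝ) ≤ n := by exact_mod_cast hn
            have : 2 * (n : ℝ) * k + -(n * A ^ 2 / 2) = n * (2 * k - 2 * (k + 1) ^ 2) := by
              rw [hA]; ring
            have h2 : (2 * (k : ℝ) - 2 * (k + 1) ^ 2) ≤ -1 := by nlinarith
            gcongr
            rw [this]
            nlinarith

end InjectiveNorm

/-! ### Concentration of first- and second-order noise terms -/

section NoiseConcentration

variable {k n : ℕ}

lemma noise_inner_le (a : Vec n) (x : Fin (k - 1) → Vec n) (ha : ‖a‖ ≤ 1)
    (hx : ∀ s, ‖x s‖ ≤ 1) {h : ℝ} (hh : 0 < h) :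
    noise k n {Z | h < |inner ℝ a (tensorMap Z x)|} ≤ ENNReal.ofReal ((n * h ^ 2)⁻¹) := by
  simp only [inner_tensorMap]
  refine (gpi_chebyshev _ _ hh).trans (ENNReal.ofReal_le_ofReal ?_)
  rw [sum_sq_coeff]
  have h1 : ‖a‖ ^ 2 * ∏ s, ‖x s‖ ^ 2 ≤ 1 :=
    mul_le_one₀ (pow_le_one₀ (norm_nonneg _) ha) (by positivity)
      (Finset.prod_le_one (fun s _ => by positivity)
        fun s _ => pow_le_one₀ (norm_nonneg _) (hx s))
  rw [mul_inv, div_eq_mul_inv]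
  gcongr
  simp only [NNReal.coe_inv, NNReal.coe_natCast]
  exact mul_le_of_le_one_right (by positivity) h1

/-- The variance of the square of a standard Gaussian. -/
noncomputable def varSq : ℝ := Var[fun x => x ^ 2; gaussianReal 0 1]

lemma memLp_sq_gaussianReal (s : ℝ≥0) : MemLp (fun x : ℝ => x ^ 2) 2 (gaussianReal 0 s) := by
  have h : MemLp (id : ℝ → ℝ) 4 (gaussianReal 0 s) := memLp_id_gaussianReal' 4 (by simp)
  have h2 := MemLp.norm_rpow_div h 2
  have h3 : (4 : ℝ≥0∞) / 2 = 2 := by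
    rw [show (4 : ℝ≥0∞) = 2 * 2 by norm_num]
    exact ENNReal.mul_div_cancel_right (by simp) (by simp)
  rw [h3] at h2
  refine h2.congr_norm (by fun_prop) (Filter.Eventually.of_forall fun x => ?_)
  simp

lemma variance_sq_gaussianReal (s : ℝ≥0) :
    Var[fun x => x ^ 2; gaussianReal 0 s] = s ^ 2 * varSq := by
  have h1 : gaussianReal 0 s = (gaussianReal 0 1).map (fun x => Real.sqrt s * x) := by
    rw [gaussianReal_map_const_mul]
    congr 1
    · simp
    · ext
      simp
  rw [h1, variance_map (by fun_prop) (by fun_prop)]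
  have h2 : (fun x : ℝ => x ^ 2) ∘ (fun x => Real.sqrt s * x) = fun x => (s : ℝ) * x ^ 2 := by
    funext x
    simp [mul_pow, Real.sq_sqrt]
  rw [h2, variance_const_mul]
  rfl

lemma integral_sq_gaussianReal (s : ℝ≥0) : ∫ x, x ^ 2 ∂gaussianReal 0 s = s := by
  have h := variance_eq_sub (memLp_id_gaussianReal (μ := 0) (v := s) 2)
  rw [variance_id_gaussianReal] at h
  simpa [integral_id_gaussianReal] using h.symm

/-- Chebyshev's inequality: the squares are independent, each of variance `varSq / n²`. -/
lemma gpi_sum_sq_le (hn : 0 < n) {h : ℝ} (hh : 0 < h) :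
    gpi (Fin n) (n : ℝ≥0)⁻¹ {y | h < |∑ i, y i ^ 2 - 1|}
      ≤ ENNReal.ofReal (varSq / (n * h ^ 2)) := by
  have hn' : (n : ℝ) ≠ 0 := by positivity
  set μ := gpi (Fin n) (n : ℝ≥0)⁻¹
  set X : Fin n → (Fin n → ℝ) → ℝ := fun i y => y i ^ 2 with hX
  have hmem : ∀ i, MemLp (X i) 2 μ := fun i =>
    (memLp_sq_gaussianReal (n : ℝ≥0)⁻¹).comp_measurePreserving
      (measurePreserving_eval (fun _ : Fin n => gaussianReal 0 (n : ℝ≥0)⁻¹) i)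
  have hvar : Var[∑ i, X i; μ] = varSq / n := by
    have := variance_sum_pi (μ := fun _ : Fin n => gaussianReal 0 (n : ℝ≥0)⁻¹)
      (X := fun _ x => x ^ 2) (fun i => memLp_sq_gaussianReal _)
    simp only [variance_sq_gaussianReal, Finset.sum_const, Finset.card_univ, Fintype.card_fin,
      nsmul_eq_mul, NNReal.coe_inv, NNReal.coe_natCast] at this
    refine Eq.trans ?_ (this.trans ?_)
    · congr 1
    · field_simp
  have hint : ∫ y, (∑ i, X i) y ∂μ = 1 := by
    simp only [Finset.sum_apply]
    rw [integral_finsetSum _ fun i _ => (hmem i).integrable (by norm_num)]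
    have : ∀ i, ∫ y, X i y ∂μ = (n : ℝ)⁻¹ := by
      intro i
      have h1 := (measurePreserving_eval (fun _ : Fin n => gaussianReal 0 (n : ℝ≥0)⁻¹) i).map_eq
      have h2 := integral_sq_gaussianReal (n : ℝ≥0)⁻¹
      rw [← h1, integral_map (measurable_pi_apply i).aemeasurable (by fun_prop)] at h2
      simpa using h2
    simp [this, hn']
  have h1 := meas_ge_le_variance_div_sq (memLp_finsetSum' Finset.univ fun i _ => hmem i) hh
  rw [hvar, hint] at h1
  refine le_trans (measure_mono fun y hy => ?_) (h1.trans (ENNReal.ofReal_le_ofReal ?_))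
  · simp only [Set.mem_ofPred_eq, Finset.sum_apply, hX] at hy ⊢
    exact hy.le
  · rw [div_div]

/-- The vector `Z[w^{⊗(k-1)}]` has norm close to one. -/
lemma noise_sq_norm_contract_le (hn : 0 < n) (w : Vec n) (hw : ‖w‖ = 1) {h : ℝ} (hh : 0 < h) :
    noise k n {Z | h < |‖contract Z w‖ ^ 2 - 1|} ≤ ENNReal.ofReal (varSq / (n * h ^ 2)) := by
  have hm : Measurable fun Z : Tensor k n => WithLp.ofLp (contract Z w) := by
    refine measurable_pi_lambda _ fun i => ?_
    simp only [contract]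
    fun_prop
  refine le_trans ?_ (gpi_sum_sq_le hn hh)
  rw [← noise_map_contract w hw, Measure.map_apply hm (measurableSet_lt measurable_const
    (by fun_prop))]
  refine measure_mono fun Z hZ => ?_
  simp only [Set.mem_ofPred_eq, EuclideanSpace.real_norm_sq_eq, Set.mem_preimage] at hZ ⊢
  exact hZ

lemma measurable_tensorMap_inner {α : Type*} [MeasurableSpace α] (a : Vec n)
    {f : α → Tensor k n} {x : α → Fin (k - 1) → Vec n} (hf : Measurable f)
    (hx : ∀ s, Measurable fun ω => x ω s) :
    Measurable fun ω => inner ℝ a (tensorMap (f ω) (x ω)) := by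
  have : ∀ s i, Measurable fun ω => x ω s i := fun s i => by
    have := hx s
    fun_prop
  simp only [inner_tensorMap, tprodVec]
  fun_prop

/-- The second-order terms `⟨a, Z[w, …, ξ, …, w]⟩`, where `ξ = Z[w^{⊗(k-1)}]`, are small. -/
lemma noise_second_order_le (a w : Vec n) (ha : ‖a‖ ≤ 1) (hw : ‖w‖ = 1)
    (s : Fin (k - 1)) {h M : ℝ} (hh : 0 < h) :
    noise k n {Z | ‖contract Z w‖ ≤ M ∧ |inner ℝ a (contract Z w)| ≤ h ∧
      (1 + M) * h < |inner ℝ a (tensorMap Z (Function.update (fun _ => w) s (contract Z w)))|}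
      ≤ ENNReal.ofReal (M ^ 2 / (n * h ^ 2)) := by
  set e := tprodVec (fun _ : Fin (k - 1) => w) with he
  have he1 : ∑ J, e J ^ 2 = 1 := by
    rw [he, sum_tprodVec_sq]
    simp [hw]
  -- In the term to be bounded, `ξ = Z[w^{⊗(k-1)}]` is itself fed into `Z`. Resampling installs an
  -- independent vector as `ξ`, so that it can be fixed before the rest of `Z` is drawn.
  set R : Tensor k n × (Fin n → ℝ) → Tensor k n := fun q I =>
    q.1 I + (q.2 I.1 - (unfold q.1).mulVec e I.1) * e I.2 with hR
  have hRm : Measurable R := by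
    refine measurable_pi_lambda _ fun I => ?_
    simp only [hR, Matrix.mulVec, dotProduct, unfold]
    fun_prop
  have hRlaw : ((noise k n).prod (gpi (Fin n) (n : ℝ≥0)⁻¹)).map R = noise k n :=
    gpi_resample (n : ℝ≥0)⁻¹ e he1
  have hcm : Measurable fun Z : Tensor k n => contract Z w :=
    measurable_contract.comp (measurable_id.prodMk measurable_const)
  set B : Set (Tensor k n) := {Z | ‖contract Z w‖ ≤ M ∧ |inner ℝ a (contract Z w)| ≤ h ∧
      (1 + M) * h < |inner ℝ a (tensorMap Z (Function.update (fun _ => w) s (contract Z w)))|}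
    with hB
  have hBm : MeasurableSet B := by
    refine (measurableSet_le hcm.norm measurable_const).inter
      ((measurableSet_le (f := fun Z => |inner ℝ a (contract Z w)|) (g := fun _ => h)
        ((measurable_const (a := a)).inner hcm).abs measurable_const).inter
        (measurableSet_lt (f := fun _ => (1 + M) * h) (g := fun Z => |inner ℝ a (tensorMap Z
          (Function.update (fun _ => w) s (contract Z w)))|) measurable_const ?_))
    refine (measurable_tensorMap_inner a measurable_id fun s' => ?_).abs
    by_cases hs : s' = s
    · subst hs
      simpa using hcm
    · simp only [Function.update_of_ne hs]
      exact measurable_const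
  have hRe : ∀ q, unfold (R q) = unfold q.1 + Matrix.vecMulVec (q.2 - (unfold q.1).mulVec e) e :=
    fun q => rfl
  have hee : e ⬝ᵥ e = 1 := by simpa [dotProduct, sq] using he1
  have hval : ∀ q x, tensorMap (R q) x = tensorMap q.1 x
      + (e ⬝ᵥ tprodVec x) • (WithLp.toLp 2 q.2 - tensorMap q.1 fun _ => w) := by
    intro q x
    rw [tensorMap_eq_mulVec, hRe, Matrix.add_mulVec, Matrix.vecMulVec_mulVec]
    ext i
    simp [tensorMap_eq_mulVec, he]
  have hcon : ∀ q, contract (R q) w = WithLp.toLp 2 q.2 := by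
    intro q
    rw [contract_eq, hval, ← he, hee, one_smul]
    abel
  rw [← hRlaw, Measure.map_apply hRm hBm, Measure.prod_apply_symm (hRm hBm)]
  have hsec : ∀ y : Fin n → ℝ,
      noise k n ((fun Z => (Z, y)) ⁻¹' (R ⁻¹' B)) ≤ ENNReal.ofReal (M ^ 2 / (n * h ^ 2)) := by
    intro y
    set Y : Vec n := WithLp.toLp 2 y with hY
    set x : Fin (k - 1) → Vec n := Function.update (fun _ => w) s Y with hx
    -- For fixed `ξ = Y` the term is a centred Gaussian of variance at most `M² / n` plus the
    -- constant `⟨w, Y⟩ ⟨a, Y⟩`, of modulus at most `M h`. Hence the threshold `(1 + M) h`.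
    have hsub : ((fun Z => (Z, y)) ⁻¹' (R ⁻¹' B)) ⊆ {Z | ‖Y‖ ≤ M ∧ h < |∑ I : Fin n × (Fin (k - 1) → Fin n),
        (a I.1 * (tprodVec x I.2 - inner ℝ w Y * e I.2)) * Z I|} := by
      intro Z hZ
      rw [Set.mem_preimage, Set.mem_preimage, hB, Set.mem_ofPred_eq, hcon] at hZ
      obtain ⟨h1, h2, h3⟩ := hZ
      refine ⟨h1, ?_⟩
      have hex : e ⬝ᵥ tprodVec x = inner ℝ w Y := by
        have := sum_tprodVec_mul (fun _ : Fin (k - 1) => w) x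
        rw [dotProduct, he, this, ← Finset.mul_prod_erase _ _ (Finset.mem_univ s), hx,
          Function.update_self, Finset.prod_eq_one, mul_one]
        intro s' hs'
        rw [Function.update_of_ne (Finset.ne_of_mem_erase hs'), real_inner_self_eq_norm_sq, hw,
          one_pow]
      have h4 : inner ℝ a (tensorMap (R (Z, y)) x)
          = ∑ I : Fin n × (Fin (k - 1) → Fin n),
            (a I.1 * (tprodVec x I.2 - inner ℝ w Y * e I.2)) * Z I + inner ℝ w Y * inner ℝ a Y := by
        rw [hval, hex, inner_add_right, inner_smul_right, inner_sub_right, inner_tensorMap,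
          inner_tensorMap, mul_sub, Finset.mul_sum]
        have : ∑ I : Fin n × (Fin (k - 1) → Fin n),
            (a I.1 * (tprodVec x I.2 - inner ℝ w Y * e I.2)) * Z I
            = ∑ I : Fin n × (Fin (k - 1) → Fin n), a I.1 * tprodVec x I.2 * Z I
              - ∑ I : Fin n × (Fin (k - 1) → Fin n), inner ℝ w Y * (a I.1 * e I.2 * Z I) := by
          rw [← Finset.sum_sub_distrib]
          exact Finset.sum_congr rfl fun I _ => by ring
        rw [this, he]
        ring
      rw [h4] at h3
      have h5 : |inner ℝ w Y * inner ℝ a Y| ≤ M * h := by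
        rw [abs_mul]
        refine mul_le_mul ?_ h2 (abs_nonneg _) ((norm_nonneg _).trans h1)
        refine (abs_real_inner_le_norm _ _).trans ?_
        rw [hw, one_mul]
        exact h1
      have h6 := abs_add_le (∑ I : Fin n × (Fin (k - 1) → Fin n),
            (a I.1 * (tprodVec x I.2 - inner ℝ w Y * e I.2)) * Z I) (inner ℝ w Y * inner ℝ a Y)
      show h < _
      linarith
    by_cases hYM : ‖Y‖ ≤ M
    · refine (measure_mono (hsub.trans fun Z hZ => hZ.2)).trans
        ((gpi_chebyshev _ _ hh).trans (ENNReal.ofReal_le_ofReal ?_))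
      have h7 : ∑ J, (tprodVec x J - inner ℝ w Y * e J) ^ 2 ≤ M ^ 2 := by
        have h8 : ∑ J, tprodVec x J * e J = inner ℝ w Y := by
          have := sum_tprodVec_mul x (fun _ : Fin (k - 1) => w)
          rw [he, this, ← Finset.mul_prod_erase _ _ (Finset.mem_univ s), hx,
            Function.update_self, Finset.prod_eq_one, mul_one, real_inner_comm]
          intro s' hs'
          rw [Function.update_of_ne (Finset.ne_of_mem_erase hs'), real_inner_self_eq_norm_sq, hw,
            one_pow]
        have h9 : ∑ J, tprodVec x J ^ 2 = ‖Y‖ ^ 2 := by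
          rw [sum_tprodVec_sq, ← Finset.mul_prod_erase _ _ (Finset.mem_univ s), hx,
            Function.update_self, Finset.prod_eq_one, mul_one]
          intro s' hs'
          rw [Function.update_of_ne (Finset.ne_of_mem_erase hs'), hw, one_pow]
        have h10 : ∑ J, (tprodVec x J - inner ℝ w Y * e J) ^ 2
            = ∑ J, tprodVec x J ^ 2 - 2 * inner ℝ w Y * ∑ J, tprodVec x J * e J
              + inner ℝ w Y ^ 2 * ∑ J, e J ^ 2 := by
          rw [Finset.mul_sum, Finset.mul_sum, ← Finset.sum_sub_distrib, ← Finset.sum_add_distrib]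
          exact Finset.sum_congr rfl fun J _ => by ring
        rw [h10, h8, h9, he1]
        have : ‖Y‖ ^ 2 ≤ M ^ 2 := by gcongr
        nlinarith [sq_nonneg (inner ℝ w Y)]
      have h11 : ∑ I : Fin n × (Fin (k - 1) → Fin n),
          (a I.1 * (tprodVec x I.2 - inner ℝ w Y * e I.2)) ^ 2 ≤ M ^ 2 := by
        simp only [mul_pow, Fintype.sum_prod_type, ← Finset.mul_sum, ← Finset.sum_mul]
        rw [← EuclideanSpace.real_norm_sq_eq]
        refine le_trans ?_ h7
        exact mul_le_of_le_one_left (Finset.sum_nonneg fun J _ => sq_nonneg _)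
          (pow_le_one₀ (norm_nonneg _) ha)
      rw [← div_div]
      simp only [NNReal.coe_inv, NNReal.coe_natCast]
      gcongr
      rw [inv_mul_eq_div]
      gcongr
    · refine le_trans (le_of_eq ?_) zero_le
      refine measure_mono_null (t := ∅) (fun Z hZ => absurd (hsub hZ).1 hYM) measure_empty
  calc ∫⁻ y, noise k n ((fun Z => (Z, y)) ⁻¹' (R ⁻¹' B)) ∂gpi (Fin n) (n : ℝ≥0)⁻¹
      ≤ ∫⁻ _, ENNReal.ofReal (M ^ 2 / (n * h ^ 2)) ∂gpi (Fin n) (n : ℝ≥0)⁻¹ :=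
        lintegral_mono hsec
    _ = _ := by simp

end NoiseConcentration

/-! ### From the uniform distribution on the sphere to the Gaussian one -/

section Sphere

variable {n : ℕ}

/-- The unnormalized Gaussian measure on `ℝⁿ`. -/
noncomputable def gaussDens (n : ℕ) : Measure (Vec n) :=
  volume.withDensity fun x => ENNReal.ofReal (Real.exp (-‖x‖ ^ 2 / 2))

lemma integrable_exp_neg_sq_norm :
    Integrable (fun x : Vec n => Real.exp (-‖x‖ ^ 2 / 2)) := by
  have h := GaussianFourier.integrable_cexp_neg_mul_sq_norm_add_of_euclideanSpace (ι := Fin n)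
    (b := 1 / 2) (by norm_num) 0 0
  refine h.re.congr (Filter.Eventually.of_forall fun x => ?_)
  have : (-(1 / 2 : ℂ) * (‖x‖ : ℂ) ^ 2 + 0 * ((inner ℝ (0 : Vec n) x : ℝ) : ℂ))
      = ((-‖x‖ ^ 2 / 2 : ℝ) : ℂ) := by
    push_cast
    ring
  simp only [this]
  exact Complex.exp_ofReal_re _

instance : IsFiniteMeasure (gaussDens n) := by
  refine isFiniteMeasure_withDensity_ofReal ?_
  exact integrable_exp_neg_sq_norm.2

lemma charFun_gaussDens (t : Vec n) :
    charFun (gaussDens n) t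
      = (Real.pi / (1 / 2 : ℂ)) ^ (n / 2 : ℂ) * Complex.exp (-‖t‖ ^ 2 / 2) := by
  have h := GaussianFourier.integral_cexp_neg_mul_sq_norm_add_of_euclideanSpace (ι := Fin n)
    (b := 1 / 2) (by norm_num) Complex.I t
  rw [Fintype.card_fin] at h
  have h2 : Complex.I ^ 2 * (‖t‖ : ℂ) ^ 2 / (4 * (1 / 2)) = -‖t‖ ^ 2 / 2 := by
    rw [Complex.I_sq]
    ring
  rw [h2] at h
  rw [← h, charFun_apply, gaussDens,
    integral_withDensity_eq_integral_toReal_smul (by fun_prop) (by simp)]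
  refine integral_congr_ae (Filter.Eventually.of_forall fun x => ?_)
  simp only [ENNReal.toReal_ofReal (Real.exp_pos _).le, Complex.real_smul, Complex.ofReal_exp,
    ← Complex.exp_add]
  congr 1
  push_cast
  rw [real_inner_comm]
  ring

lemma gaussDens_univ_ne_zero : gaussDens n Set.univ ≠ 0 := by
  intro h
  have h1 := charFun_gaussDens (0 : Vec n)
  rw [charFun_zero, Measure.real, h] at h1
  have h2 : (Real.pi / (1 / 2 : ℂ)) ^ (n / 2 : ℂ) ≠ 0 := by
    rw [Ne, Complex.cpow_eq_zero_iff]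
    have : (Real.pi : ℂ) ≠ 0 := by exact_mod_cast Real.pi_ne_zero
    simp [this]
  simp only [ENNReal.toReal_zero, Complex.ofReal_zero, norm_zero] at h1
  refine h2 ?_
  have h3 := h1.symm
  simp at h3

/-- Both characteristic functions are multiples of the same Gaussian, and their values at `0` agree.
The normalising constant of the density is never computed. -/
lemma gaussDens_eq : gaussDens n = gaussDens n Set.univ • stdGaussian (Vec n) := by
  have : IsFiniteMeasure (gaussDens n Set.univ • stdGaussian (Vec n)) :=
    Measure.smul_finite _ (measure_ne_top _ _)
  refine Measure.ext_of_charFun (funext fun t => ?_)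
  have h0 := charFun_gaussDens (0 : Vec n)
  rw [charFun_zero] at h0
  have h1 : charFun (gaussDens n Set.univ • stdGaussian (Vec n)) t
      = ((gaussDens n).real Set.univ : ℂ) * charFun (stdGaussian (Vec n)) t := by
    rw [charFun_apply, charFun_apply, integral_smul_measure, Complex.real_smul]
    rfl
  rw [h1, charFun_gaussDens, charFun_stdGaussian, h0]
  simp

/-- The uniform measure of the trace of a cone on the sphere is its standard Gaussian measure. -/
lemma unifSphere_cone (hn : 0 < n) {C : Set (Vec n)} (hC : MeasurableSet C)
    (hcone : ∀ c : ℝ, 0 < c → ∀ x, c • x ∈ C ↔ x ∈ C) :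
    unifSphere n {u | (u : Vec n) ∈ C} = stdGaussian (Vec n) C := by
  have : Nonempty (Fin n) := ⟨⟨0, hn⟩⟩
  have : Nontrivial (Vec n) := by
    refine ⟨⟨0, EuclideanSpace.single ⟨0, hn⟩ 1, fun h => ?_⟩⟩
    have := congrArg (fun x : Vec n => x ⟨0, hn⟩) h
    simp at this
  set σ := (volume : Measure (Vec n)).toSphere with hσ
  set ρ := Measure.volumeIoiPow (Module.finrank ℝ (Vec n) - 1) with hρ
  set K := ∫⁻ s : Set.Ioi (0 : ℝ), ENNReal.ofReal (Real.exp (-s.1 ^ 2 / 2)) ∂ρ with hK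
  -- In polar coordinates the indicator of a cone depends on the direction and the density on the
  -- radius. The radial mass `K` is the same for all cones and cancels in the quotient with the
  -- whole space.
  have key : ∀ C : Set (Vec n), MeasurableSet C → (∀ c : ℝ, 0 < c → ∀ x, c • x ∈ C ↔ x ∈ C) →
      gaussDens n C = σ {u | (u : Vec n) ∈ C} * K := by
    intro C hC hcone
    have hCs : MeasurableSet {u : Metric.sphere (0 : Vec n) 1 | (u : Vec n) ∈ C} :=
      measurable_subtype_coe hC
    rw [gaussDens, withDensity_apply _ hC, ← lintegral_indicator hC]
    set F : Vec n → ℝ≥0∞ := C.indicator fun x => ENNReal.ofReal (Real.exp (-‖x‖ ^ 2 / 2))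
    have hmp := (volume : Measure (Vec n)).measurePreserving_homeomorphUnitSphereProd
    have h1 : ∫⁻ x, F x = ∫⁻ x : ({0}ᶜ : Set (Vec n)), F x.1 ∂(volume.comap Subtype.val) := by
      rw [lintegral_subtype_comap (measurableSet_singleton _).compl, restrict_compl_singleton]
    have h2 : ∀ x : ({0}ᶜ : Set (Vec n)), F x.1
        = (fun p : Metric.sphere (0 : Vec n) 1 × Set.Ioi (0 : ℝ) =>
          ({u : Metric.sphere (0 : Vec n) 1 | (u : Vec n) ∈ C}.indicator 1 p.1)
            * ENNReal.ofReal (Real.exp (-p.2.1 ^ 2 / 2))) (homeomorphUnitSphereProd (Vec n) x) := by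
      intro x
      have hx : 0 < ‖x.1‖ := norm_pos_iff.2 x.2
      have hmem : (‖x.1‖⁻¹ • x.1 ∈ C) ↔ x.1 ∈ C := hcone _ (inv_pos.2 hx) _
      have hiff : (homeomorphUnitSphereProd (Vec n) x).1
          ∈ {u : Metric.sphere (0 : Vec n) 1 | (u : Vec n) ∈ C} ↔ x.1 ∈ C := by
        rw [← hmem]
        simp
      simp only [F]
      by_cases h : x.1 ∈ C
      · rw [Set.indicator_of_mem h, Set.indicator_of_mem (hiff.2 h)]
        simp
      · rw [Set.indicator_of_notMem h, Set.indicator_of_notMem (fun h' => h (hiff.1 h'))]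
        simp
    rw [h1, lintegral_congr h2]
    have h3 := hmp.lintegral_comp_emb (Homeomorph.measurableEmbedding _)
      (fun p : Metric.sphere (0 : Vec n) 1 × Set.Ioi (0 : ℝ) =>
          ({u : Metric.sphere (0 : Vec n) 1 | (u : Vec n) ∈ C}.indicator 1 p.1)
            * ENNReal.ofReal (Real.exp (-p.2.1 ^ 2 / 2)))
    refine Eq.trans ?_ (h3.trans ?_)
    · congr 1
    rw [lintegral_prod_mul (f := ({u : Metric.sphere (0 : Vec n) 1 | (u : Vec n) ∈ C}.indicator 1))
      (g := fun s : Set.Ioi (0 : ℝ) => ENNReal.ofReal (Real.exp (-s.1 ^ 2 / 2)))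
      ((measurable_one.indicator hCs).aemeasurable)
      (by fun_prop), lintegral_indicator_one hCs]
  have hu := key Set.univ MeasurableSet.univ (by simp)
  have hc := key C hC hcone
  simp only [Set.mem_univ] at hu
  have hu' : gaussDens n Set.univ = σ Set.univ * K := hu
  have hm0 := gaussDens_univ_ne_zero (n := n)
  have hmt : gaussDens n Set.univ ≠ ⊤ := measure_ne_top _ _
  have hσ0 : σ Set.univ ≠ 0 := fun h => hm0 (by rw [hu', h, zero_mul])
  have hK0 : K ≠ 0 := fun h => hm0 (by rw [hu', h, mul_zero])
  have hKt : K ≠ ⊤ := fun h => hmt (by rw [hu', h, ENNReal.mul_top hσ0])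
  have hσt : σ Set.univ ≠ ⊤ := measure_ne_top _ _
  have h3 : gaussDens n C = σ Set.univ * K * stdGaussian (Vec n) C := by
    rw [← hu']
    conv_lhs => rw [gaussDens_eq]
    rfl
  rw [hc] at h3
  have h4 : σ {u | (u : Vec n) ∈ C} = σ Set.univ * stdGaussian (Vec n) C := by
    have : σ {u | (u : Vec n) ∈ C} * K = (σ Set.univ * stdGaussian (Vec n) C) * K := by
      rw [h3]; ring
    exact (ENNReal.mul_left_inj hK0 hKt).1 this
  rw [unifSphere, Measure.smul_apply, smul_eq_mul, ← hσ, h4, ← mul_assoc,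
    ENNReal.inv_mul_cancel hσ0 hσt, one_mul]

lemma isProbabilityMeasure_unifSphere (hn : 0 < n) : IsProbabilityMeasure (unifSphere n) := by
  refine ⟨?_⟩
  have := unifSphere_cone hn (C := Set.univ) MeasurableSet.univ (by simp)
  simpa using this

/-- The coordinates of a standard Gaussian vector with respect to orthonormal vectors are
independent standard Gaussians. -/
lemma stdGaussian_map_inner {r : ℕ} {v : Fin r → Vec n} (hv : Orthonormal ℝ v) :
    (stdGaussian (Vec n)).map (fun x j => inner ℝ x (v j)) = gpi (Fin r) 1 := by
  rw [← map_pi_eq_stdGaussian, Measure.map_map]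
  · have h := gpi_map_orthonormal (ι := Fin n) (κ := Fin r) 1 (fun j i => v j i) ?_
    · rw [← h]
      congr 1
    · intro j l
      rw [orthonormal_iff_ite] at hv
      rw [← hv j l]
      simp [PiLp.inner_apply, mul_comm]
  · fun_prop
  · fun_prop

/-- The law of the directions of the coordinates of a uniform point of the sphere with respect to
orthonormal vectors. -/
lemma unifSphere_coord_cone (hn : 0 < n) {r : ℕ} {v : Fin r → Vec n} (hv : Orthonormal ℝ v)
    {C : Set (Fin r → ℝ)} (hC : MeasurableSet C)
    (hcone : ∀ c : ℝ, 0 < c → ∀ x, c • x ∈ C ↔ x ∈ C) :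
    unifSphere n {u | (fun j => inner ℝ (u : Vec n) (v j)) ∈ C} = gpi (Fin r) 1 C := by
  have hm : Measurable fun (x : Vec n) (j : Fin r) => inner ℝ x (v j) := by fun_prop
  rw [← stdGaussian_map_inner hv, Measure.map_apply hm hC]
  refine unifSphere_cone hn (hm hC) fun c hc x => ?_
  rw [Set.mem_preimage, Set.mem_preimage, ← hcone c hc (fun j => inner ℝ x (v j))]
  have : (fun j => inner ℝ (c • x) (v j)) = c • fun j => inner ℝ x (v j) := by
    funext j
    simp [real_inner_smul_left]
  rw [this]

end Sphere

/-! ### Gaussian computation of `p_i`, and its symmetry -/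

section Coordinates

lemma gpi_succ_apply {m : ℕ} (i : Fin (m + 1)) {S : Set (Fin (m + 1) → ℝ)}
    (hS : MeasurableSet S) :
    gpi (Fin (m + 1)) 1 S
      = ∫⁻ x, gpi (Fin m) 1 {y | i.insertNth (α := fun _ => ℝ) x y ∈ S} ∂gaussianReal 0 1 := by
  have h := (measurePreserving_piFinSuccAbove (fun _ : Fin (m + 1) => gaussianReal 0 1) i).symm
  change Measure.pi _ S = _
  rw [← h.map_eq, Measure.map_apply h.measurable hS, Measure.prod_apply (h.measurable hS)]
  rfl

lemma gpi_succ_apply' {m : ℕ} (i : Fin (m + 1)) {S : Set (Fin (m + 1) → ℝ)}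
    (hS : MeasurableSet S) :
    gpi (Fin (m + 1)) 1 S
      = ∫⁻ y, gaussianReal 0 1 {x | i.insertNth (α := fun _ => ℝ) x y ∈ S} ∂gpi (Fin m) 1 := by
  have h := (measurePreserving_piFinSuccAbove (fun _ : Fin (m + 1) => gaussianReal 0 1) i).symm
  change Measure.pi _ S = _
  rw [← h.map_eq, Measure.map_apply h.measurable hS, Measure.prod_apply_symm (h.measurable hS)]
  rfl

lemma halfGauss_eq (x : ℝ) : halfGauss x = 2 * gaussianPDFReal 0 1 x := by
  rw [halfGauss, gaussianPDFReal]
  have h1 : Real.sqrt (2 / Real.pi) = 2 * (Real.sqrt (2 * Real.pi * (1 : ℝ≥0)))⁻¹ := by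
    rw [← Real.sqrt_inv, show (2 : ℝ) = Real.sqrt 4 by
      rw [show (4 : ℝ) = 2 ^ 2 by norm_num, Real.sqrt_sq (by norm_num)], ← Real.sqrt_mul (by norm_num)]
    congr 1
    rw [show Real.sqrt 4 = 2 by rw [show (4 : ℝ) = 2 ^ 2 by norm_num, Real.sqrt_sq (by norm_num)]]
    have := Real.pi_pos
    simp only [NNReal.coe_one, mul_one]
    field_simp
    norm_num
  rw [h1]
  simp
  ring

lemma gaussianPDFReal_abs (x : ℝ) : gaussianPDFReal 0 1 |x| = gaussianPDFReal 0 1 x := by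
  simp [gaussianPDFReal]

lemma gaussianReal_abs_le {c : ℝ} (hc : 0 ≤ c) :
    (gaussianReal 0 1).real {y | |y| ≤ c} = ∫ y in (0 : ℝ)..c, halfGauss y := by
  rw [Measure.real, gaussianReal_apply_eq_integral _ one_ne_zero, ENNReal.toReal_ofReal
    (integral_nonneg fun _ => gaussianPDFReal_nonneg _ _ _)]
  have hS : MeasurableSet {y : ℝ | |y| ≤ c} := measurableSet_le (by fun_prop) measurable_const
  rw [← integral_indicator hS]
  have h1 : ∀ y : ℝ, {y : ℝ | |y| ≤ c}.indicator (gaussianPDFReal 0 1) y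
      = (Set.Iic c).indicator (gaussianPDFReal 0 1) |y| := by
    intro y
    by_cases hy : |y| ≤ c
    · rw [Set.indicator_of_mem (by exact hy), Set.indicator_of_mem (by exact hy),
        gaussianPDFReal_abs]
    · rw [Set.indicator_of_notMem (by exact hy), Set.indicator_of_notMem (by exact hy)]
  simp_rw [h1]
  rw [integral_comp_abs (f := (Set.Iic c).indicator (gaussianPDFReal 0 1)),
    setIntegral_indicator measurableSet_Iic, Set.Ioi_inter_Iic,
    intervalIntegral.integral_of_le hc, ← integral_const_mul]
  simp_rw [halfGauss_eq]

/-- The cone where `|βⱼ xⱼ^{k-2}|` is maximal at `j = i`. -/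
def argmaxCone (k : ℕ) {r : ℕ} (β : Fin r → ℝ) (i : Fin r) : Set (Fin r → ℝ) :=
  {x | ∀ j, |β j * x j ^ (k - 2)| ≤ |β i * x i ^ (k - 2)|}

lemma measurableSet_argmaxCone (k : ℕ) {r : ℕ} (β : Fin r → ℝ) (i : Fin r) :
    MeasurableSet (argmaxCone k β i) := by
  have : argmaxCone k β i = ⋂ j, {x | |β j * x j ^ (k - 2)| ≤ |β i * x i ^ (k - 2)|} := by
    ext x
    simp [argmaxCone]
  rw [this]
  exact MeasurableSet.iInter fun j => measurableSet_le (by fun_prop) (by fun_prop)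

/-- Positive `c` serve to pass from the sphere to the Gaussian; `c = -1` gives the reflection
symmetry that splits `p_i` into halves. -/
lemma smul_mem_argmaxCone (k : ℕ) {r : ℕ} (β : Fin r → ℝ) (i : Fin r) (c : ℝ) (hc : c ≠ 0)
    (x : Fin r → ℝ) : c • x ∈ argmaxCone k β i ↔ x ∈ argmaxCone k β i := by
  have hc' : 0 < |c| ^ (k - 2) := by positivity
  have h : ∀ j, |β j * (c • x) j ^ (k - 2)| = |c| ^ (k - 2) * |β j * x j ^ (k - 2)| := by
    intro j
    simp only [Pi.smul_apply, smul_eq_mul, mul_pow, abs_mul, abs_pow]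
    ring
  simp only [argmaxCone, Set.mem_ofPred_eq, h]
  exact forall_congr' fun j => mul_le_mul_iff_right₀ hc'

lemma argmaxProb_eq {n : ℕ} (hn : 0 < n) (k : ℕ) {r : ℕ} (β : Fin r → ℝ) {v : Fin r → Vec n}
    (hv : Orthonormal ℝ v) (i : Fin r) :
    argmaxProb k β v i = (gpi (Fin r) 1).real (argmaxCone k β i) := by
  rw [argmaxProb, Measure.real, Measure.real,
    ← unifSphere_coord_cone hn hv (measurableSet_argmaxCone k β i)
      fun c hc x => smul_mem_argmaxCone k β i c hc.ne' x]
  rfl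

/-- Extraction of a `(k - 2)`-th root, which needs `k ≥ 3`; the cone becomes a linear comparison of
moduli. -/
lemma abs_mul_pow_le_iff {k : ℕ} (hk : 3 ≤ k) {b b' x x' : ℝ} (hb : b ≠ 0) :
    |b * x ^ (k - 2)| ≤ |b' * x' ^ (k - 2)|
      ↔ |x| ≤ (|b'| / |b|) ^ (1 / ((k : ℝ) - 2)) * |x'| := by
  have hb0 : 0 < |b| := abs_pos.2 hb
  have hk2 : k - 2 ≠ 0 := by omega
  set α := (|b'| / |b|) ^ (1 / ((k : ℝ) - 2)) with hα
  have hα0 : 0 ≤ α := by positivity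
  have h1 : α ^ (k - 2) = |b'| / |b| := by
    have h2 : (1 / ((k : ℝ) - 2)) = ((k - 2 : ℕ) : ℝ)⁻¹ := by
      rw [Nat.cast_sub (by omega)]
      simp
    rw [hα, h2, Real.rpow_inv_natCast_pow (by positivity) hk2]
  rw [abs_mul, abs_mul, abs_pow, abs_pow, ← pow_le_pow_iff_left₀ (abs_nonneg x) (by positivity) hk2,
    mul_pow, h1, div_mul_eq_mul_div, le_div_iff₀ hb0, mul_comm (|x| ^ (k - 2))]

/-- Given the `i`-th coordinate `x`, the section of the cone is a box with sides proportional to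
`|x|`, whose measure is a product of half-Gaussian integrals. Evenness in `x` folds the outer
integral onto the half-line and doubles the density. -/
lemma gpi_argmaxCone {k : ℕ} (hk : 3 ≤ k) {r : ℕ} {β : Fin r → ℝ} (hβ : ∀ j, β j ≠ 0)
    (i : Fin r) : (gpi (Fin r) 1).real (argmaxCone k β i) = gaussProb k β i := by
  obtain ⟨m, rfl⟩ : ∃ m, r = m + 1 := ⟨r - 1, by have := i.2; omega⟩
  set α : Fin (m + 1) → ℝ := fun l => (|β i| / |β l|) ^ (1 / ((k : ℝ) - 2)) with hα
  have hα0 : ∀ l, 0 ≤ α l := fun l => by positivity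
  set G : ℝ → ℝ := fun x => ∏ l : Fin m, ∫ y in (0 : ℝ)..(α (i.succAbove l) * x), halfGauss y
    with hG
  have hsec : ∀ x : ℝ, gpi (Fin m) 1 {y | i.insertNth (α := fun _ => ℝ) x y ∈ argmaxCone k β i}
      = ENNReal.ofReal (G |x|) := by
    intro x
    have h1 : {y : Fin m → ℝ | i.insertNth (α := fun _ => ℝ) x y ∈ argmaxCone k β i}
        = Set.univ.pi fun l => {z : ℝ | |z| ≤ α (i.succAbove l) * |x|} := by
      ext y
      simp only [argmaxCone, Set.mem_ofPred_eq, Set.mem_univ_pi]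
      rw [Fin.forall_iff_succAbove i]
      simp only [Fin.insertNth_apply_same, Fin.insertNth_apply_succAbove, le_refl, true_and]
      exact forall_congr' fun l => abs_mul_pow_le_iff hk (hβ _)
    rw [h1, Measure.pi_pi, hG, ENNReal.ofReal_prod_of_nonneg]
    · refine Finset.prod_congr rfl fun l _ => ?_
      rw [← gaussianReal_abs_le (mul_nonneg (hα0 _) (abs_nonneg x)), ofReal_measureReal]
    · intro l _
      rw [← gaussianReal_abs_le (mul_nonneg (hα0 _) (abs_nonneg x))]
      exact measureReal_nonneg
  have hGm : Measurable fun x => G |x| := by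
    refine Finset.measurable_prod _ fun l _ => ?_
    have : Continuous fun z : ℝ => ∫ y in (0 : ℝ)..z, halfGauss y := by
      refine intervalIntegral.continuous_primitive (fun a b => Continuous.intervalIntegrable ?_ _ _) 0
      unfold halfGauss
      fun_prop
    exact (this.comp (by fun_prop : Continuous fun x : ℝ => α (i.succAbove l) * |x|)).measurable
  have hG0 : ∀ x, 0 ≤ G |x| := by
    intro x
    refine Finset.prod_nonneg fun l _ => ?_
    rw [← gaussianReal_abs_le (mul_nonneg (hα0 _) (abs_nonneg x))]
    exact measureReal_nonneg
  rw [Measure.real, gpi_succ_apply i (measurableSet_argmaxCone k β i), lintegral_congr hsec,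
    ← integral_eq_lintegral_of_nonneg_ae (Filter.Eventually.of_forall hG0)
      hGm.aestronglyMeasurable, integral_gaussianReal_eq_integral_smul one_ne_zero]
  have h2 : ∀ x, gaussianPDFReal 0 1 x • G |x| = (fun x => gaussianPDFReal 0 1 x * G x) |x| := by
    intro x
    simp [gaussianPDFReal_abs]
  simp_rw [h2]
  rw [integral_comp_abs (f := fun x => gaussianPDFReal 0 1 x * G x), ← integral_const_mul,
    gaussProb]
  refine integral_congr_ae (Filter.Eventually.of_forall fun x => ?_)
  simp only [halfGauss_eq x, ← mul_assoc]
  congr 1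
  rw [hG]
  have h3 : Finset.univ.erase i = Finset.univ.image i.succAbove := by
    rw [Fin.image_succAbove_univ]
    ext l
    simp
  rw [h3, Finset.prod_image fun _ _ _ _ h => Fin.succAbove_right_injective h]

lemma argmaxProb_eq_gaussProb {n : ℕ} (hn : 0 < n) {k : ℕ} (hk : 3 ≤ k) {r : ℕ} {β : Fin r → ℝ}
    (hβ : ∀ j, β j ≠ 0) {v : Fin r → Vec n} (hv : Orthonormal ℝ v) (i : Fin r) :
    argmaxProb k β v i = gaussProb k β i :=
  (argmaxProb_eq hn k β hv i).trans (gpi_argmaxCone hk hβ i)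

lemma gpi_map_neg (r : ℕ) : (gpi (Fin r) 1).map (fun x => -x) = gpi (Fin r) 1 := by
  have h := gpi_map_orthonormal (ι := Fin r) (κ := Fin r) 1 (-1) (by
    intro k l
    simp [Matrix.one_apply])
  have h2 : (fun x : Fin r → ℝ => -x) = fun x => (-1 : Matrix (Fin r) (Fin r) ℝ).mulVec x := by
    funext x
    rw [Matrix.neg_mulVec, Matrix.one_mulVec]
  rw [h2]
  exact h

lemma gpi_map_eval {r : ℕ} (j : Fin r) : (gpi (Fin r) 1).map (fun x => x j) = gaussianReal 0 1 :=
  (measurePreserving_eval (fun _ : Fin r => gaussianReal 0 1) j).map_eq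

/-- By symmetry, half of the mass of the cone lies on each side of the hyperplane `xᵢ = 0`. -/
lemma gpi_argmaxCone_pos (k : ℕ) {r : ℕ} (β : Fin r → ℝ) (i : Fin r) :
    (gpi (Fin r) 1).real (argmaxCone k β i ∩ {x | 0 < x i})
        = (gpi (Fin r) 1).real (argmaxCone k β i) / 2 ∧
      (gpi (Fin r) 1).real (argmaxCone k β i ∩ {x | x i < 0})
        = (gpi (Fin r) 1).real (argmaxCone k β i) / 2 := by
  set μ := gpi (Fin r) 1
  have hmC := measurableSet_argmaxCone k β i
  have hmp : MeasurableSet {x : Fin r → ℝ | 0 < x i} :=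
    measurableSet_lt measurable_const (measurable_pi_apply i)
  have hmn : MeasurableSet {x : Fin r → ℝ | x i < 0} :=
    measurableSet_lt (measurable_pi_apply i) measurable_const
  have h1 : μ.real (argmaxCone k β i ∩ {x | 0 < x i})
      = μ.real (argmaxCone k β i ∩ {x | x i < 0}) := by
    rw [Measure.real, Measure.real]
    congr 1
    conv_lhs => rw [show μ = gpi (Fin r) 1 from rfl, ← gpi_map_neg r]
    rw [Measure.map_apply measurable_neg (hmC.inter hmp)]
    congr 1
    ext x
    simp only [Set.mem_preimage, Set.mem_inter_iff, Set.mem_ofPred_eq, Pi.neg_apply, neg_pos]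
    have := smul_mem_argmaxCone k β i (-1) (by norm_num) x
    rw [neg_one_smul] at this
    rw [this]
  have h0 : μ.real {x | x i = 0} = 0 := by
    have : μ {x | x i = 0} = 0 := by
      have hs : MeasurableSet ({0} : Set ℝ) := measurableSet_singleton 0
      have h2 := gpi_map_eval i
      have h3 : gaussianReal 0 1 ({0} : Set ℝ) = 0 :=
        gaussianReal_absolutelyContinuous 0 one_ne_zero (by simp)
      rw [← h2, Measure.map_apply (measurable_pi_apply i) hs] at h3
      exact h3
    rw [Measure.real, this]
    simp
  have h2 : μ.real (argmaxCone k β i) ≤ μ.real (argmaxCone k β i ∩ {x | 0 < x i})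
      + μ.real (argmaxCone k β i ∩ {x | x i < 0}) + μ.real {x | x i = 0} := by
    have hsub : argmaxCone k β i ⊆ (argmaxCone k β i ∩ {x | 0 < x i}
        ∪ argmaxCone k β i ∩ {x | x i < 0}) ∪ {x | x i = 0} := ?_
    · refine (measureReal_mono hsub).trans ((measureReal_union_le _ _).trans ?_)
      gcongr
      exact measureReal_union_le _ _
    intro x hx
    rcases lt_trichotomy (x i) 0 with h | h | h
    · exact Or.inl (Or.inr ⟨hx, h⟩)
    · exact Or.inr h
    · exact Or.inl (Or.inl ⟨hx, h⟩)
  have h3 : μ.real (argmaxCone k β i ∩ {x | 0 < x i})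
      + μ.real (argmaxCone k β i ∩ {x | x i < 0}) ≤ μ.real (argmaxCone k β i) := by
    rw [← measureReal_union _ (hmC.inter hmn)]
    · exact measureReal_mono (Set.union_subset Set.inter_subset_left Set.inter_subset_left)
    · rw [Set.disjoint_left]
      rintro x ⟨_, hx⟩ ⟨_, hx'⟩
      exact lt_asymm (a := 0) (b := x i) hx hx'
  rw [h0] at h2
  constructor <;> linarith

end Coordinates

/-! ### The initial point is nondegenerate with high probability -/

section InitialCondition

lemma measurableSet_lt_le {α : Type*} [MeasurableSpace α] {f g h : α → ℝ} (hf : Measurable f)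
    (hg : Measurable g) (hh : Measurable h) : MeasurableSet {x | f x < g x ∧ g x ≤ h x} :=
  (measurableSet_lt hf hg).inter (measurableSet_le hg hh)

lemma gaussianReal_le_of_pdf_le {S : Set ℝ} {c L : ℝ} (hS : MeasurableSet S)
    (hpdf : ∀ x ∈ S, gaussianPDFReal 0 1 x ≤ c) (hc : 0 ≤ c)
    (hvol : volume S ≤ ENNReal.ofReal L) : gaussianReal 0 1 S ≤ ENNReal.ofReal (c * L) := by
  rw [gaussianReal_apply _ one_ne_zero]
  calc ∫⁻ x in S, gaussianPDF 0 1 x ≤ ∫⁻ _ in S, ENNReal.ofReal c := by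
        refine setLIntegral_mono' hS fun x hx => ENNReal.ofReal_le_ofReal (hpdf x hx)
    _ = ENNReal.ofReal c * volume S := by rw [setLIntegral_const]
    _ ≤ ENNReal.ofReal c * ENNReal.ofReal L := by gcongr
    _ = _ := by rw [ENNReal.ofReal_mul hc]

lemma gaussianPDFReal_le (x : ℝ) : gaussianPDFReal 0 1 x ≤ 1 / 2 * Real.exp (-x ^ 2 / 2) := by
  have h1 : (Real.sqrt (2 * Real.pi * (1 : ℝ≥0)))⁻¹ ≤ 1 / 2 := by
    rw [inv_le_comm₀ (by positivity) (by norm_num)]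
    refine Real.le_sqrt_of_sq_le ?_
    simp only [NNReal.coe_one]
    nlinarith [Real.pi_gt_three]
  rw [gaussianPDFReal]
  have h2 : -(x - 0) ^ 2 / (2 * ((1 : ℝ≥0) : ℝ)) = -x ^ 2 / 2 := by simp
  rw [h2]
  gcongr

lemma gaussianReal_small (δ : ℝ) :
    gaussianReal 0 1 {x | |x| ≤ δ} ≤ ENNReal.ofReal δ := by
  refine (gaussianReal_le_of_pdf_le (c := 1 / 2) (L := 2 * δ)
    (measurableSet_le (by fun_prop) measurable_const) (fun x _ => ?_) (by norm_num) ?_).trans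
    (le_of_eq (by ring_nf))
  · refine (gaussianPDFReal_le x).trans (mul_le_of_le_one_right (by norm_num) ?_)
    exact Real.exp_le_one_iff.2 (by nlinarith [sq_nonneg x])
  · have : {x : ℝ | |x| ≤ δ} = Set.Icc (-δ) δ := by
      ext x
      simp [abs_le]
    rw [this, Real.volume_Icc]
    exact ENNReal.ofReal_le_ofReal (by linarith)

/-- The set has length at most `2 δ y`, and since `|x| ≥ y / 2` on it the density there is at most
`e^{-y²/8} / 2`. The product is `O(δ)` uniformly in `y`, because `y e^{-y²/8}` is bounded. -/
lemma gaussianReal_gap {δ y : ℝ} (hδ : 0 ≤ δ) (hδ2 : δ ≤ 1 / 2) (hy : 0 ≤ y) :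
    gaussianReal 0 1 {x | (1 - δ) * y < |x| ∧ |x| ≤ y} ≤ ENNReal.ofReal (2 * δ) := by
  have hE : y * Real.exp (-y ^ 2 / 8) ≤ 2 := by
    have h1 : 1 + y ^ 2 / 8 ≤ Real.exp (y ^ 2 / 8) := by
      have := Real.add_one_le_exp (y ^ 2 / 8)
      linarith
    have h2 : Real.exp (-y ^ 2 / 8) * Real.exp (y ^ 2 / 8) = 1 := by
      rw [← Real.exp_add]
      simp [neg_div]
    have h3 : y ≤ 2 * Real.exp (y ^ 2 / 8) := by nlinarith [sq_nonneg (y - 2)]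
    calc y * Real.exp (-y ^ 2 / 8)
        ≤ 2 * Real.exp (y ^ 2 / 8) * Real.exp (-y ^ 2 / 8) := by gcongr
      _ = 2 * (Real.exp (-y ^ 2 / 8) * Real.exp (y ^ 2 / 8)) := by ring
      _ = 2 := by rw [h2, mul_one]
  have hS : MeasurableSet {x : ℝ | (1 - δ) * y < |x| ∧ |x| ≤ y} :=
    measurableSet_lt_le measurable_const (by fun_prop) measurable_const
  refine (gaussianReal_le_of_pdf_le (c := 1 / 2 * Real.exp (-y ^ 2 / 8)) (L := 2 * (δ * y)) hS
    (fun x hx => ?_) (by positivity) ?_).trans (ENNReal.ofReal_le_ofReal ?_)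
  · refine (gaussianPDFReal_le x).trans ?_
    have h1 : y / 2 ≤ |x| := by
      have := hx.1
      nlinarith
    have h2 : (y / 2) ^ 2 ≤ x ^ 2 := by
      rw [← sq_abs x]
      gcongr
    exact mul_le_mul_of_nonneg_left (Real.exp_le_exp.2 (by linarith)) (by norm_num)
  · have hsub : {x : ℝ | (1 - δ) * y < |x| ∧ |x| ≤ y}
        ⊆ Set.Icc ((1 - δ) * y) y ∪ Set.Icc (-y) (-((1 - δ) * y)) := by
      rintro x ⟨h1, h2⟩
      rcases le_total 0 x with h | h
      · rw [abs_of_nonneg h] at h1 h2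
        exact Or.inl ⟨h1.le, h2⟩
      · rw [abs_of_nonpos h] at h1 h2
        exact Or.inr ⟨by linarith, by linarith⟩
    refine (measure_mono hsub).trans ((measure_union_le _ _).trans ?_)
    rw [Real.volume_Icc, Real.volume_Icc, ← ENNReal.ofReal_add]
    · exact ENNReal.ofReal_le_ofReal (by linarith)
    · nlinarith
    · nlinarith
  · nlinarith

/-- Conditioning on all coordinates but the `j`-th reduces this to one dimension. Uniformity in `c`
matters, since nothing is assumed about the ratios of the `β j`. -/
lemma gpi_gap {r : ℕ} {i j : Fin r} (hij : i ≠ j) {δ c : ℝ} (hδ : 0 ≤ δ) (hδ2 : δ ≤ 1 / 2)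
    (hc : 0 ≤ c) :
    gpi (Fin r) 1 {x | (1 - δ) * (c * |x i|) < |x j| ∧ |x j| ≤ c * |x i|}
      ≤ ENNReal.ofReal (2 * δ) := by
  obtain ⟨m, rfl⟩ : ∃ m, r = m + 1 := ⟨r - 1, by have := i.2; omega⟩
  obtain ⟨i', rfl⟩ := Fin.exists_succAbove_eq hij
  have hS : MeasurableSet {x : Fin (m + 1) → ℝ | (1 - δ) * (c * |x (j.succAbove i')|) < |x j| ∧
      |x j| ≤ c * |x (j.succAbove i')|} :=
    measurableSet_lt_le (by fun_prop) (by fun_prop) (by fun_prop)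
  rw [gpi_succ_apply' j hS]
  calc _ ≤ ∫⁻ _ : Fin m → ℝ, ENNReal.ofReal (2 * δ) ∂gpi (Fin m) 1 := by
        refine lintegral_mono fun y => ?_
        simp only [Set.mem_ofPred_eq, Fin.insertNth_apply_same, Fin.insertNth_apply_succAbove]
        exact gaussianReal_gap hδ hδ2 (by positivity)
    _ = _ := by simp

/-- The initial conditions under which power iteration can be followed. -/
def initGood (k : ℕ) {n r : ℕ} (δ : ℝ) (β : Fin r → ℝ) (v : Fin r → Vec n) : Set (Vec n) :=
  {x | (∀ j, δ ^ 2 * ‖x‖ ≤ Real.sqrt n * |inner ℝ x (v j)|) ∧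
    (∀ j l, δ ^ 2 * |inner ℝ x (v j)| ≤ |inner ℝ x (v l)|) ∧
    (3 ≤ k → ∀ i j, i ≠ j →
      |β j * inner ℝ x (v j) ^ (k - 2)| ≤ |β i * inner ℝ x (v i) ^ (k - 2)| →
      |β j * inner ℝ x (v j) ^ (k - 2)| ≤ (1 - δ) * |β i * inner ℝ x (v i) ^ (k - 2)|)}

variable {n r : ℕ}

lemma measurableSet_initGood (k : ℕ) (δ : ℝ) (β : Fin r → ℝ) (v : Fin r → Vec n) :
    MeasurableSet (initGood k δ β v) := by
  have hm : ∀ j, Measurable fun x : Vec n => inner ℝ x (v j) := fun j => by fun_prop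
  have ha : ∀ j, Measurable fun x : Vec n => |β j * inner ℝ x (v j) ^ (k - 2)| :=
    fun j => (((hm j).pow_const _).const_mul _).abs
  refine measurableSet_setOfPred.2 (Measurable.and ?_ (Measurable.and ?_ ?_))
  · exact Measurable.forall fun j => measurableSet_setOfPred.1
      (measurableSet_le (by fun_prop) (by fun_prop))
  · exact Measurable.forall fun j => Measurable.forall fun l => measurableSet_setOfPred.1
      (measurableSet_le (by fun_prop) (by fun_prop))
  · exact measurable_const.imp (Measurable.forall fun i => Measurable.forall fun j =>
      measurable_const.imp ((measurableSet_setOfPred.1 (measurableSet_le (ha j) (ha i))).imp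
        (measurableSet_setOfPred.1 (measurableSet_le (ha j) ((ha i).const_mul _)))))

lemma smul_mem_initGood (k : ℕ) (δ : ℝ) (β : Fin r → ℝ) (v : Fin r → Vec n) (c : ℝ) (hc : 0 < c)
    (x : Vec n) : c • x ∈ initGood k δ β v ↔ x ∈ initGood k δ β v := by
  have hp : 0 < c ^ (k - 2) := by positivity
  have h1 : ∀ j, |β j * inner ℝ (c • x) (v j) ^ (k - 2)|
      = c ^ (k - 2) * |β j * inner ℝ x (v j) ^ (k - 2)| := by
    intro j
    rw [real_inner_smul_left, mul_pow, ← abs_of_pos hp, ← abs_mul, abs_of_pos hp]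
    congr 1
    ring
  have h2 : ∀ j, |inner ℝ (c • x) (v j)| = c * |inner ℝ x (v j)| := by
    intro j
    rw [real_inner_smul_left, abs_mul, abs_of_pos hc]
  simp only [initGood, Set.mem_ofPred_eq, h1, h2, norm_smul, Real.norm_eq_abs, abs_of_pos hc]
  refine and_congr (forall_congr' fun j => ?_) (and_congr (forall_congr' fun j =>
    forall_congr' fun l => ?_) (imp_congr_right fun _ => forall_congr' fun i =>
    forall_congr' fun j => imp_congr_right fun _ => imp_congr (mul_le_mul_iff_right₀ hp) ?_))
  · rw [mul_left_comm, mul_left_comm (Real.sqrt n)]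
    exact mul_le_mul_iff_right₀ hc
  · rw [mul_left_comm]
    exact mul_le_mul_iff_right₀ hc
  · rw [mul_left_comm]
    exact mul_le_mul_iff_right₀ hp

/-- Markov's inequality for the squared norm, which has mean `n`. -/
lemma stdGaussian_norm_sq_gt {δ : ℝ} (hδ : 0 < δ) (hn : 0 < n) :
    stdGaussian (Vec n) {x | n / δ < ‖x‖ ^ 2} ≤ ENNReal.ofReal δ := by
  have hS : MeasurableSet {x : Vec n | n / δ < ‖x‖ ^ 2} :=
    measurableSet_lt measurable_const (by fun_prop)
  rw [← map_pi_eq_stdGaussian, Measure.map_apply (by fun_prop) hS]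
  set μ := gpi (Fin n) 1
  have hint : ∀ i : Fin n, Integrable (fun y : Fin n → ℝ => y i ^ 2) μ := fun i =>
    ((memLp_sq_gaussianReal 1).comp_measurePreserving
      (measurePreserving_eval (fun _ : Fin n => gaussianReal 0 1) i)).integrable (by norm_num)
  have h1 := mul_meas_ge_le_integral_of_nonneg (μ := μ) (f := fun y => ∑ i, y i ^ 2)
    (Filter.Eventually.of_forall fun y => Finset.sum_nonneg fun i _ => sq_nonneg _)
    (integrable_finsetSum _ fun i _ => hint i) (n / δ)
  rw [integral_finsetSum _ fun i _ => hint i] at h1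
  have h2 : ∀ i : Fin n, ∫ y, y i ^ 2 ∂μ = 1 := by
    intro i
    have h3 := integral_sq_gaussianReal 1
    rw [← gpi_map_eval i, integral_map (measurable_pi_apply i).aemeasurable (by fun_prop)] at h3
    simpa using h3
  simp only [h2, Finset.sum_const, Finset.card_univ, Fintype.card_fin, nsmul_eq_mul, mul_one] at h1
  have hn' : (0 : ℝ) < n := by exact_mod_cast hn
  have h4 : μ.real {y | n / δ ≤ ∑ i, y i ^ 2} ≤ δ := by
    rw [div_mul_eq_mul_div, div_le_iff₀ hδ] at h1
    nlinarith
  rw [← ofReal_measureReal (by exact measure_ne_top μ _)]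
  refine ENNReal.ofReal_le_ofReal (le_trans (measureReal_mono ?_) h4)
  intro y hy
  simp only [Set.mem_preimage, Set.mem_ofPred_eq, EuclideanSpace.real_norm_sq_eq] at hy ⊢
  exact hy.le

/-- For a Gaussian vector the failure is contained in four kinds of events of probability `O(δ)`: a
coordinate below `δ`, a coordinate above `1 / δ`, a squared norm above `n / δ`, and a near tie
between two spikes. A quotient of a lower bound by an upper bound produces the `δ²` in `initGood`.
-/
lemma unifSphere_initGood_compl (hn : 0 < n) (k : ℕ) {δ : ℝ} (hδ : 0 < δ) (hδ2 : δ ≤ 1 / 2)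
    {β : Fin r → ℝ} (hβ : ∀ j, β j ≠ 0) {v : Fin r → Vec n} (hv : Orthonormal ℝ v) :
    unifSphere n {u | (u : Vec n) ∉ initGood k δ β v}
      ≤ ENNReal.ofReal ((2 * r ^ 2 + 2 * r + 1) * δ) := by
  set c : Fin r → Fin r → ℝ := fun i j => (|β i| / |β j|) ^ (1 / ((k : ℝ) - 2)) with hc
  have hc0 : ∀ i j, 0 ≤ c i j := fun i j => by positivity
  have hcone := unifSphere_cone hn (measurableSet_initGood k δ β v).compl (fun a ha x => by
    rw [Set.mem_compl_iff, Set.mem_compl_iff, smul_mem_initGood k δ β v a ha x])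
  refine (le_of_eq hcone).trans ?_
  set φ : Vec n → Fin r → ℝ := fun x j => inner ℝ x (v j) with hφ
  have hφm : Measurable φ := by
    rw [hφ]
    fun_prop
  set E1 : Fin r → Set (Fin r → ℝ) := fun j => {x | |x j| ≤ δ}
  set E2 : Fin r → Set (Fin r → ℝ) := fun j => {x | δ⁻¹ < |x j|}
  set E4 : Fin r × Fin r → Set (Fin r → ℝ) := fun p =>
    {x | p.1 ≠ p.2 ∧ (1 - δ) * (c p.1 p.2 * |x p.1|) < |x p.2| ∧ |x p.2| ≤ c p.1 p.2 * |x p.1|}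
  have hsub : (initGood k δ β v)ᶜ ⊆ (φ ⁻¹' ((⋃ j, E1 j) ∪ (⋃ j, E2 j) ∪ (⋃ p, E4 p)))
      ∪ {x | n / δ < ‖x‖ ^ 2} := by
    intro x hx
    by_contra hcon
    simp only [Set.mem_union, Set.mem_preimage, Set.mem_iUnion, not_or, not_exists] at hcon
    obtain ⟨⟨⟨h1, h2⟩, h4⟩, h3⟩ := hcon
    have h1' : ∀ j, δ < |inner ℝ x (v j)| := fun j => not_le.1 (h1 j)
    have h2' : ∀ j, |inner ℝ x (v j)| ≤ δ⁻¹ := fun j => not_lt.1 (h2 j)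
    have h3' : ‖x‖ ^ 2 ≤ n / δ := not_lt.1 h3
    refine hx ⟨fun j => ?_, fun j l => ?_, fun hk i j hij hle => ?_⟩
    · refine (sq_le_sq₀ (by positivity) (by positivity)).1 ?_
      rw [mul_pow, mul_pow, Real.sq_sqrt (by positivity)]
      have h5 : δ ^ 2 ≤ |inner ℝ x (v j)| ^ 2 := by
        have := h1' j
        gcongr
      calc (δ ^ 2) ^ 2 * ‖x‖ ^ 2 ≤ (δ ^ 2) ^ 2 * (n / δ) := by gcongr
        _ = n * (δ ^ 2 * δ) := by field_simp
        _ ≤ n * (δ ^ 2 * 1) := by gcongr; linarith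
        _ ≤ n * |inner ℝ x (v j)| ^ 2 := by rw [mul_one]; gcongr
    · calc δ ^ 2 * |inner ℝ x (v j)| ≤ δ ^ 2 * δ⁻¹ := by gcongr; exact h2' j
        _ = δ := by field_simp
        _ ≤ _ := (h1' l).le
    · have h5 := (abs_mul_pow_le_iff hk (hβ j)).1 hle
      have h6 : |inner ℝ x (v j)| ≤ (1 - δ) * (c i j * |inner ℝ x (v i)|) := by
        by_contra h7
        exact h4 (i, j) ⟨hij, not_le.1 h7, h5⟩
      have h7 : (1 - δ) * (c i j * |inner ℝ x (v i)|)
          = c i j * |(1 - δ) * inner ℝ x (v i)| := by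
        rw [abs_mul, abs_of_nonneg (by linarith : (0 : ℝ) ≤ 1 - δ)]
        ring
      rw [h7] at h6
      have h8 := (abs_mul_pow_le_iff hk (hβ j)).2 h6
      refine h8.trans ?_
      rw [mul_pow, mul_left_comm, abs_mul, abs_pow,
        abs_of_nonneg (by linarith : (0 : ℝ) ≤ 1 - δ)]
      gcongr
      calc (1 - δ) ^ (k - 2) ≤ (1 - δ) ^ 1 :=
            pow_le_pow_of_le_one (by linarith) (by linarith) (by omega)
        _ = 1 - δ := pow_one _
  have hE1 : ∀ j, gpi (Fin r) 1 (E1 j) ≤ ENNReal.ofReal δ := by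
    intro j
    have hS : MeasurableSet {x : ℝ | |x| ≤ δ} := measurableSet_le (by fun_prop) measurable_const
    have := gaussianReal_small δ
    rw [← gpi_map_eval j, Measure.map_apply (measurable_pi_apply j) hS] at this
    exact this
  have hE2 : ∀ j, gpi (Fin r) 1 (E2 j) ≤ ENNReal.ofReal δ := by
    intro j
    have h5 := gpi_chebyshev (ι := Fin r) 1 (fun i => if i = j then 1 else 0)
      (t := δ⁻¹) (by positivity)
    simp only [ite_mul, one_mul, zero_mul, Finset.sum_ite_eq', Finset.mem_univ, if_true, ite_pow,
      one_pow, ne_eq, OfNat.ofNat_ne_zero, not_false_eq_true, zero_pow, NNReal.coe_one] at h5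
    refine h5.trans (ENNReal.ofReal_le_ofReal ?_)
    rw [inv_pow, one_div, inv_inv]
    nlinarith
  have hE4 : ∀ p, gpi (Fin r) 1 (E4 p) ≤ ENNReal.ofReal (2 * δ) := by
    intro p
    by_cases hp : p.1 = p.2
    · have : E4 p = ∅ := by
        ext x
        simp [E4, hp]
      rw [this]
      simp
    · exact (measure_mono fun x hx => hx.2).trans (gpi_gap hp hδ.le hδ2 (hc0 _ _))
  have hEm : MeasurableSet ((⋃ j, E1 j) ∪ (⋃ j, E2 j) ∪ (⋃ p, E4 p)) := by
    refine ((MeasurableSet.iUnion fun j => ?_).union (MeasurableSet.iUnion fun j => ?_)).union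
      (MeasurableSet.iUnion fun p => ?_)
    · exact measurableSet_le (by fun_prop) measurable_const
    · exact measurableSet_lt measurable_const (by fun_prop)
    · exact (MeasurableSet.const _).inter
        (measurableSet_lt_le (by fun_prop) (by fun_prop) (by fun_prop))
  refine (measure_mono hsub).trans ((measure_union_le _ _).trans ?_)
  rw [← Measure.map_apply hφm hEm, hφ, stdGaussian_map_inner hv]
  calc _ ≤ (∑ _j : Fin r, ENNReal.ofReal δ + ∑ _j : Fin r, ENNReal.ofReal δ
        + ∑ _p : Fin r × Fin r, ENNReal.ofReal (2 * δ)) + ENNReal.ofReal δ := by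
        gcongr
        · refine (measure_union_le _ _).trans ?_
          gcongr
          · refine (measure_union_le _ _).trans ?_
            gcongr
            · exact (measure_iUnion_fintype_le _ _).trans (Finset.sum_le_sum fun j _ => hE1 j)
            · exact (measure_iUnion_fintype_le _ _).trans (Finset.sum_le_sum fun j _ => hE2 j)
          · exact (measure_iUnion_fintype_le _ _).trans (Finset.sum_le_sum fun p _ => hE4 p)
        · exact stdGaussian_norm_sq_gt hδ hn
    _ = ENNReal.ofReal ((2 * r ^ 2 + 2 * r + 1) * δ) := by
        simp only [Finset.sum_const, Finset.card_univ, Fintype.card_fin, Fintype.card_prod,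
          nsmul_eq_mul]
        rw [← ENNReal.ofReal_natCast, ← ENNReal.ofReal_natCast, ← ENNReal.ofReal_mul (by positivity),
          ← ENNReal.ofReal_mul (by positivity), ← ENNReal.ofReal_add (by positivity) (by positivity),
          ← ENNReal.ofReal_add (by positivity) (by positivity),
          ← ENNReal.ofReal_add (by positivity) (by positivity)]
        congr 1
        push_cast
        ring

end InitialCondition

/-! ### Self-reinforcement of the leading spike -/

section Dynamics

variable {k n r : ℕ}

lemma norm_contract_le (Z : Tensor k n) {u : Vec n} (hu : ‖u‖ ≤ 1) :
    ‖contract Z u‖ ≤ ‖tensorMap Z‖ := by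
  rw [contract_eq]
  refine ((tensorMap Z).le_opNorm _).trans (mul_le_of_le_one_right (norm_nonneg _) ?_)
  exact Finset.prod_le_one (fun _ _ => norm_nonneg _) fun _ _ => hu

/-- Orthonormality decouples the spikes: up to noise, each coordinate evolves by itself. -/
lemma inner_contract_spiked {v : Fin r → Vec n} (hv : Orthonormal ℝ v) (β : Fin r → ℝ)
    (Z : Tensor k n) (u : Vec n) (j : Fin r) :
    inner ℝ (contract (spiked k β v Z) u) (v j)
      = β j * inner ℝ u (v j) ^ (k - 1) + inner ℝ (v j) (contract Z u) := by
  rw [contract_spiked, inner_add_left, hv.inner_left_fintype, real_inner_comm (contract Z u)]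
  simp

lemma sign_add_of_abs_lt {a e : ℝ} (h : |e| < |a|) : SignType.sign (a + e) = SignType.sign a := by
  have he := abs_lt.1 h
  rcases lt_trichotomy a 0 with ha | ha | ha
  · rw [abs_of_neg ha] at he
    rw [sign_neg ha, sign_neg (by linarith [he.2])]
  · simp only [ha, abs_zero] at h
    exact absurd h (not_lt.2 (abs_nonneg e))
  · rw [abs_of_pos ha] at he
    rw [sign_pos ha, sign_pos (by linarith [he.1])]

/-- The ratios `|⟨u, v j⟩| / |⟨u, v i⟩|` bounded by `q j` shrink under power iteration. -/
structure TrapData (k : ℕ) (β : Fin r → ℝ) (i : Fin r) (q : Fin r → ℝ) (θ ρ Q : ℝ) : Prop where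
  theta_nonneg : 0 ≤ θ
  theta_lt_one : θ < 1
  rho_pos : 0 < ρ
  rho_le : ∀ j, ρ ≤ q j
  le_Q : ∀ j, q j ≤ Q
  self : q i = 1
  gap : ∀ j, j ≠ i → |β j| * q j ^ (k - 2) ≤ θ * |β i|
  beta_ne : β i ≠ 0

/-- The ratios of the coordinates of `u` to its coordinate along `v i` are at most `q`. -/
def Trapped (v : Fin r → Vec n) (i : Fin r) (q : Fin r → ℝ) (u : Vec n) : Prop :=
  ∀ j, |inner ℝ u (v j)| ≤ q j * |inner ℝ u (v i)|

namespace TrapData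

variable {β : Fin r → ℝ} {i : Fin r} {q : Fin r → ℝ} {θ ρ Q : ℝ}

lemma q_pos (H : TrapData k β i q θ ρ Q) (j : Fin r) : 0 < q j := H.rho_pos.trans_le (H.rho_le j)

lemma one_le_Q (H : TrapData k β i q θ ρ Q) : 1 ≤ Q := H.self ▸ H.le_Q i

lemma rho_le_one (H : TrapData k β i q θ ρ Q) : ρ ≤ 1 := H.self ▸ H.rho_le i

lemma beta_mul_le (H : TrapData k β i q θ ρ Q) (j : Fin r) : |β j| * q j ^ (k - 2) ≤ |β i| := by
  by_cases hj : j = i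
  · rw [hj, H.self, one_pow, mul_one]
  · exact (H.gap j hj).trans (mul_le_of_le_one_left (abs_nonneg _) H.theta_lt_one.le)

lemma s_le_half (H : TrapData k β i q θ ρ Q) {s : ℝ} (hs0 : 0 ≤ s)
    (hs : s * (1 + Q) ≤ (1 - θ) * ρ) : s ≤ 1 / 2 := by
  have h1 := H.one_le_Q
  have h2 := H.rho_le_one
  have h3 := H.theta_nonneg
  have h4 := H.theta_lt_one
  nlinarith [H.rho_pos]

variable {v : Fin r → Vec n} {Z : Tensor k n} {u : Vec n} {s : ℝ}

/-- Of the factors in `q j ^ (k - 1)`, one reproduces the ratio bound and the other `k - 2` are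
absorbed by `gap`, leaving the contraction factor `θ`. -/
lemma abs_inner_contract_le (H : TrapData k β i q θ ρ Q) (hk : 2 ≤ k) (hv : Orthonormal ℝ v)
    (hu : Trapped v i q u) {j : Fin r} (hj : j ≠ i)
    (he : |inner ℝ (v j) (contract Z u)| ≤ s * (|β i| * |inner ℝ u (v i)| ^ (k - 1))) :
    |inner ℝ (contract (spiked k β v Z) u) (v j)|
      ≤ (θ * q j + s) * (|β i| * |inner ℝ u (v i)| ^ (k - 1)) := by
  rw [inner_contract_spiked hv]
  have hk1 : k - 1 = (k - 2) + 1 := by omega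
  have h1 : |β j * inner ℝ u (v j) ^ (k - 1)|
      ≤ θ * q j * (|β i| * |inner ℝ u (v i)| ^ (k - 1)) := by
    rw [abs_mul, abs_pow]
    calc |β j| * |inner ℝ u (v j)| ^ (k - 1)
        ≤ |β j| * (q j * |inner ℝ u (v i)|) ^ (k - 1) := by
          gcongr
          exact hu j
      _ = (|β j| * q j ^ (k - 2)) * q j * |inner ℝ u (v i)| ^ (k - 1) := by
          rw [mul_pow, hk1, pow_succ (q j)]
          ring
      _ ≤ (θ * |β i|) * q j * |inner ℝ u (v i)| ^ (k - 1) := by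
          have := (H.q_pos j).le
          exact mul_le_mul_of_nonneg_right (mul_le_mul_of_nonneg_right (H.gap j hj) this)
            (by positivity)
      _ = _ := by ring
  calc _ ≤ |β j * inner ℝ u (v j) ^ (k - 1)| + |inner ℝ (v j) (contract Z u)| := abs_add_le _ _
    _ ≤ _ := by linarith

lemma le_abs_inner_contract (hv : Orthonormal ℝ v)
    (he : |inner ℝ (v i) (contract Z u)| ≤ s * (|β i| * |inner ℝ u (v i)| ^ (k - 1))) :
    (1 - s) * (|β i| * |inner ℝ u (v i)| ^ (k - 1))
      ≤ |inner ℝ (contract (spiked k β v Z) u) (v i)| := by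
  rw [inner_contract_spiked hv]
  have h1 := abs_sub_abs_le_abs_sub (β i * inner ℝ u (v i) ^ (k - 1))
    (-inner ℝ (v i) (contract Z u))
  rw [sub_neg_eq_add, abs_neg, abs_mul, abs_pow] at h1
  linarith

/-- The contraction leaves room for noise: `θ q_j + s ≤ (1 - s) q_j` holds as soon as `s (1 + q_j) ≤
(1 - θ) q_j`, which `hs` ensures through `q_j ≤ Q` and `ρ ≤ q_j`. -/
lemma trapped_contract (H : TrapData k β i q θ ρ Q) (hk : 2 ≤ k) (hv : Orthonormal ℝ v)
    (hs : s * (1 + Q) ≤ (1 - θ) * ρ) (hs0 : 0 ≤ s) (hu : Trapped v i q u)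
    (he : ∀ j, |inner ℝ (v j) (contract Z u)| ≤ s * (|β i| * |inner ℝ u (v i)| ^ (k - 1))) :
    Trapped v i q (contract (spiked k β v Z) u) := by
  intro j
  by_cases hj : j = i
  · rw [hj, H.self, one_mul]
  refine (H.abs_inner_contract_le hk hv hu hj (he j)).trans ?_
  have h0 := le_abs_inner_contract hv (he i)
  refine le_trans ?_ (mul_le_mul_of_nonneg_left h0 (H.q_pos j).le)
  rw [← mul_assoc (q j)]
  refine mul_le_mul_of_nonneg_right ?_ (by positivity : 0 ≤ |β i| * |inner ℝ u (v i)| ^ (k - 1))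
  have h1 := H.le_Q j
  have h2 := H.rho_le j
  have h3 := H.theta_lt_one
  nlinarith

/-- Bounds the normalisation in one step. The other spikes cannot inflate it by more than a
constant, since their contributions are trapped relative to that of `v i`. -/
lemma norm_contract_spiked_le (H : TrapData k β i q θ ρ Q) (hk : 2 ≤ k) (hv : Orthonormal ℝ v)
    (hu : Trapped v i q u) (hu1 : ‖u‖ ≤ 1) {M : ℝ} (hM : ‖tensorMap Z‖ ≤ M) :
    ‖contract (spiked k β v Z) u‖ ≤ r * Q * (|β i| * |inner ℝ u (v i)| ^ (k - 1)) + M := by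
  rw [contract_spiked]
  refine (norm_add_le _ _).trans (add_le_add ?_ ((norm_contract_le Z hu1).trans hM))
  have hk1 : k - 1 = (k - 2) + 1 := by omega
  calc _ ≤ ∑ j, ‖(β j * inner ℝ u (v j) ^ (k - 1)) • v j‖ := norm_sum_le _ _
    _ ≤ ∑ _j : Fin r, Q * (|β i| * |inner ℝ u (v i)| ^ (k - 1)) := by
        refine Finset.sum_le_sum fun j _ => ?_
        rw [norm_smul, hv.1 j, mul_one, Real.norm_eq_abs, abs_mul, abs_pow]
        calc |β j| * |inner ℝ u (v j)| ^ (k - 1)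
            ≤ |β j| * (q j * |inner ℝ u (v i)|) ^ (k - 1) := by
              gcongr
              exact hu j
          _ = q j * ((|β j| * q j ^ (k - 2)) * |inner ℝ u (v i)| ^ (k - 1)) := by
              rw [mul_pow, hk1, pow_succ (q j)]
              ring
          _ ≤ Q * (|β i| * |inner ℝ u (v i)| ^ (k - 1)) := by
              have := H.one_le_Q
              have := (H.q_pos j).le
              exact mul_le_mul (H.le_Q j)
                (mul_le_mul_of_nonneg_right (H.beta_mul_le j) (by positivity)) (by positivity)
                (by positivity)
    _ = _ := by
        simp only [Finset.sum_const, Finset.card_univ, Fintype.card_fin, nsmul_eq_mul]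
        ring

lemma sign_inner_contract (H : TrapData k β i q θ ρ Q) (hv : Orthonormal ℝ v) (hs : s < 1)
    (hm : inner ℝ u (v i) ≠ 0)
    (he : |inner ℝ (v i) (contract Z u)| ≤ s * (|β i| * |inner ℝ u (v i)| ^ (k - 1))) :
    SignType.sign (inner ℝ (contract (spiked k β v Z) u) (v i))
      = SignType.sign (β i) * SignType.sign (inner ℝ u (v i)) ^ (k - 1) := by
  rw [inner_contract_spiked hv, sign_add_of_abs_lt, sign_mul, sign_pow]
  have : 0 < |β i| * |inner ℝ u (v i)| ^ (k - 1) := by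
    have := abs_pos.2 H.beta_ne
    have := abs_pos.2 hm
    positivity
  rw [abs_mul, abs_pow]
  nlinarith

lemma inner_contract_ne (H : TrapData k β i q θ ρ Q) (hv : Orthonormal ℝ v) (hs : s < 1)
    (hm : inner ℝ u (v i) ≠ 0)
    (he : |inner ℝ (v i) (contract Z u)| ≤ s * (|β i| * |inner ℝ u (v i)| ^ (k - 1))) :
    inner ℝ (contract (spiked k β v Z) u) (v i) ≠ 0 := by
  have h1 := H.sign_inner_contract hv hs hm he
  rw [← sign_ne_zero, h1]
  exact mul_ne_zero (sign_ne_zero.2 H.beta_ne) (pow_ne_zero _ (sign_ne_zero.2 hm))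

end TrapData

lemma inner_powerStep (X : Tensor k n) (u w : Vec n) :
    inner ℝ (powerStep X u) w = ‖contract X u‖⁻¹ * inner ℝ (contract X u) w := by
  rw [powerStep, real_inner_smul_left]

/-- One step of power iteration: the iterate stays trapped, and its coordinate along `v i` either
grows geometrically or is bounded below. -/
lemma TrapData.step {β : Fin r → ℝ} {i : Fin r} {q : Fin r → ℝ} {θ ρ Q : ℝ}
    {v : Fin r → Vec n} {Z : Tensor k n} {u : Vec n} {s M : ℝ}
    (H : TrapData k β i q θ ρ Q) (hk : 2 ≤ k) (hv : Orthonormal ℝ v)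
    (hs : s * (1 + Q) ≤ (1 - θ) * ρ) (hs0 : 0 ≤ s) (hM : ‖tensorMap Z‖ ≤ M) (hM0 : 0 < M)
    (hu : Trapped v i q u) (hu1 : ‖u‖ = 1) (hm : inner ℝ u (v i) ≠ 0)
    (he : ∀ j, |inner ℝ (v j) (contract Z u)| ≤ s * (|β i| * |inner ℝ u (v i)| ^ (k - 1))) :
    Trapped v i q (powerStep (spiked k β v Z) u) ∧ ‖powerStep (spiked k β v Z) u‖ = 1 ∧
    inner ℝ (powerStep (spiked k β v Z) u) (v i) ≠ 0 ∧
    SignType.sign (inner ℝ (powerStep (spiked k β v Z) u) (v i))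
      = SignType.sign (β i) * SignType.sign (inner ℝ u (v i)) ^ (k - 1) ∧
    min (1 / (4 * (r * Q))) (|β i| * |inner ℝ u (v i)| ^ (k - 1) / (4 * M))
      ≤ |inner ℝ (powerStep (spiked k β v Z) u) (v i)| := by
  have hs2 := H.s_le_half hs0 hs
  set F := contract (spiked k β v Z) u with hF
  have hne := H.inner_contract_ne hv (by linarith) hm (he i)
  have hF0 : F ≠ 0 := fun h => hne (by rw [← hF, h, inner_zero_left])
  have hFn : 0 < ‖F‖ := norm_pos_iff.2 hF0
  set x := |β i| * |inner ℝ u (v i)| ^ (k - 1) with hx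
  have hx0 : 0 < x := by
    have := abs_pos.2 H.beta_ne
    have := abs_pos.2 hm
    positivity
  have hr : 0 < r := i.pos
  have hQ := H.one_le_Q
  have hR : 0 < r * Q := by positivity
  have hFu := H.norm_contract_spiked_le hk hv hu hu1.le hM
  have hFl := TrapData.le_abs_inner_contract hv (he i)
  refine ⟨?_, ?_, ?_, ?_, ?_⟩
  · intro j
    rw [inner_powerStep, inner_powerStep, abs_mul, abs_mul, mul_left_comm]
    exact mul_le_mul_of_nonneg_left (H.trapped_contract hk hv hs hs0 hu he j) (abs_nonneg _)
  · rw [powerStep, norm_smul, norm_inv, norm_norm, inv_mul_cancel₀ hFn.ne']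
  · rw [inner_powerStep]
    exact mul_ne_zero (inv_ne_zero hFn.ne') hne
  · rw [inner_powerStep, sign_mul, sign_pos (inv_pos.2 hFn), one_mul]
    exact H.sign_inner_contract hv (by linarith) hm (he i)
  · rw [inner_powerStep, abs_mul, abs_of_pos (inv_pos.2 hFn), inv_mul_eq_div, ← hF]
    have h1 : x / 2 / (r * Q * x + M) ≤ |inner ℝ F (v i)| / ‖F‖ := by
      refine div_le_div₀ (abs_nonneg _) ?_ hFn hFu
      refine le_trans ?_ hFl
      nlinarith
    refine le_trans ?_ h1
    -- If the signal dominates the norm, the new coordinate is bounded below by a constant;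
    -- otherwise it is at least a multiple of the signal.
    rcases le_total M (r * Q * x) with h | h
    · refine (min_le_left _ _).trans ?_
      rw [div_div, div_le_div_iff₀ (by positivity) (by positivity)]
      nlinarith
    · refine (min_le_right _ _).trans ?_
      rw [div_div]
      exact div_le_div_of_nonneg_left hx0.le (by positivity) (by linarith)

/-- The trapped phase of power iteration. The noise is at most `η` during the first `T` steps, in
which the coordinate along `v i` grows by a factor `g` in each step. -/
lemma TrapData.iterate {β : Fin r → ℝ} {i : Fin r} {q : Fin r → ℝ} {θ ρ Q : ℝ}
    {v : Fin r → Vec n} {Z : Tensor k n} {u : Vec n} {s M m₁ g η : ℝ} {T : ℕ}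
    (H : TrapData k β i q θ ρ Q) (hk : 2 ≤ k) (hv : Orthonormal ℝ v)
    (hs : s * (1 + Q) ≤ (1 - θ) * ρ) (hs0 : 0 ≤ s) (hM : ‖tensorMap Z‖ ≤ M) (hM0 : 0 < M)
    (hm1 : 0 < m₁) (hm10 : m₁ ≤ 1 / (4 * (r * Q))) (hg : 1 ≤ g)
    (hgrow : 4 * M * g ≤ |β i| * m₁ ^ (k - 2)) (hη : η ≤ s * (4 * M * g * m₁))
    (hM2 : M ≤ s * (|β i| * (1 / (4 * (r * Q))) ^ (k - 1)))
    (hT : 1 / (4 * (r * Q)) ≤ g ^ T * m₁)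
    (hnoise : ∀ t < T, ∀ j, |inner ℝ (v j) (contract Z (powerIter (spiked k β v Z) u t))| ≤ η)
    (hu : Trapped v i q u) (hu1 : ‖u‖ = 1) (hum : m₁ ≤ |inner ℝ u (v i)|) (t : ℕ) :
    Trapped v i q (powerIter (spiked k β v Z) u t) ∧ ‖powerIter (spiked k β v Z) u t‖ = 1 ∧
    min (1 / (4 * (r * Q))) (g ^ t * m₁) ≤ |inner ℝ (powerIter (spiked k β v Z) u t) (v i)| ∧
    SignType.sign (inner ℝ (powerIter (spiked k β v Z) u (t + 1)) (v i))
      = SignType.sign (β i)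
        * SignType.sign (inner ℝ (powerIter (spiked k β v Z) u t) (v i)) ^ (k - 1) := by
  set X := spiked k β v Z with hX
  have hr : 0 < r := i.pos
  have hQ := H.one_le_Q
  have hR : 0 < r * Q := by positivity
  have hk1 : k - 1 = (k - 2) + 1 := by omega
  -- The relative noise is at most `s` at all times, for different reasons before and after time
  -- `T`.
  have key : ∀ t, Trapped v i q (powerIter X u t) → ‖powerIter X u t‖ = 1 →
      min (1 / (4 * (r * Q))) (g ^ t * m₁) ≤ |inner ℝ (powerIter X u t) (v i)| →
      inner ℝ (powerIter X u t) (v i) ≠ 0 ∧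
      ∀ j, |inner ℝ (v j) (contract Z (powerIter X u t))|
        ≤ s * (|β i| * |inner ℝ (powerIter X u t) (v i)| ^ (k - 1)) := by
    intro t _ h2 h3
    have hpos : m₁ ≤ |inner ℝ (powerIter X u t) (v i)| := by
      refine le_trans (le_min hm10 ?_) h3
      exact le_mul_of_one_le_left hm1.le (one_le_pow₀ hg)
    refine ⟨abs_pos.1 (hm1.trans_le hpos), fun j => ?_⟩
    by_cases ht : t < T
    · refine (hnoise t ht j).trans (hη.trans (mul_le_mul_of_nonneg_left ?_ hs0))
      calc 4 * M * g * m₁ ≤ |β i| * m₁ ^ (k - 2) * m₁ := by gcongr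
        _ = |β i| * m₁ ^ (k - 1) := by rw [hk1, pow_succ]; ring
        _ ≤ _ := by gcongr
    -- From time `T` on the coordinate is of order one, and the injective norm suffices; no control
    -- of the dependence between iterates and noise is needed any more.
    · have h5 : 1 / (4 * (r * Q)) ≤ |inner ℝ (powerIter X u t) (v i)| := by
        refine le_trans (le_min le_rfl (hT.trans ?_)) h3
        have : g ^ T ≤ g ^ t := pow_le_pow_right₀ hg (not_lt.1 ht)
        gcongr
      calc |inner ℝ (v j) (contract Z (powerIter X u t))|
          ≤ ‖v j‖ * ‖contract Z (powerIter X u t)‖ := abs_real_inner_le_norm _ _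
        _ ≤ M := by
            rw [hv.1 j, one_mul]
            exact (norm_contract_le Z h2.le).trans hM
        _ ≤ _ := hM2
        _ ≤ _ := by gcongr
  have main : ∀ t, Trapped v i q (powerIter X u t) ∧ ‖powerIter X u t‖ = 1 ∧
      min (1 / (4 * (r * Q))) (g ^ t * m₁) ≤ |inner ℝ (powerIter X u t) (v i)| := by
    intro t
    induction t with
    | zero =>
      refine ⟨hu, hu1, (min_le_right _ _).trans ?_⟩
      rw [pow_zero, one_mul]
      exact hum
    | succ t ih =>
      obtain ⟨h1, h2, h3⟩ := ih
      obtain ⟨h4, h5⟩ := key t h1 h2 h3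
      obtain ⟨h6, h7, _, _, h8⟩ := H.step hk hv hs hs0 hM hM0 h1 h2 h4 h5
      refine ⟨h6, h7, le_trans (le_min (min_le_left _ _) ?_) h8⟩
      set m := |inner ℝ (powerIter X u t) (v i)| with hm
      have hpos : m₁ ≤ m := by
        refine le_trans (le_min hm10 ?_) h3
        exact le_mul_of_one_le_left hm1.le (one_le_pow₀ hg)
      -- The growth factor is smallest at the lowest level `m₁`, where `hgrow` guarantees `g`.
      have h9 : g * m ≤ |β i| * m ^ (k - 1) / (4 * M) := by
        rw [le_div_iff₀ (by positivity)]
        calc g * m * (4 * M) = (4 * M * g) * m := by ring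
          _ ≤ (|β i| * m₁ ^ (k - 2)) * m := by
              have : 0 ≤ m := abs_nonneg _
              gcongr
          _ ≤ (|β i| * m ^ (k - 2)) * m := by
              have : 0 ≤ m := abs_nonneg _
              gcongr
          _ = _ := by rw [hk1, pow_succ]; ring
      refine le_trans ?_ h9
      rcases le_total (1 / (4 * (r * Q))) (g ^ t * m₁) with h | h
      · rw [min_eq_left h] at h3
        refine (min_le_left _ _).trans (h3.trans ?_)
        exact le_mul_of_one_le_left (abs_nonneg _) hg
      · rw [min_eq_right h] at h3
        refine (min_le_right _ _).trans ?_
        rw [pow_succ', mul_assoc]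
        gcongr
  obtain ⟨h1, h2, h3⟩ := main t
  obtain ⟨h4, h5⟩ := key t h1 h2 h3
  exact ⟨h1, h2, h3, (H.step hk hv hs hs0 hM hM0 h1 h2 h4 h5).2.2.2.1⟩

end Dynamics

/-! ### The tangent of the angle to a spike -/

section Tangent

variable {k n r : ℕ}

/-- The component of `x` orthogonal to the unit vector `w`. -/
noncomputable def perp (w x : Vec n) : Vec n := x - inner ℝ x w • w

lemma perp_add (w x y : Vec n) : perp w (x + y) = perp w x + perp w y := by
  simp only [perp, inner_add_left, add_smul]
  abel

lemma perp_smul (w : Vec n) (c : ℝ) (x : Vec n) : perp w (c • x) = c • perp w x := by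
  simp only [perp, real_inner_smul_left, smul_sub, smul_smul]

lemma perp_sub (w x y : Vec n) : perp w (x - y) = perp w x - perp w y := by
  simp only [perp, inner_sub_left, sub_smul]
  abel

lemma perp_sum {ι : Type*} (w : Vec n) (s : Finset ι) (x : ι → Vec n) :
    perp w (∑ j ∈ s, x j) = ∑ j ∈ s, perp w (x j) := by
  simp only [perp, sum_inner, Finset.sum_smul, Finset.sum_sub_distrib]

variable {w : Vec n}

lemma perp_self (hw : ‖w‖ = 1) : perp w w = 0 := by
  rw [perp, real_inner_self_eq_norm_sq, hw]
  simp

lemma inner_perp_self (hw : ‖w‖ = 1) (x : Vec n) : inner ℝ (perp w x) w = 0 := by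
  rw [perp, inner_sub_left, real_inner_smul_left, real_inner_self_eq_norm_sq, hw]
  simp

lemma inner_perp_of_orthogonal {y : Vec n} (hy : inner ℝ w y = 0) (x : Vec n) :
    inner ℝ (perp w x) y = inner ℝ x y := by
  rw [perp, inner_sub_left, real_inner_smul_left, hy]
  simp

lemma norm_sq_eq_perp (hw : ‖w‖ = 1) (x : Vec n) :
    ‖x‖ ^ 2 = inner ℝ x w ^ 2 + ‖perp w x‖ ^ 2 := by
  rw [perp, norm_sub_sq_real, norm_smul, hw, real_inner_smul_right, Real.norm_eq_abs, mul_one,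
    sq_abs]
  ring

lemma norm_perp_le (hw : ‖w‖ = 1) (x : Vec n) : ‖perp w x‖ ≤ ‖x‖ := by
  refine (sq_le_sq₀ (norm_nonneg _) (norm_nonneg _)).1 ?_
  rw [norm_sq_eq_perp hw x]
  nlinarith [sq_nonneg (inner ℝ x w : ℝ)]

/-- The tangent of the angle between `u` and the line spanned by `w`. -/
noncomputable def tanRatio (w u : Vec n) : ℝ := ‖perp w u‖ / |inner ℝ u w|

lemma tanRatio_nonneg (w u : Vec n) : 0 ≤ tanRatio w u := by
  unfold tanRatio
  positivity

lemma tanRatio_smul (w u : Vec n) {c : ℝ} (hc : c ≠ 0) : tanRatio w (c • u) = tanRatio w u := by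
  rw [tanRatio, tanRatio, perp_smul, norm_smul, real_inner_smul_left, abs_mul, Real.norm_eq_abs,
    mul_div_mul_left _ _ (abs_pos.2 hc).ne']

lemma norm_perp_le_tanRatio {u : Vec n} (hw : ‖w‖ = 1) (hu : ‖u‖ = 1) (hm : inner ℝ u w ≠ 0) :
    ‖perp w u‖ ≤ tanRatio w u := by
  have h1 : |inner ℝ u w| ≤ 1 := by
    refine (abs_real_inner_le_norm u w).trans ?_
    rw [hw, hu, mul_one]
  rw [tanRatio]
  exact le_div_self (norm_nonneg _) (abs_pos.2 hm) h1

/-- Pythagoras for the sum and Bessel's inequality for the coordinates of `u`; unlike the triangle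
inequality this costs no factor depending on `r`. -/
lemma norm_sum_erase_le {v : Fin r → Vec n} (hv : Orthonormal ℝ v) (i : Fin r) (c : Fin r → ℝ)
    (u : Vec n) {A : ℝ} (hA0 : 0 ≤ A) (hA : ∀ j, j ≠ i → |c j| ≤ A * |inner ℝ u (v j)|) :
    ‖∑ j ∈ Finset.univ.erase i, c j • v j‖ ≤ A * ‖perp (v i) u‖ := by
  refine (sq_le_sq₀ (norm_nonneg _) (by positivity)).1 ?_
  have h1 : ‖∑ j ∈ Finset.univ.erase i, c j • v j‖ ^ 2 = ∑ j ∈ Finset.univ.erase i, c j ^ 2 := by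
    rw [← real_inner_self_eq_norm_sq, hv.inner_sum]
    simp [sq]
  have h2 : ∑ j ∈ Finset.univ.erase i, inner ℝ (v j) (perp (v i) u) ^ 2 ≤ ‖perp (v i) u‖ ^ 2 := by
    have := hv.sum_inner_products_le (perp (v i) u) (s := Finset.univ.erase i)
    simpa using this
  rw [h1, mul_pow]
  refine le_trans ?_ (mul_le_mul_of_nonneg_left h2 (by positivity))
  rw [Finset.mul_sum]
  refine Finset.sum_le_sum fun j hj => ?_
  have hji := Finset.ne_of_mem_erase hj
  rw [real_inner_comm, inner_perp_of_orthogonal (hv.2 hji.symm), ← mul_pow, ← sq_abs (c j),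
    ← sq_abs (A * _), abs_mul, abs_of_nonneg hA0]
  have := hA j hji
  gcongr

/-- One factor `⟨u, v j⟩` is kept for Bessel's inequality. The bound `A` on the remaining factors is
left open: in the trapped phase it gives linear, near the spike superlinear contraction. -/
lemma norm_perp_contract_le {v : Fin r → Vec n} (hv : Orthonormal ℝ v) (hk : 2 ≤ k) (i : Fin r)
    (β : Fin r → ℝ) (Z : Tensor k n) {u : Vec n} (hu : ‖u‖ ≤ 1) {A : ℝ} (hA0 : 0 ≤ A)
    (hA : ∀ j, j ≠ i → |β j| * |inner ℝ u (v j)| ^ (k - 2) ≤ A) :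
    ‖perp (v i) (contract (spiked k β v Z) u)‖ ≤ A * ‖perp (v i) u‖ + ‖tensorMap Z‖ := by
  rw [contract_spiked, perp_add, perp_sum]
  refine (norm_add_le _ _).trans (add_le_add ?_
    ((norm_perp_le (hv.1 i) _).trans (norm_contract_le Z hu)))
  rw [← Finset.add_sum_erase _ _ (Finset.mem_univ i), perp_smul, perp_self (hv.1 i), smul_zero,
    zero_add]
  have h1 : ∑ j ∈ Finset.univ.erase i, perp (v i) ((β j * inner ℝ u (v j) ^ (k - 1)) • v j)
      = ∑ j ∈ Finset.univ.erase i, (β j * inner ℝ u (v j) ^ (k - 1)) • v j := by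
    refine Finset.sum_congr rfl fun j hj => ?_
    rw [perp_smul]
    congr 1
    rw [perp, hv.2 (Finset.ne_of_mem_erase hj)]
    simp
  rw [h1]
  refine norm_sum_erase_le hv i _ u hA0 fun j hj => ?_
  have hk1 : k - 1 = (k - 2) + 1 := by omega
  rw [abs_mul, abs_pow, hk1, pow_succ, ← mul_assoc]
  exact mul_le_mul_of_nonneg_right (hA j hj) (abs_nonneg _)

/-- One step of power iteration for the tangent. -/
lemma tanRatio_powerStep_le {v : Fin r → Vec n} (hv : Orthonormal ℝ v) (hk : 2 ≤ k) {i : Fin r}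
    {β : Fin r → ℝ} {Z : Tensor k n} {u : Vec n} (hu : ‖u‖ = 1) {A M s m₀ : ℝ} (hA0 : 0 ≤ A)
    (hA : ∀ j, j ≠ i → |β j| * |inner ℝ u (v j)| ^ (k - 2) ≤ A) (hM : ‖tensorMap Z‖ ≤ M)
    (hm0 : 0 < m₀) (hm : m₀ ≤ |inner ℝ u (v i)|) (hβ : β i ≠ 0) (hs : s < 1)
    (hs0 : M ≤ s * (|β i| * m₀ ^ (k - 1))) :
    (1 - s) * tanRatio (v i) (powerStep (spiked k β v Z) u)
      ≤ A / (|β i| * |inner ℝ u (v i)| ^ (k - 2)) * tanRatio (v i) u + s := by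
  set m := |inner ℝ u (v i)| with hmdef
  have hm' : 0 < m := hm0.trans_le hm
  have hb : 0 < |β i| := abs_pos.2 hβ
  have hk1 : k - 1 = (k - 2) + 1 := by omega
  have hs' : 0 ≤ s := by
    have h1 : 0 < |β i| * m₀ ^ (k - 1) := by positivity
    have h2 : 0 ≤ s * (|β i| * m₀ ^ (k - 1)) := ((norm_nonneg _).trans hM).trans hs0
    exact nonneg_of_mul_nonneg_left h2 h1
  set x := |β i| * m ^ (k - 1) with hx
  have hx0 : 0 < x := by positivity
  have hMx : M ≤ s * x := hs0.trans (mul_le_mul_of_nonneg_left (by rw [hx]; gcongr) hs')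
  have he : |inner ℝ (v i) (contract Z u)| ≤ s * x := by
    refine le_trans ?_ hMx
    refine (abs_real_inner_le_norm _ _).trans ?_
    rw [hv.1 i, one_mul]
    exact (norm_contract_le Z hu.le).trans hM
  set F := contract (spiked k β v Z) u with hF
  have hFl : (1 - s) * x ≤ |inner ℝ F (v i)| := TrapData.le_abs_inner_contract hv he
  have hFp : 0 < |inner ℝ F (v i)| := lt_of_lt_of_le (by nlinarith) hFl
  have hF0 : F ≠ 0 := fun h => by
    rw [h, inner_zero_left, abs_zero] at hFp
    exact lt_irrefl _ hFp
  have hp : ‖perp (v i) F‖ ≤ A * ‖perp (v i) u‖ + M :=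
    (norm_perp_contract_le hv hk i β Z hu.le hA0 hA).trans (by gcongr)
  rw [powerStep, tanRatio_smul _ _ (inv_ne_zero (norm_ne_zero_iff.2 hF0)), tanRatio, tanRatio,
    ← hF, ← hmdef]
  have h1 : A / (|β i| * m ^ (k - 2)) * (‖perp (v i) u‖ / m) = A * ‖perp (v i) u‖ / x := by
    rw [hx, hk1, pow_succ, div_mul_div_comm]
    ring
  rw [h1]
  calc (1 - s) * (‖perp (v i) F‖ / |inner ℝ F (v i)|)
      = (1 - s) * ‖perp (v i) F‖ / |inner ℝ F (v i)| := by ring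
    _ ≤ (1 - s) * ‖perp (v i) F‖ / ((1 - s) * x) := by
        have : 0 < 1 - s := by linarith
        gcongr
    _ = ‖perp (v i) F‖ / x := by
        have : 1 - s ≠ 0 := by linarith
        field_simp
    _ ≤ (A * ‖perp (v i) u‖ + s * x) / x := by
        gcongr
        linarith
    _ = A * ‖perp (v i) u‖ / x + s := by field_simp

/-- A linear recursion contracts up to the size of the noise. -/
lemma linear_recursion {y : ℕ → ℝ} {θ s y₀ : ℝ} (hθ0 : 0 ≤ θ) (hθ : θ < 1) (hs0 : 0 ≤ s)
    (hs : s ≤ (1 - θ) / 2) (hy : ∀ t, 0 ≤ y t) (h0 : y 0 ≤ y₀)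
    (h : ∀ t, (1 - s) * y (t + 1) ≤ θ * y t + s) (t : ℕ) :
    y t ≤ ((1 + θ) / 2) ^ t * y₀ + 4 * s / (1 - θ) := by
  have h1θ : 0 < 1 - θ := by linarith
  set D := 4 * s / (1 - θ) with hD
  have hD1 : D * (1 - θ) = 4 * s := by rw [hD]; field_simp
  have hD0 : 0 ≤ D := by positivity
  induction t with
  | zero =>
    rw [pow_zero, one_mul]
    linarith
  | succ t ih =>
    have h2 : y (t + 1) ≤ (1 + θ) / 2 * y t + 2 * s := by
      have h3 := h t
      have h4 := hy t
      have h5 := hy (t + 1)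
      -- Here `1 - s ≥ (1 + θ) / 2`, and the square of `(1 + θ) / 2` is at least `θ`; for the
      -- constant term `s ≤ 1 / 2` suffices.
      have h6 : (1 - s) * ((1 + θ) / 2 * y t + 2 * s) ≥ θ * y t + s := by
        have : (1 - s) * ((1 + θ) / 2) ≥ θ := by nlinarith
        nlinarith [mul_le_mul_of_nonneg_right this h4]
      have h7 : 0 < 1 - s := by linarith
      exact le_of_mul_le_mul_left (h3.trans h6) h7
    refine h2.trans ?_
    rw [pow_succ']
    have h3 : (1 + θ) / 2 * y t ≤ (1 + θ) / 2 * (((1 + θ) / 2) ^ t * y₀ + D) :=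
      mul_le_mul_of_nonneg_left ih (by linarith)
    nlinarith

/-- A superlinear recursion converges doubly exponentially, up to the size of the noise. -/
lemma superlinear_recursion {z : ℕ → ℝ} {a D : ℝ} {p : ℕ} (hp : 2 ≤ p) (ha0 : 0 ≤ a)
    (ha : a ≤ 1 / 4) (hz : ∀ t, 0 ≤ z t) (h0 : 2 * z 0 ≤ D)
    (h : ∀ t, z (t + 1) ≤ z t ^ p + a) (t : ℕ) : 2 * z t ≤ max (4 * a) (D ^ p ^ t) := by
  induction t with
  | zero =>
    rw [pow_zero, pow_one]
    exact h0.trans (le_max_right _ _)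
  | succ t ih =>
    rcases le_total (2 * z t) (4 * a) with h1 | h1
    · refine le_trans ?_ (le_max_left _ _)
      have h2 : z t ^ p ≤ z t ^ 2 := pow_le_pow_of_le_one (hz t) (by linarith) hp
      have h3 := hz t
      have h4 := h t
      nlinarith
    · have h2 : 2 * z t ≤ max (4 * a) (D ^ p ^ t) := ih
      -- Doubling `z` absorbs the additive error: if `a ≤ z ^ p` then `2 (z ^ p + a) ≤ 4 z ^ p ≤ (2
      -- z) ^ p`, and otherwise the new value is already at the floor `4 a`.
      rcases le_total (z t ^ p) a with h3 | h3
      · refine le_trans ?_ (le_max_left _ _)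
        linarith [h t]
      · have h5 : 2 * z (t + 1) ≤ (2 * z t) ^ p := by
          have h6 : (4 : ℝ) ≤ 2 ^ p := by
            calc (4 : ℝ) = 2 ^ 2 := by norm_num
              _ ≤ 2 ^ p := pow_le_pow_right₀ (by norm_num) hp
          rw [mul_pow]
          have h7 : 0 ≤ z t ^ p := pow_nonneg (hz t) p
          nlinarith [h t]
        rcases le_max_iff.1 h2 with h8 | h8
        · have h9 : 2 * z t = 4 * a := le_antisymm h8 h1
          refine le_trans ?_ (le_max_left _ _)
          have h10 : z t ^ p ≤ z t ^ 2 := pow_le_pow_of_le_one (hz t) (by linarith) hp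
          have h4 := h t
          nlinarith
        · refine le_trans ?_ (le_max_right _ _)
          refine h5.trans ?_
          rw [pow_succ, pow_mul]
          have := hz t
          gcongr

lemma contract_smul (Z : Tensor k n) (c : ℝ) (u : Vec n) :
    contract Z (c • u) = c ^ (k - 1) • contract Z u := by
  rw [contract_eq, contract_eq]
  have := (tensorMap Z).map_smul_univ (fun _ => c) (fun _ => u)
  simpa using this

lemma norm_contract_sub_le (Z : Tensor k n) {u w : Vec n} (hu : ‖u‖ ≤ 1) (hw : ‖w‖ ≤ 1) :
    ‖contract Z u - contract Z w‖ ≤ ‖tensorMap Z‖ * (k - 1 : ℕ) * ‖u - w‖ := by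
  rw [contract_eq, contract_eq]
  refine ((tensorMap Z).norm_image_sub_le _ _).trans ?_
  rw [Fintype.card_fin]
  have h1 : max ‖fun _ : Fin (k - 1) => u‖ ‖fun _ : Fin (k - 1) => w‖ ^ (k - 1 - 1) ≤ 1 := by
    refine pow_le_one₀ (le_max_of_le_left (norm_nonneg _)) (max_le ?_ ?_)
    · exact (pi_norm_const_le u).trans hu
    · exact (pi_norm_const_le w).trans hw
  have h2 : ‖(fun _ : Fin (k - 1) => u) - (fun _ : Fin (k - 1) => w)‖ ≤ ‖u - w‖ :=
    pi_norm_const_le (u - w)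
  calc _ ≤ ‖tensorMap Z‖ * (k - 1 : ℕ) * 1 * ‖u - w‖ := by gcongr
    _ = _ := by ring

lemma abs_inner_contract_sub_le (Z : Tensor k n) (hk : 2 ≤ k) {u w : Vec n} (hu : ‖u‖ ≤ 1)
    (hw : ‖w‖ ≤ 1) :
    |inner ℝ u (contract Z u) - inner ℝ w (contract Z w)| ≤ k * ‖tensorMap Z‖ * ‖u - w‖ := by
  have h1 : inner ℝ u (contract Z u) - inner ℝ w (contract Z w)
      = inner ℝ (u - w) (contract Z u) + inner ℝ w (contract Z u - contract Z w) := by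
    rw [inner_sub_left, inner_sub_right]
    ring
  rw [h1]
  have h2 := (abs_real_inner_le_norm (u - w) (contract Z u)).trans
    (mul_le_mul_of_nonneg_left (norm_contract_le Z hu) (norm_nonneg _))
  have h3 := (abs_real_inner_le_norm w (contract Z u - contract Z w)).trans
    (mul_le_mul hw (norm_contract_sub_le Z hu hw) (norm_nonneg _) zero_le_one)
  have h4 : ((k - 1 : ℕ) : ℝ) = k - 1 := by
    rw [Nat.cast_sub (by omega)]
    simp
  rw [h4] at h3
  refine (abs_add_le _ _).trans ((add_le_add h2 h3).trans (le_of_eq ?_))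
  ring

lemma powerVal_eq (hk : 1 ≤ k) {v : Fin r → Vec n} (β : Fin r → ℝ)
    (Z : Tensor k n) (u : Vec n) :
    inner ℝ u (contract (spiked k β v Z) u)
      = ∑ j, β j * inner ℝ u (v j) ^ k + inner ℝ u (contract Z u) := by
  rw [contract_spiked, inner_add_right, inner_sum]
  congr 1
  refine Finset.sum_congr rfl fun j _ => ?_
  rw [real_inner_smul_right, mul_assoc, ← pow_succ, Nat.sub_add_cancel hk]

/-- A unit vector `u` with small tangent is close to `± w`. -/
lemma norm_sub_sign_smul_le {u : Vec n} (hw : ‖w‖ = 1) (hu : ‖u‖ = 1) (hm : inner ℝ u w ≠ 0) :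
    ‖u - ((SignType.sign (inner ℝ u w : ℝ) : SignType) : ℝ) • w‖ ≤ 2 * tanRatio w u := by
  set m : ℝ := inner ℝ u w with hmdef
  have hp := norm_perp_le_tanRatio hw hu hm
  have hsq := norm_sq_eq_perp hw u
  rw [hu, ← hmdef] at hsq
  have hm1 : |m| ≤ 1 := by
    have := (abs_real_inner_le_norm u w)
    rwa [hw, hu, mul_one] at this
  have hp1 : ‖perp w u‖ ≤ 1 := (norm_perp_le hw u).trans hu.le
  have h1 : u - ((SignType.sign m : SignType) : ℝ) • w
      = perp w u + (m - ((SignType.sign m : SignType) : ℝ)) • w := by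
    rw [perp, sub_smul]
    abel
  have h2 : |m - ((SignType.sign m : SignType) : ℝ)| = 1 - |m| := by
    rcases lt_or_gt_of_ne hm with h | h
    · rw [sign_neg h, abs_of_neg h] at *
      simp only [SignType.coe_neg, SignType.coe_one, sub_neg_eq_add]
      rw [abs_of_nonneg (by linarith)]
      ring
    · rw [sign_pos h, abs_of_pos h] at *
      simp only [SignType.coe_one]
      rw [abs_of_nonpos (by linarith)]
      ring
  rw [h1]
  refine (norm_add_le _ _).trans ?_
  rw [norm_smul, hw, mul_one, Real.norm_eq_abs, h2]
  have h3 : |m| ^ 2 = m ^ 2 := sq_abs m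
  have h4 : 0 ≤ |m| := abs_nonneg m
  have h5 : 0 ≤ ‖perp w u‖ := norm_nonneg _
  nlinarith

/-- The signal varies only to second order in the tangent `y`: `1 - |⟨u, v i⟩| ≤ y²`, and the other
coordinates enter with power `k ≥ 2`. So a factor `B` appears only with `y²`, and this error is `O(1
/ B)` when `y = O(1 / B)`. The noise is merely Lipschitz. -/
lemma abs_powerVal_sub_le {v : Fin r → Vec n} (hv : Orthonormal ℝ v) (hk : 2 ≤ k)
    {β : Fin r → ℝ} {B : ℝ} (hB : ∀ j, |β j| ≤ B) (Z : Tensor k n) {u : Vec n} (hu : ‖u‖ = 1)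
    {i : Fin r} (hm : inner ℝ u (v i) ≠ 0) :
    |inner ℝ u (contract (spiked k β v Z) u)
        - β i * ((SignType.sign (inner ℝ u (v i) : ℝ) : SignType) : ℝ) ^ k|
      ≤ (k + r) * B * tanRatio (v i) u ^ 2 + 2 * k * ‖tensorMap Z‖ * tanRatio (v i) u
        + |inner ℝ (v i) (contract Z (v i))| := by
  set m : ℝ := inner ℝ u (v i) with hmdef
  set σ : ℝ := ((SignType.sign m : SignType) : ℝ) with hσ
  set y := tanRatio (v i) u with hy
  have hB0 : 0 ≤ B := (abs_nonneg _).trans (hB i)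
  have hσ1 : |σ| = 1 := by
    rcases lt_or_gt_of_ne hm with h | h
    · simp [hσ, sign_neg h]
    · simp [hσ, sign_pos h]
  have hσm : m = σ * |m| := by
    rcases lt_or_gt_of_ne hm with h | h
    · simp [hσ, sign_neg h, abs_of_neg h]
    · simp [hσ, sign_pos h, abs_of_pos h]
  have hp := norm_perp_le_tanRatio (hv.1 i) hu hm
  have hsq := norm_sq_eq_perp (hv.1 i) u
  rw [hu, ← hmdef] at hsq
  have hm1 : |m| ≤ 1 := by
    have := (abs_real_inner_le_norm u (v i))
    rwa [hv.1 i, hu, mul_one] at this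
  have hy0 := tanRatio_nonneg (v i) u
  have hpy : ‖perp (v i) u‖ ^ 2 ≤ y ^ 2 := by gcongr
  rw [powerVal_eq (by omega), ← Finset.add_sum_erase _ _ (Finset.mem_univ i)]
  have h1 : |β i * m ^ k - β i * σ ^ k| ≤ B * (k * y ^ 2) := by
    rw [← mul_sub, abs_mul]
    refine mul_le_mul (hB i) ?_ (abs_nonneg _) hB0
    have h2 : m ^ k - σ ^ k = σ ^ k * (|m| ^ k - 1) := by
      nth_rw 1 [hσm]
      rw [mul_pow]
      ring
    rw [h2, abs_mul, abs_pow, hσ1, one_pow, one_mul, abs_sub_comm,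
      abs_of_nonneg (sub_nonneg.2 (pow_le_one₀ (abs_nonneg _) hm1))]
    have h3 := one_add_mul_le_pow (a := |m| - 1) (by linarith [abs_nonneg m]) k
    have h4 : 1 + (|m| - 1) = |m| := by ring
    rw [h4] at h3
    have h5 : 1 - |m| ≤ y ^ 2 := by
      have h6 : |m| ^ 2 = m ^ 2 := sq_abs m
      nlinarith [abs_nonneg m]
    have h7 : (k : ℝ) * (1 - |m|) ≤ k * y ^ 2 := by gcongr
    linarith
  have h2 : |∑ j ∈ Finset.univ.erase i, β j * inner ℝ u (v j) ^ k| ≤ r * (B * y ^ 2) := by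
    refine (Finset.abs_sum_le_sum_abs _ _).trans ?_
    calc _ ≤ ∑ _j ∈ Finset.univ.erase i, B * y ^ 2 := by
          refine Finset.sum_le_sum fun j hj => ?_
          have hji := Finset.ne_of_mem_erase hj
          rw [abs_mul, abs_pow]
          have h3 : |inner ℝ u (v j)| ≤ ‖perp (v i) u‖ := by
            rw [← inner_perp_of_orthogonal (hv.2 hji.symm) u]
            refine (abs_real_inner_le_norm _ _).trans ?_
            rw [hv.1 j, mul_one]
          have h4 : |inner ℝ u (v j)| ≤ 1 := by
            refine (abs_real_inner_le_norm _ _).trans ?_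
            rw [hv.1 j, hu, mul_one]
          refine mul_le_mul (hB j) ?_ (by positivity) hB0
          calc |inner ℝ u (v j)| ^ k ≤ |inner ℝ u (v j)| ^ 2 :=
                pow_le_pow_of_le_one (abs_nonneg _) h4 hk
            _ ≤ ‖perp (v i) u‖ ^ 2 := by gcongr
            _ ≤ y ^ 2 := hpy
      _ ≤ ∑ _j : Fin r, B * y ^ 2 :=
          Finset.sum_le_sum_of_subset_of_nonneg (Finset.erase_subset _ _)
            fun _ _ _ => by positivity
      _ = _ := by simp
  have h3 := abs_inner_contract_sub_le Z hk hu.le (w := σ • v i) (by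
    rw [norm_smul, hv.1 i, Real.norm_eq_abs, hσ1, mul_one])
  have h4 := norm_sub_sign_smul_le (hv.1 i) hu hm
  rw [← hmdef, ← hσ, ← hy] at h4
  have h5 : |inner ℝ (σ • v i) (contract Z (σ • v i))| = |inner ℝ (v i) (contract Z (v i))| := by
    rw [contract_smul, real_inner_smul_left, real_inner_smul_right, abs_mul, abs_mul, abs_pow, hσ1]
    simp
  have h6 : (k : ℝ) * ‖tensorMap Z‖ * ‖u - σ • v i‖ ≤ k * ‖tensorMap Z‖ * (2 * y) := by gcongr
  have h7 : |inner ℝ u (contract Z u)|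
      ≤ k * ‖tensorMap Z‖ * (2 * y) + |inner ℝ (v i) (contract Z (v i))| := by
    rw [← h5]
    have := abs_sub_abs_le_abs_sub (inner ℝ u (contract Z u) : ℝ)
      (inner ℝ (σ • v i) (contract Z (σ • v i)))
    linarith
  have e : β i * m ^ k + ∑ j ∈ Finset.univ.erase i, β j * inner ℝ u (v j) ^ k
        + inner ℝ u (contract Z u) - β i * σ ^ k
      = (β i * m ^ k - β i * σ ^ k) + ∑ j ∈ Finset.univ.erase i, β j * inner ℝ u (v j) ^ k
        + inner ℝ u (contract Z u) := by ring
  rw [e]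
  refine (abs_add_three _ _ _).trans ((add_le_add (add_le_add h1 h2) h7).trans (le_of_eq ?_))
  ring

end Tangent

/-! ### First-order expansion of the noise, and tangent vectors -/

section SlotDeriv

variable {k n r : ℕ}

/-- The derivative of `u ↦ Z[u^{⊗(k-1)}]` at `w` in direction `x`. -/
noncomputable def slotDeriv (Z : Tensor k n) (w x : Vec n) : Vec n :=
  ∑ s, tensorMap Z (Function.update (fun _ => w) s x)

lemma slotDeriv_sub (Z : Tensor k n) (w x y : Vec n) :
    slotDeriv Z w (x - y) = slotDeriv Z w x - slotDeriv Z w y := by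
  simp only [slotDeriv, ContinuousMultilinearMap.map_update_sub, Finset.sum_sub_distrib]

lemma slotDeriv_smul (Z : Tensor k n) (w : Vec n) (c : ℝ) (x : Vec n) :
    slotDeriv Z w (c • x) = c • slotDeriv Z w x := by
  simp only [slotDeriv, ContinuousMultilinearMap.map_update_smul, Finset.smul_sum]

lemma norm_slotDeriv_le (Z : Tensor k n) {w : Vec n} (hw : ‖w‖ = 1) (x : Vec n) :
    ‖slotDeriv Z w x‖ ≤ k * ‖tensorMap Z‖ * ‖x‖ := by
  refine (norm_sum_le _ _).trans ?_
  calc _ ≤ ∑ _s : Fin (k - 1), ‖tensorMap Z‖ * ‖x‖ := by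
        refine Finset.sum_le_sum fun s _ => ((tensorMap Z).le_opNorm _).trans ?_
        refine mul_le_mul_of_nonneg_left (le_of_eq ?_) (norm_nonneg _)
        rw [← Finset.mul_prod_erase _ _ (Finset.mem_univ s), Function.update_self,
          Finset.prod_eq_one, mul_one]
        intro t ht
        rw [Function.update_of_ne (Finset.ne_of_mem_erase ht), hw]
    _ = (k - 1 : ℕ) * (‖tensorMap Z‖ * ‖x‖) := by simp
    _ ≤ k * (‖tensorMap Z‖ * ‖x‖) := by
        have : k - 1 ≤ k := Nat.sub_le _ _
        gcongr
    _ = _ := by ring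

/-- Multilinear expansion over the set of slots that receive `x`: the remainder consists of the sets
with at least two slots, fewer than `2 ^ k` in number. -/
lemma norm_contract_add_sub_le (Z : Tensor k n) {w x : Vec n} (hw : ‖w‖ = 1) (hx : ‖x‖ ≤ 1) :
    ‖contract Z (w + x) - contract Z w - slotDeriv Z w x‖
      ≤ 2 ^ k * ‖tensorMap Z‖ * ‖x‖ ^ 2 := by
  classical
  have h := (tensorMap Z).toMultilinearMap.map_add_eq_map_add_linearDeriv_add (fun _ => w)
    (fun _ => x)
  have h1 : contract Z (w + x) - contract Z w - slotDeriv Z w x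
      = ∑ s : Finset (Fin (k - 1)) with 2 ≤ s.card,
        tensorMap Z (s.piecewise (fun _ => x) (fun _ => w)) := by
    rw [MultilinearMap.linearDeriv_apply] at h
    rw [sub_sub, sub_eq_iff_eq_add', contract_eq, contract_eq, slotDeriv]
    exact h
  rw [h1]
  refine (norm_sum_le _ _).trans ?_
  calc _ ≤ ∑ _s : Finset (Fin (k - 1)) with 2 ≤ _s.card, ‖tensorMap Z‖ * ‖x‖ ^ 2 := by
        refine Finset.sum_le_sum fun s hs => ((tensorMap Z).le_opNorm _).trans ?_
        refine mul_le_mul_of_nonneg_left ?_ (norm_nonneg _)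
        have h2 : ∀ t, ‖s.piecewise (fun _ => x) (fun _ => w) t‖
            = if t ∈ s then ‖x‖ else 1 := by
          intro t
          by_cases ht : t ∈ s
          · simp [ht]
          · simp [ht, hw]
        simp only [h2]
        rw [Finset.prod_ite]
        simp only [Finset.prod_const, one_pow, mul_one, Finset.filter_mem_eq_inter,
          Finset.univ_inter]
        exact pow_le_pow_of_le_one (norm_nonneg _) hx (Finset.mem_filter.1 hs).2
    _ ≤ ∑ _s : Finset (Fin (k - 1)), ‖tensorMap Z‖ * ‖x‖ ^ 2 :=
        Finset.sum_le_sum_of_subset_of_nonneg (Finset.filter_subset _ _)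
          fun _ _ _ => by positivity
    _ = 2 ^ (k - 1) * (‖tensorMap Z‖ * ‖x‖ ^ 2) := by simp
    _ ≤ 2 ^ k * (‖tensorMap Z‖ * ‖x‖ ^ 2) := by
        have : (2 : ℝ) ^ (k - 1) ≤ 2 ^ k := pow_le_pow_right₀ (by norm_num) (Nat.sub_le _ _)
        gcongr
    _ = _ := by ring

/-- The tangent vector of `u` at `w`: up to scaling, `u` is `w + tanVec w u`. -/
noncomputable def tanVec (w u : Vec n) : Vec n := (inner ℝ u w : ℝ)⁻¹ • perp w u

lemma norm_tanVec (w u : Vec n) : ‖tanVec w u‖ = tanRatio w u := by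
  rw [tanVec, norm_smul, norm_inv, Real.norm_eq_abs, tanRatio, inv_mul_eq_div]

lemma tanVec_smul (w u : Vec n) {c : ℝ} (hc : c ≠ 0) : tanVec w (c • u) = tanVec w u := by
  rw [tanVec, tanVec, perp_smul, real_inner_smul_left, smul_smul, mul_inv, mul_comm c⁻¹, mul_assoc,
    inv_mul_cancel₀ hc, mul_one]

lemma eq_smul_add_tanVec {w u : Vec n} (hm : inner ℝ u w ≠ 0) :
    u = (inner ℝ u w : ℝ) • (w + tanVec w u) := by
  rw [tanVec, smul_add, smul_smul, mul_inv_cancel₀ hm, one_smul, perp]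
  abel

lemma inner_tanVec_self {w : Vec n} (hw : ‖w‖ = 1) (u : Vec n) : inner ℝ (tanVec w u) w = 0 := by
  rw [tanVec, real_inner_smul_left, inner_perp_self hw, mul_zero]

/-- A tangent vector depends only on the line of its argument and the contraction is homogeneous, so
the normalisation drops out: tangent vectors satisfy an exact recursion of their own. -/
lemma tanVec_powerStep {w u : Vec n} (hm : inner ℝ u w ≠ 0) (X : Tensor k n) :
    tanVec w (powerStep X u) = tanVec w (contract X (w + tanVec w u)) := by
  by_cases h0 : contract X u = 0
  · have h1 : contract X (w + tanVec w u) = 0 := by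
      rw [eq_smul_add_tanVec hm, contract_smul] at h0
      exact (smul_eq_zero.1 h0).resolve_left (pow_ne_zero _ hm)
    rw [powerStep, h0, h1, smul_zero]
  · rw [powerStep, tanVec_smul _ _ (inv_ne_zero (norm_ne_zero_iff.2 h0))]
    nth_rw 1 [eq_smul_add_tanVec hm]
    rw [contract_smul, tanVec_smul _ _ (pow_ne_zero _ hm)]

/-- Perturbation of a quotient. It is stated for vectors so as to serve both the tangent vector and
its component along `a`. -/
lemma norm_div_sub_div_le {E : Type*} [NormedAddCommGroup E] [NormedSpace ℝ E] {f b : ℝ}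
    {P p : E} (hb : b ≠ 0) (hf : |f - b| ≤ |b| / 2) :
    ‖f⁻¹ • P - b⁻¹ • p‖ ≤ 2 * |b|⁻¹ * ‖P - p‖ + 2 * |b|⁻¹ ^ 2 * |f - b| * ‖p‖ := by
  have hb' : 0 < |b| := abs_pos.2 hb
  have hfb : |b| / 2 ≤ |f| := by
    have := abs_sub_abs_le_abs_sub b f
    rw [abs_sub_comm] at this
    linarith
  have hf0 : f ≠ 0 := abs_pos.1 (by linarith)
  have h1 : f⁻¹ • P - b⁻¹ • p = f⁻¹ • (P - p) + (f⁻¹ * b⁻¹ * (b - f)) • p := by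
    have : f⁻¹ * b⁻¹ * (b - f) = f⁻¹ - b⁻¹ := by field_simp
    rw [this, smul_sub, sub_smul]
    abel
  have h2 : |f|⁻¹ ≤ 2 * |b|⁻¹ := by
    rw [inv_le_comm₀ (by linarith) (by positivity), mul_inv, inv_inv]
    linarith
  rw [h1]
  refine (norm_add_le _ _).trans ?_
  rw [norm_smul, norm_smul, norm_inv, norm_mul, norm_mul, norm_inv, norm_inv]
  simp only [Real.norm_eq_abs]
  rw [abs_sub_comm b f]
  calc |f|⁻¹ * ‖P - p‖ + |f|⁻¹ * |b|⁻¹ * |f - b| * ‖p‖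
      ≤ 2 * |b|⁻¹ * ‖P - p‖ + 2 * |b|⁻¹ * |b|⁻¹ * |f - b| * ‖p‖ := by gcongr
    _ = _ := by ring

end SlotDeriv

/-! ### One step of power iteration near a spike -/

section Expansion

variable {k n r : ℕ}

/-- The conditions under which power iteration near the spike `v i` is expanded: the noise acts on
`v i`, and on the directions `v j` and `a`, as on typical vectors. -/
structure NearSpike (β : Fin r → ℝ) (v : Fin r → Vec n) (Z : Tensor k n) (i : Fin r) (a : Vec n)
    (B h L : ℝ) : Prop where
  orth : Orthonormal ℝ v
  three_le : 3 ≤ k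
  one_le_L : 1 ≤ L
  beta_le : ∀ j, |β j| ≤ B
  le_beta : B ≤ L * |β i|
  B_large : 6 * L ^ 3 ≤ B
  one_le_mul : 1 ≤ h * B
  h_le : h ≤ 1
  norm_noise : ‖contract Z (v i)‖ ≤ L
  slot_norm : ∀ x, ‖slotDeriv Z (v i) x‖ ≤ L * ‖x‖
  slot_err : ∀ x, ‖x‖ ≤ 1 →
    ‖contract Z (v i + x) - contract Z (v i) - slotDeriv Z (v i) x‖ ≤ L * ‖x‖ ^ 2
  a_le : ‖a‖ ≤ 1
  noise_a : |inner ℝ a (contract Z (v i))| ≤ h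
  noise_v : ∀ j, |inner ℝ (v j) (contract Z (v i))| ≤ h
  noise_sq : |‖contract Z (v i)‖ ^ 2 - 1| ≤ h
  slot_a : |inner ℝ a (slotDeriv Z (v i) (contract Z (v i)))| ≤ L * h
  slot_self : |inner ℝ (v i) (slotDeriv Z (v i) (contract Z (v i)))| ≤ L * h

namespace NearSpike

variable {β : Fin r → ℝ} {v : Fin r → Vec n} {Z : Tensor k n} {i : Fin r} {a : Vec n} {B h L : ℝ}

/-- Each step enlarges the constant. Passing to the larger `L'` makes the conclusion of one step a
hypothesis of the next. -/
lemma mono (H : NearSpike β v Z i a B h L) {L' : ℝ} (hL : L ≤ L') (hB : 6 * L' ^ 3 ≤ B)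
    (hh : 0 ≤ h) : NearSpike β v Z i a B h L' :=
  { H with
    one_le_L := H.one_le_L.trans hL
    le_beta := H.le_beta.trans (mul_le_mul_of_nonneg_right hL (abs_nonneg _))
    B_large := hB
    norm_noise := H.norm_noise.trans hL
    slot_norm := fun x => (H.slot_norm x).trans (mul_le_mul_of_nonneg_right hL (norm_nonneg _))
    slot_err := fun x hx => (H.slot_err x hx).trans
      (mul_le_mul_of_nonneg_right hL (by positivity))
    slot_a := H.slot_a.trans (mul_le_mul_of_nonneg_right hL hh)
    slot_self := H.slot_self.trans (mul_le_mul_of_nonneg_right hL hh) }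

lemma six_le_B (H : NearSpike β v Z i a B h L) : 6 ≤ B := by
  have h1 : (1 : ℝ) ≤ L ^ 3 := one_le_pow₀ H.one_le_L
  linarith [H.B_large]

lemma h_pos (H : NearSpike β v Z i a B h L) : 0 < h := by
  have := H.six_le_B
  have := H.one_le_mul
  by_contra hcon
  nlinarith

lemma inv_B_le (H : NearSpike β v Z i a B h L) : B⁻¹ ≤ h := by
  have := H.six_le_B
  rw [inv_le_iff_one_le_mul₀ (by linarith)]
  exact H.one_le_mul

lemma L_div_B_le (H : NearSpike β v Z i a B h L) : L * B⁻¹ ≤ 1 / 6 := by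
  have h1 := H.six_le_B
  have h2 := H.one_le_L
  have h3 := H.B_large
  rw [← div_eq_mul_inv, div_le_iff₀ (by linarith)]
  nlinarith [mul_self_nonneg (L - 1), mul_self_nonneg L]

lemma beta_ne (H : NearSpike β v Z i a B h L) : β i ≠ 0 := by
  intro h0
  have h1 := H.le_beta
  rw [h0, abs_zero, mul_zero] at h1
  linarith [H.six_le_B]

lemma inv_beta_le (H : NearSpike β v Z i a B h L) : |β i|⁻¹ ≤ L * B⁻¹ := by
  have h1 := H.six_le_B
  have h2 := abs_pos.2 H.beta_ne
  rw [← div_eq_mul_inv, inv_eq_one_div, div_le_div_iff₀ h2 (by linarith)]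
  linarith [H.le_beta]

lemma norm_noise_sub_le (H : NearSpike β v Z i a B h L) {x : Vec n} (hx : ‖x‖ ≤ 1) :
    ‖contract Z (v i + x) - contract Z (v i)‖ ≤ 2 * L * ‖x‖ := by
  have h1 := H.slot_err x hx
  have h2 := H.slot_norm x
  have h3 : contract Z (v i + x) - contract Z (v i)
      = (contract Z (v i + x) - contract Z (v i) - slotDeriv Z (v i) x) + slotDeriv Z (v i) x := by
    abel
  rw [h3]
  refine (norm_add_le _ _).trans ?_
  have h4 := H.one_le_L
  have h5 := norm_nonneg x
  have h6 : L * ‖x‖ ^ 2 ≤ L * ‖x‖ := by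
    refine mul_le_mul_of_nonneg_left ?_ (by linarith)
    nlinarith
  linarith

/-- Since `⟨v i + x, v i⟩` is exactly `1`, the signal contributes exactly `β i` to this coordinate.
-/
lemma inner_contract (H : NearSpike β v Z i a B h L) {x : Vec n} (hx : inner ℝ x (v i) = 0) :
    inner ℝ (contract (spiked k β v Z) (v i + x)) (v i)
      = β i + inner ℝ (v i) (contract Z (v i + x)) := by
  rw [inner_contract_spiked H.orth, inner_add_left, hx, real_inner_self_eq_norm_sq, H.orth.1 i]
  simp

lemma perp_contract (H : NearSpike β v Z i a B h L) {x : Vec n} :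
    perp (v i) (contract (spiked k β v Z) (v i + x))
      = ∑ j ∈ Finset.univ.erase i, (β j * inner ℝ x (v j) ^ (k - 1)) • v j
        + perp (v i) (contract Z (v i + x)) := by
  rw [contract_spiked, perp_add, perp_sum, ← Finset.add_sum_erase _ _ (Finset.mem_univ i),
    perp_smul, perp_self (H.orth.1 i), smul_zero, zero_add]
  congr 1
  refine Finset.sum_congr rfl fun j hj => ?_
  have hji := Finset.ne_of_mem_erase hj
  rw [perp_smul, inner_add_left, H.orth.2 hji.symm, zero_add]
  congr 1
  rw [perp, H.orth.2 hji]
  simp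

/-- The exponent `k - 1 ≥ 2` allows one factor to be bounded by `η`. In the first step `η` is `‖x‖`;
in the second it is of order `h / B`. -/
lemma norm_spikes_le (H : NearSpike β v Z i a B h L) {x : Vec n} (hx : ‖x‖ ≤ 1) {η : ℝ}
    (hη0 : 0 ≤ η) (hη : ∀ j, j ≠ i → |inner ℝ x (v j)| ≤ η) :
    ‖∑ j ∈ Finset.univ.erase i, (β j * inner ℝ x (v j) ^ (k - 1)) • v j‖ ≤ B * η * ‖x‖ := by
  have hB : 0 ≤ B := by linarith [H.six_le_B]
  refine (norm_sum_erase_le H.orth i _ x (A := B * η) (by positivity) fun j hj => ?_).trans ?_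
  · have h1 : |inner ℝ x (v j)| ≤ 1 := by
      refine (abs_real_inner_le_norm _ _).trans ?_
      rw [H.orth.1 j, mul_one]
      exact hx
    rw [abs_mul, abs_pow, mul_assoc]
    refine mul_le_mul (H.beta_le j) ?_ (by positivity) hB
    calc |inner ℝ x (v j)| ^ (k - 1) ≤ |inner ℝ x (v j)| ^ 2 :=
          pow_le_pow_of_le_one (abs_nonneg _) h1 (by have := H.three_le; omega)
      _ = |inner ℝ x (v j)| * |inner ℝ x (v j)| := sq _
      _ ≤ η * |inner ℝ x (v j)| := by
          gcongr
          exact hη j hj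
  · have := norm_perp_le (H.orth.1 i) x
    gcongr

/-- The limiting direction of the tangent vectors. -/
lemma norm_tanVec_sub_le (H : NearSpike β v Z i a B h L) {x : Vec n}
    (hx0 : inner ℝ x (v i) = 0) (hx : ‖x‖ ≤ L * B⁻¹) :
    ‖tanVec (v i) (contract (spiked k β v Z) (v i + x))
      - (β i)⁻¹ • perp (v i) (contract Z (v i))‖ ≤ 12 * L ^ 5 * B⁻¹ ^ 2 := by
  have hL := H.one_le_L
  have hB := H.six_le_B
  have hBi : 0 < B⁻¹ := inv_pos.2 (by linarith)
  have hLB := H.L_div_B_le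
  have hx1 : ‖x‖ ≤ 1 := by linarith
  have hβ := H.inv_beta_le
  set ξ := contract Z (v i)
  set X := spiked k β v Z
  -- The other spikes contribute `B ‖x‖²` and the change of the noise `‖x‖`, both of order `1 / B`.
  have h1 : ‖perp (v i) (contract X (v i + x)) - perp (v i) ξ‖ ≤ 3 * L ^ 2 * B⁻¹ := by
    rw [H.perp_contract, add_sub_assoc, ← perp_sub]
    refine (norm_add_le _ _).trans ?_
    have h2 := H.norm_spikes_le hx1 (norm_nonneg x) fun j _ => by
      refine (abs_real_inner_le_norm _ _).trans ?_
      rw [H.orth.1 j, mul_one]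
    have h3 := (norm_perp_le (H.orth.1 i) _).trans (H.norm_noise_sub_le hx1)
    have h4 : B * ‖x‖ * ‖x‖ ≤ B * (L * B⁻¹) * (L * B⁻¹) := by gcongr
    have h5 : B * (L * B⁻¹) * (L * B⁻¹) = L ^ 2 * B⁻¹ := by field_simp
    have h6 : 2 * L * ‖x‖ ≤ 2 * L * (L * B⁻¹) := by gcongr
    have h7 : 2 * L * (L * B⁻¹) = 2 * L ^ 2 * B⁻¹ := by ring
    linarith
  have h2 : |inner ℝ (contract X (v i + x)) (v i) - β i| ≤ 3 * L ^ 2 := by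
    rw [H.inner_contract hx0, add_sub_cancel_left]
    refine (abs_real_inner_le_norm _ _).trans ?_
    rw [H.orth.1 i, one_mul]
    have h3 : contract Z (v i + x) = ξ + (contract Z (v i + x) - ξ) := by abel
    rw [h3]
    refine (norm_add_le _ _).trans ?_
    have h4 := H.norm_noise_sub_le hx1
    have h5 := H.norm_noise
    have h6 : 2 * L * ‖x‖ ≤ 2 * L * 1 := by gcongr
    nlinarith
  have h3 : |inner ℝ (contract X (v i + x)) (v i) - β i| ≤ |β i| / 2 := by
    refine h2.trans ?_
    have h4 := H.le_beta
    have h5 := H.B_large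
    have h6 : 6 * L ^ 2 ≤ |β i| := by
      have h7 : L * (6 * L ^ 2) ≤ L * |β i| := by
        calc L * (6 * L ^ 2) = 6 * L ^ 3 := by ring
          _ ≤ L * |β i| := h5.trans h4
      exact le_of_mul_le_mul_left h7 (by linarith)
    linarith
  refine (norm_div_sub_div_le H.beta_ne h3).trans ?_
  have h4 : ‖perp (v i) ξ‖ ≤ L := (norm_perp_le (H.orth.1 i) _).trans H.norm_noise
  calc 2 * |β i|⁻¹ * ‖perp (v i) (contract X (v i + x)) - perp (v i) ξ‖
        + 2 * |β i|⁻¹ ^ 2 * |inner ℝ (contract X (v i + x)) (v i) - β i| * ‖perp (v i) ξ‖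
      ≤ 2 * (L * B⁻¹) * (3 * L ^ 2 * B⁻¹) + 2 * (L * B⁻¹) ^ 2 * (3 * L ^ 2) * L := by gcongr
    _ = (6 * L ^ 3 + 6 * L ^ 5) * B⁻¹ ^ 2 := by ring
    _ ≤ (6 * L ^ 5 + 6 * L ^ 5) * B⁻¹ ^ 2 := by
        have : L ^ 3 ≤ L ^ 5 := pow_le_pow_right₀ hL (by norm_num)
        gcongr
    _ = _ := by ring

/-- After one step the tangent vector is nearly parallel to the tangential part of `ξ`, whose
coordinates along the other spikes are at most `h`. This improves the trivial bound `1 / B` to `h /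
B`. -/
lemma abs_inner_tangent_le (H : NearSpike β v Z i a B h L) {x : Vec n}
    (hx : ‖x - (β i)⁻¹ • perp (v i) (contract Z (v i))‖ ≤ L * B⁻¹ ^ 2) {j : Fin r} (hj : j ≠ i) :
    |inner ℝ x (v j)| ≤ 2 * L * h * B⁻¹ := by
  have hL := H.one_le_L
  have hB := H.six_le_B
  have hBi : 0 < B⁻¹ := inv_pos.2 (by linarith)
  set ξ := contract Z (v i)
  have h1 : inner ℝ x (v j) = inner ℝ (x - (β i)⁻¹ • perp (v i) ξ) (v j)
      + (β i)⁻¹ * inner ℝ (v j) ξ := by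
    rw [inner_sub_left, real_inner_smul_left, inner_perp_of_orthogonal (H.orth.2 hj.symm),
      real_inner_comm ξ]
    ring
  have h2 : |inner ℝ (x - (β i)⁻¹ • perp (v i) ξ) (v j)| ≤ L * B⁻¹ ^ 2 := by
    refine (abs_real_inner_le_norm _ _).trans ?_
    rw [H.orth.1 j, mul_one]
    exact hx
  rw [h1]
  refine (abs_add_le _ _).trans ?_
  rw [abs_mul, abs_inv]
  calc |inner ℝ (x - (β i)⁻¹ • perp (v i) ξ) (v j)| + |β i|⁻¹ * |inner ℝ (v j) ξ|
      ≤ L * B⁻¹ ^ 2 + (L * B⁻¹) * h := by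
        have := H.inv_beta_le
        have := H.noise_v j
        gcongr
    _ ≤ L * (h * B⁻¹) + (L * B⁻¹) * h := by
        have := H.inv_B_le
        rw [sq]
        gcongr
    _ = _ := by ring

/-- Split the increment into the second-order remainder, the derivative at the deviation of `x` from
`ξ^⊥ / β_i`, and the derivative at `ξ^⊥ / β_i`. The first two are `O(B⁻²)`, hence `O(h / B)`; the
third is small through `hyD` and `⟨ξ, v i⟩ = O(h)`. -/
lemma abs_inner_noise_sub_le (H : NearSpike β v Z i a B h L) {x : Vec n} (hx' : ‖x‖ ≤ L * B⁻¹)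
    (hx : ‖x - (β i)⁻¹ • perp (v i) (contract Z (v i))‖ ≤ L * B⁻¹ ^ 2) {y : Vec n} (hy : ‖y‖ ≤ 1)
    (hyD : |inner ℝ y (slotDeriv Z (v i) (contract Z (v i)))| ≤ L * h) :
    |inner ℝ y (contract Z (v i + x) - contract Z (v i))| ≤ 4 * L ^ 3 * h * B⁻¹ := by
  have hL := H.one_le_L
  have hB := H.six_le_B
  have hBi : 0 < B⁻¹ := inv_pos.2 (by linarith)
  have hh := H.h_pos
  have hx1 : ‖x‖ ≤ 1 := by linarith [H.L_div_B_le]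
  set ξ := contract Z (v i) with hξ
  set e := x - (β i)⁻¹ • perp (v i) ξ with he
  set D := slotDeriv Z (v i) with hD
  have h1 : contract Z (v i + x) - ξ = (contract Z (v i + x) - ξ - D x) + D e
      + (β i)⁻¹ • (D ξ - inner ℝ ξ (v i) • D (v i)) := by
    rw [he, hD, slotDeriv_sub, slotDeriv_smul, perp, slotDeriv_sub, slotDeriv_smul]
    abel
  have hin : ∀ z : Vec n, |inner ℝ y z| ≤ ‖z‖ := fun z =>
    (abs_real_inner_le_norm y z).trans (mul_le_of_le_one_left (norm_nonneg _) hy)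
  have h2 : |inner ℝ y (contract Z (v i + x) - ξ - D x)| ≤ L ^ 3 * (h * B⁻¹) := by
    refine (hin _).trans ((H.slot_err x hx1).trans ?_)
    calc L * ‖x‖ ^ 2 ≤ L * (L * B⁻¹) ^ 2 := by gcongr
      _ = L ^ 3 * (B⁻¹ * B⁻¹) := by ring
      _ ≤ L ^ 3 * (h * B⁻¹) := by
          have := H.inv_B_le
          gcongr
  have h3 : |inner ℝ y (D e)| ≤ L ^ 2 * (h * B⁻¹) := by
    refine (hin _).trans ((H.slot_norm e).trans ?_)
    calc L * ‖e‖ ≤ L * (L * B⁻¹ ^ 2) := by gcongr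
      _ = L ^ 2 * (B⁻¹ * B⁻¹) := by ring
      _ ≤ L ^ 2 * (h * B⁻¹) := by
          have := H.inv_B_le
          gcongr
  have h4 : |inner ℝ y ((β i)⁻¹ • (D ξ - inner ℝ ξ (v i) • D (v i)))| ≤ (L * B⁻¹) * (2 * L * h) := by
    rw [real_inner_smul_right, abs_mul, abs_inv, inner_sub_right, real_inner_smul_right]
    refine mul_le_mul H.inv_beta_le ?_ (abs_nonneg _) (by positivity)
    have h5 : |inner ℝ ξ (v i) * inner ℝ y (D (v i))| ≤ h * L := by
      rw [abs_mul]
      refine mul_le_mul ?_ ?_ (abs_nonneg _) hh.le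
      · rw [real_inner_comm]
        exact H.noise_v i
      · refine (hin _).trans ((H.slot_norm (v i)).trans ?_)
        rw [H.orth.1 i, mul_one]
    refine (abs_sub _ _).trans ?_
    linarith
  rw [h1, inner_add_right, inner_add_right]
  refine (abs_add_three _ _ _).trans ?_
  have h6 : L ^ 2 ≤ L ^ 3 := pow_le_pow_right₀ hL (by norm_num)
  have h7 : 0 ≤ h * B⁻¹ := by positivity
  have h8 := mul_le_mul_of_nonneg_right h6 h7
  nlinarith

/-- Expansion of one step of power iteration in the direction `a`. -/
lemma abs_inner_tanVec_sub_le (H : NearSpike β v Z i a B h L) {x : Vec n}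
    (hx0 : inner ℝ x (v i) = 0) (hx' : ‖x‖ ≤ L * B⁻¹)
    (hx : ‖x - (β i)⁻¹ • perp (v i) (contract Z (v i))‖ ≤ L * B⁻¹ ^ 2) :
    |inner ℝ a (tanVec (v i) (contract (spiked k β v Z) (v i + x)))
      - (β i)⁻¹ * inner ℝ a (perp (v i) (contract Z (v i)))| ≤ 40 * L ^ 5 * h * B⁻¹ ^ 2 := by
  have hL := H.one_le_L
  have hB := H.six_le_B
  have hBi : 0 < B⁻¹ := inv_pos.2 (by linarith)
  have hh := H.h_pos
  have hx1 : ‖x‖ ≤ 1 := by linarith [H.L_div_B_le]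
  set ξ := contract Z (v i) with hξ
  set X := spiked k β v Z with hX
  have hw1 : ‖v i‖ ≤ 1 := (H.orth.1 i).le
  have hperp : ∀ z, inner ℝ a (perp (v i) z) = inner ℝ a z - inner ℝ a (v i) * inner ℝ (v i) z := by
    intro z
    rw [perp, inner_sub_right, real_inner_smul_right, real_inner_comm z (v i)]
    ring
  have haw : |inner ℝ a (v i)| ≤ 1 := by
    refine (abs_real_inner_le_norm _ _).trans ?_
    rw [H.orth.1 i, mul_one]
    exact H.a_le
  have hwa := H.abs_inner_noise_sub_le hx' hx H.a_le H.slot_a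
  have hww := H.abs_inner_noise_sub_le hx' hx hw1 H.slot_self
  have h1 : |inner ℝ (contract X (v i + x)) (v i) - β i| ≤ 5 * L ^ 3 * h := by
    rw [H.inner_contract hx0, add_sub_cancel_left]
    have h3 : contract Z (v i + x) = ξ + (contract Z (v i + x) - ξ) := by abel
    rw [h3, inner_add_right]
    refine (abs_add_le _ _).trans ?_
    have h4 : 4 * L ^ 3 * h * B⁻¹ ≤ 4 * L ^ 3 * h * 1 := by
      have : B⁻¹ ≤ 1 := inv_le_one_of_one_le₀ (by linarith)
      gcongr
    have h5 : h ≤ L ^ 3 * h := le_mul_of_one_le_left hh.le (one_le_pow₀ hL)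
    have := H.noise_v i
    linarith
  -- `h1` is too costly in `L` to be compared with `|β i|`; the crude norm bound `3 L` against `6 L
  -- ≤ |β i|` does it.
  have h2 : |inner ℝ (contract X (v i + x)) (v i) - β i| ≤ |β i| / 2 := by
    have h2' : |inner ℝ (contract X (v i + x)) (v i) - β i| ≤ 3 * L := by
      rw [H.inner_contract hx0, add_sub_cancel_left]
      refine (abs_real_inner_le_norm _ _).trans ?_
      rw [H.orth.1 i, one_mul]
      have h3 : contract Z (v i + x) = ξ + (contract Z (v i + x) - ξ) := by abel
      rw [h3]
      refine (norm_add_le _ _).trans ?_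
      have h4 := H.norm_noise_sub_le hx1
      have h5 := H.norm_noise
      have h6 : 2 * L * ‖x‖ ≤ 2 * L * 1 := by gcongr
      linarith
    refine h2'.trans ?_
    have h4 := H.le_beta
    have h5 := H.B_large
    have h7 : L * (6 * L) ≤ L * |β i| := by
      calc L * (6 * L) = 6 * L ^ 2 := by ring
        _ ≤ 6 * L ^ 3 := by
          have : L ^ 2 ≤ L ^ 3 := pow_le_pow_right₀ hL (by norm_num)
          linarith
        _ ≤ L * |β i| := h5.trans h4
    have := le_of_mul_le_mul_left h7 (by linarith)
    linarith
  have h3 : |inner ℝ a (perp (v i) ξ)| ≤ 2 * h := by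
    rw [hperp]
    refine (abs_sub _ _).trans ?_
    rw [abs_mul]
    have h4 : |inner ℝ a (v i)| * |inner ℝ (v i) ξ| ≤ 1 * h :=
      mul_le_mul haw (H.noise_v i) (abs_nonneg _) zero_le_one
    linarith [H.noise_a]
  have h4 : |inner ℝ a (perp (v i) (contract X (v i + x))) - inner ℝ a (perp (v i) ξ)|
      ≤ 10 * L ^ 3 * h * B⁻¹ := by
    rw [← inner_sub_right, H.perp_contract, add_sub_assoc, ← perp_sub, inner_add_right, hperp]
    -- The improved bound on the other coordinates makes the spikes contribute `h / B` instead of `1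
    -- / B`.
    have h5 := H.norm_spikes_le hx1 (η := 2 * L * h * B⁻¹) (by positivity)
      fun j hj => H.abs_inner_tangent_le hx hj
    have h6 := (abs_real_inner_le_norm a (∑ j ∈ Finset.univ.erase i,
      (β j * inner ℝ x (v j) ^ (k - 1)) • v j)).trans
      (mul_le_mul H.a_le h5 (norm_nonneg _) zero_le_one)
    have h7 : 1 * (B * (2 * L * h * B⁻¹) * ‖x‖) ≤ 2 * L ^ 3 * h * B⁻¹ := by
      calc 1 * (B * (2 * L * h * B⁻¹) * ‖x‖) ≤ 1 * (B * (2 * L * h * B⁻¹) * (L * B⁻¹)) := by gcongr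
        _ = 2 * L ^ 2 * h * B⁻¹ := by field_simp
        _ ≤ 2 * L ^ 3 * h * B⁻¹ := by
          have : L ^ 2 ≤ L ^ 3 := pow_le_pow_right₀ hL (by norm_num)
          gcongr
    have h8 : |inner ℝ a (v i) * inner ℝ (v i) (contract Z (v i + x) - ξ)|
        ≤ 1 * (4 * L ^ 3 * h * B⁻¹) := by
      rw [abs_mul]
      exact mul_le_mul haw hww (abs_nonneg _) zero_le_one
    refine (abs_add_le _ _).trans ?_
    have h9 := abs_sub (inner ℝ a (contract Z (v i + x) - ξ) : ℝ)
      (inner ℝ a (v i) * inner ℝ (v i) (contract Z (v i + x) - ξ))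
    linarith
  have h5 := norm_div_sub_div_le (P := (inner ℝ a (perp (v i) (contract X (v i + x))) : ℝ))
    (p := (inner ℝ a (perp (v i) ξ) : ℝ)) H.beta_ne h2
  rw [tanVec, real_inner_smul_right]
  simp only [smul_eq_mul, Real.norm_eq_abs] at h5
  refine h5.trans ?_
  have hβ := H.inv_beta_le
  have hh1 := H.h_le
  calc _ ≤ 2 * (L * B⁻¹) * (10 * L ^ 3 * h * B⁻¹)
        + 2 * (L * B⁻¹) ^ 2 * (5 * L ^ 3 * h) * (2 * h) := by gcongr
    _ = (20 * L ^ 4 * h + 20 * L ^ 5 * (h * h)) * B⁻¹ ^ 2 := by ring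
    _ ≤ (20 * L ^ 5 * h + 20 * L ^ 5 * (h * 1)) * B⁻¹ ^ 2 := by
        have : L ^ 4 ≤ L ^ 5 := pow_le_pow_right₀ hL (by norm_num)
        gcongr
    _ = _ := by ring

end NearSpike

end Expansion

/-! ### Powers of a cosine `c` in terms of the squared tangent `S` -/

section ScalarExpansion

variable {c S : ℝ}

lemma cos_le_one (hc : 0 < c) (hS : 0 ≤ S) (h : c ^ 2 * (1 + S) = 1) : c ≤ 1 := by
  have : c ^ 2 ≤ 1 := by nlinarith [sq_nonneg c]
  nlinarith

lemma one_sub_cos_le (hc : 0 < c) (hS : 0 ≤ S) (h : c ^ 2 * (1 + S) = 1) : 1 - c ≤ S / 2 := by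
  have h1 := cos_le_one hc hS h
  by_contra hcon
  have h2 : c < 1 - S / 2 := by linarith
  have h3 : c ^ 2 < (1 - S / 2) * c := by nlinarith
  have h4 : 1 < (1 - S / 2) * c * (1 + S) := by nlinarith
  have h5 : (1 - S / 2) * (1 - S / 2) * (1 + S) ≤ 1 := by
    have : S < 2 := by linarith
    nlinarith [mul_nonneg hS hS, mul_nonneg (mul_nonneg hS hS) (by linarith : (0 : ℝ) ≤ 3 - S)]
  have h6 : (1 - S / 2) * c * (1 + S) ≤ (1 - S / 2) * (1 - S / 2) * (1 + S) := by
    have : 0 ≤ 1 - S / 2 := by linarith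
    gcongr
  linarith

lemma abs_cos_sub_le (hc : 0 < c) (hS : 0 ≤ S) (h : c ^ 2 * (1 + S) = 1) :
    |c - (1 - S / 2)| ≤ S ^ 2 := by
  have h1 := cos_le_one hc hS h
  have h2 := one_sub_cos_le hc hS h
  have h3 : (1 - c) * (1 + c) = S * c ^ 2 := by nlinarith
  rw [abs_of_nonneg (by linarith)]
  nlinarith [mul_nonneg hS hS, mul_nonneg hS (by linarith : (0 : ℝ) ≤ 1 - c),
    mul_nonneg hS hc.le]

/-- Bernoulli's inequality on both sides: for `c ^ k` it gives the lower bound, and for `(c⁻¹) ^ k =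
(1 + x) ^ k` with `x = √(1 + S) - 1` the upper one. -/
lemma abs_cos_pow_sub_le (hc : 0 < c) (hS : 0 ≤ S) (h : c ^ 2 * (1 + S) = 1) (k : ℕ) (hk : 1 ≤ k) :
    |c ^ k - (1 - k * S / 2)| ≤ 2 * k ^ 2 * S ^ 2 := by
  have h1 := cos_le_one hc hS h
  have h2 := one_sub_cos_le hc hS h
  have hk1 : (1 : ℝ) ≤ k := by exact_mod_cast hk
  have h3 := one_add_mul_le_pow (a := c - 1) (by linarith) k
  rw [add_sub_cancel] at h3
  have h4 : 1 - k * S / 2 ≤ c ^ k := by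
    have : (k : ℝ) * (1 - c) ≤ k * (S / 2) := by gcongr
    linarith
  rw [abs_of_nonneg (by linarith)]
  set x := c⁻¹ - 1 with hx
  have hx0 : 0 ≤ x := by
    rw [hx, sub_nonneg]
    exact (one_le_inv₀ hc).2 h1
  have hcx : c * (1 + x) = 1 := by
    rw [hx, add_sub_cancel]
    exact mul_inv_cancel₀ hc.ne'
  have hxS : (1 + x) ^ 2 = 1 + S := by
    have h5 : (c * (1 + x)) ^ 2 = c ^ 2 * (1 + S) := by rw [hcx, h, one_pow]
    rw [mul_pow] at h5
    exact mul_left_cancel₀ (pow_ne_zero 2 hc.ne') h5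
  have hx1 : x ≤ S / 2 := by nlinarith [sq_nonneg x]
  have hx2 : S / 2 - S ^ 2 ≤ x := by nlinarith [sq_nonneg x]
  have h5 := one_add_mul_le_pow (a := x) (by linarith) k
  have h6 : c ^ k * (1 + k * x) ≤ 1 := by
    calc c ^ k * (1 + k * x) ≤ c ^ k * (1 + x) ^ k := by gcongr
      _ = 1 := by rw [← mul_pow, hcx, one_pow]
  have hkx : 0 ≤ k * x := by positivity
  have h7 : c ^ k ≤ 1 - k * x + (k * x) ^ 2 := by
    have h8 : 1 ≤ (1 - k * x + (k * x) ^ 2) * (1 + k * x) := by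
      nlinarith [mul_nonneg hkx (mul_nonneg hkx hkx)]
    have h9 : 0 < 1 + k * x := by positivity
    exact le_of_mul_le_mul_right (h6.trans h8) h9
  have h8 : (k * x) ^ 2 ≤ k ^ 2 * S ^ 2 := by
    rw [mul_pow]
    have : x ^ 2 ≤ S ^ 2 := by gcongr; linarith
    gcongr
  have h9 : k * (S / 2 - S ^ 2) ≤ k * x := by gcongr
  have h10 : (k : ℝ) * S ^ 2 ≤ k ^ 2 * S ^ 2 := by
    have : (k : ℝ) ≤ k ^ 2 := by nlinarith
    gcongr
  linarith

end ScalarExpansion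

/-! ### Expansions of the estimators around a spike -/

section Expansion

variable {k n r : ℕ} {β : Fin r → ℝ} {v : Fin r → Vec n} {Z : Tensor k n} {i : Fin r} {a : Vec n}
  {B h L : ℝ}

namespace NearSpike

lemma abs_norm_perp_sq_sub_le (H : NearSpike β v Z i a B h L) :
    |‖perp (v i) (contract Z (v i))‖ ^ 2 - 1| ≤ 2 * h := by
  have h1 := norm_sq_eq_perp (H.orth.1 i) (contract Z (v i))
  have h2 := H.noise_sq
  have h3 := H.noise_v i
  rw [real_inner_comm] at h3
  have h4 : inner ℝ (contract Z (v i)) (v i) ^ 2 ≤ h := by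
    rw [← sq_abs]
    have := H.h_le
    nlinarith [abs_nonneg (inner ℝ (contract Z (v i)) (v i))]
  have h5 := sq_nonneg (inner ℝ (contract Z (v i)) (v i) : ℝ)
  rw [abs_le] at *
  constructor <;> linarith [h2.1, h2.2]

lemma inv_B_sq_le (H : NearSpike β v Z i a B h L) : B⁻¹ ^ 2 ≤ h * B⁻¹ := by
  have hB := H.six_le_B
  have hBi : 0 < B⁻¹ := inv_pos.2 (by linarith)
  rw [sq]
  exact mul_le_mul_of_nonneg_right H.inv_B_le hBi.le

lemma inv_B_le_one (H : NearSpike β v Z i a B h L) : B⁻¹ ≤ 1 :=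
  inv_le_one_of_one_le₀ (by linarith [H.six_le_B])

/-- The tangential part of `ξ` has norm close to one, so the squared tangent is close to `β_i^{-2}`.
This is the source of the deterministic corrections in both expansions. -/
lemma abs_norm_sq_sub_le (H : NearSpike β v Z i a B h L) {x : Vec n} (hx' : ‖x‖ ≤ L * B⁻¹)
    (hx : ‖x - (β i)⁻¹ • perp (v i) (contract Z (v i))‖ ≤ L * B⁻¹ ^ 2) :
    |‖x‖ ^ 2 - (β i)⁻¹ ^ 2| ≤ 4 * L ^ 3 * h * B⁻¹ ^ 2 := by
  have hL := H.one_le_L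
  have hB := H.six_le_B
  have hBi : 0 < B⁻¹ := inv_pos.2 (by linarith)
  have hh := H.h_pos
  have hβ := H.inv_beta_le
  set p := perp (v i) (contract Z (v i)) with hp
  have hpL : ‖p‖ ≤ L := (norm_perp_le (H.orth.1 i) _).trans H.norm_noise
  have hpn : ‖(β i)⁻¹ • p‖ ≤ L * B⁻¹ * L := by
    rw [norm_smul, norm_inv, Real.norm_eq_abs]
    gcongr
  have h1 : |‖x‖ ^ 2 - ‖(β i)⁻¹ • p‖ ^ 2| ≤ 2 * L ^ 3 * h * B⁻¹ ^ 2 := by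
    rw [sq_sub_sq, abs_mul, abs_of_nonneg (by positivity : 0 ≤ ‖x‖ + ‖(β i)⁻¹ • p‖)]
    have h2 := (abs_norm_sub_norm_le x ((β i)⁻¹ • p)).trans hx
    calc (‖x‖ + ‖(β i)⁻¹ • p‖) * |‖x‖ - ‖(β i)⁻¹ • p‖|
        ≤ (L * B⁻¹ + L * B⁻¹ * L) * (L * B⁻¹ ^ 2) := by gcongr
      _ = (L ^ 2 + L ^ 3) * B⁻¹ * B⁻¹ ^ 2 := by ring
      _ ≤ (L ^ 3 + L ^ 3) * h * B⁻¹ ^ 2 := by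
          have : L ^ 2 ≤ L ^ 3 := pow_le_pow_right₀ hL (by norm_num)
          have := H.inv_B_le
          gcongr
      _ = _ := by ring
  have h2 : |‖(β i)⁻¹ • p‖ ^ 2 - (β i)⁻¹ ^ 2| ≤ 2 * L ^ 3 * h * B⁻¹ ^ 2 := by
    have h3 : ‖(β i)⁻¹ • p‖ ^ 2 - (β i)⁻¹ ^ 2 = (β i)⁻¹ ^ 2 * (‖p‖ ^ 2 - 1) := by
      rw [norm_smul, mul_pow, Real.norm_eq_abs, sq_abs]
      ring
    rw [h3, abs_mul, abs_pow, abs_inv]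
    calc |β i|⁻¹ ^ 2 * |‖p‖ ^ 2 - 1| ≤ (L * B⁻¹) ^ 2 * (2 * h) := by
          have := H.abs_norm_perp_sq_sub_le
          gcongr
      _ = 2 * L ^ 2 * h * B⁻¹ ^ 2 := by ring
      _ ≤ 2 * L ^ 3 * h * B⁻¹ ^ 2 := by
          have : L ^ 2 ≤ L ^ 3 := pow_le_pow_right₀ hL (by norm_num)
          gcongr
  have h3 := abs_sub_le (‖x‖ ^ 2) (‖(β i)⁻¹ • p‖ ^ 2) ((β i)⁻¹ ^ 2)
  linarith

lemma norm_pow_four_le (H : NearSpike β v Z i a B h L) {x : Vec n} (hx' : ‖x‖ ≤ L * B⁻¹) :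
    (‖x‖ ^ 2) ^ 2 ≤ L ^ 4 * h * B⁻¹ ^ 2 := by
  have hL := H.one_le_L
  have hB := H.six_le_B
  have hBi : 0 < B⁻¹ := inv_pos.2 (by linarith)
  calc (‖x‖ ^ 2) ^ 2 ≤ ((L * B⁻¹) ^ 2) ^ 2 := by gcongr
    _ = L ^ 4 * (B⁻¹ * B⁻¹) * B⁻¹ ^ 2 := by ring
    _ ≤ L ^ 4 * (h * 1) * B⁻¹ ^ 2 := by
        have := H.inv_B_le
        have := H.inv_B_le_one
        have := H.h_pos
        gcongr
    _ = _ := by ring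

lemma cos_sq_mul (H : NearSpike β v Z i a B h L) {u : Vec n} (hu : ‖u‖ = 1)
    (hc : 0 < inner ℝ u (v i)) :
    (inner ℝ u (v i) : ℝ) ^ 2 * (1 + ‖tanVec (v i) u‖ ^ 2) = 1 := by
  have h1 := norm_sq_eq_perp (H.orth.1 i) u
  rw [hu] at h1
  rw [tanVec, norm_smul, mul_pow, norm_inv, Real.norm_eq_abs, inv_pow, sq_abs, mul_add, mul_one,
    mul_inv_cancel_left₀ (pow_ne_zero 2 hc.ne')]
  linarith

/-- The expansion of `⟨a, u⟩`. -/
lemma abs_inner_sub_le (H : NearSpike β v Z i a B h L) {u : Vec n} (hu : ‖u‖ = 1)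
    (hc : 0 < inner ℝ u (v i)) (hx' : ‖tanVec (v i) u‖ ≤ L * B⁻¹)
    (hx : ‖tanVec (v i) u - (β i)⁻¹ • perp (v i) (contract Z (v i))‖ ≤ L * B⁻¹ ^ 2)
    (ha : |inner ℝ a (tanVec (v i) u) - (β i)⁻¹ * inner ℝ a (perp (v i) (contract Z (v i)))|
      ≤ L * h * B⁻¹ ^ 2) :
    |inner ℝ a u - ((1 - 1 / (2 * β i ^ 2)) * inner ℝ a (v i)
        + (inner ℝ a (contract Z (v i)) - inner ℝ a (v i) * inner ℝ (v i) (contract Z (v i))) / β i)|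
      ≤ 6 * L ^ 4 * h * B⁻¹ ^ 2 := by
  have hL := H.one_le_L
  have hB := H.six_le_B
  have hBi : 0 < B⁻¹ := inv_pos.2 (by linarith)
  have hh := H.h_pos
  have hcos := H.cos_sq_mul hu hc
  have hS := H.abs_norm_sq_sub_le hx' hx
  have hS2 := H.norm_pow_four_le hx'
  have hux := eq_smul_add_tanVec hc.ne'
  set c : ℝ := inner ℝ u (v i) with hcdef
  set x := tanVec (v i) u with hxdef
  set ξ := contract Z (v i) with hξ
  have hc1 := cos_le_one hc (sq_nonneg ‖x‖) hcos
  have h1 := abs_cos_sub_le hc (sq_nonneg ‖x‖) hcos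
  have h2 := one_sub_cos_le hc (sq_nonneg ‖x‖) hcos
  have hA : |inner ℝ a (v i)| ≤ 1 := by
    refine (abs_real_inner_le_norm _ _).trans ?_
    rw [H.orth.1 i, mul_one]
    exact H.a_le
  have hap : inner ℝ a (perp (v i) ξ) = inner ℝ a ξ - inner ℝ a (v i) * inner ℝ (v i) ξ := by
    rw [perp, inner_sub_right, real_inner_smul_right, real_inner_comm ξ (v i)]
    ring
  have hapl : |inner ℝ a (perp (v i) ξ)| ≤ 2 * h := by
    rw [hap]
    refine (abs_sub _ _).trans ?_
    rw [abs_mul]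
    have h4 : |inner ℝ a (v i)| * |inner ℝ (v i) ξ| ≤ 1 * h :=
      mul_le_mul hA (H.noise_v i) (abs_nonneg _) zero_le_one
    linarith [H.noise_a]
  set y0 := (β i)⁻¹ * inner ℝ a (perp (v i) ξ) with hy0
  have hy0l : |y0| ≤ L * B⁻¹ * (2 * h) := by
    rw [hy0, abs_mul, abs_inv]
    have := H.inv_beta_le
    gcongr
  -- With `u = c (v i + x)`: the error of the cosine, the error of the squared tangent, and the
  -- linear term, in which replacing `c` by `1` costs only `1 - c = O(B⁻²)`.
  have e : inner ℝ a u - ((1 - 1 / (2 * β i ^ 2)) * inner ℝ a (v i)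
        + (inner ℝ a ξ - inner ℝ a (v i) * inner ℝ (v i) ξ) / β i)
      = (c - (1 - ‖x‖ ^ 2 / 2)) * inner ℝ a (v i)
        + (-(1 / 2) * (‖x‖ ^ 2 - (β i)⁻¹ ^ 2)) * inner ℝ a (v i)
        + (c * (inner ℝ a x - y0) - (1 - c) * y0) := by
    have h3 : inner ℝ a u = c * (inner ℝ a (v i) + inner ℝ a x) := by
      nth_rw 1 [hux]
      rw [real_inner_smul_right, inner_add_right]
    rw [h3, ← hap, hy0]
    have := H.beta_ne
    field_simp
    ring
  rw [e]
  refine (abs_add_three _ _ _).trans ?_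
  have t1 : |(c - (1 - ‖x‖ ^ 2 / 2)) * inner ℝ a (v i)| ≤ L ^ 4 * h * B⁻¹ ^ 2 * 1 := by
    rw [abs_mul]
    exact mul_le_mul (h1.trans hS2) hA (abs_nonneg _) (by positivity)
  have t2 : |(-(1 / 2) * (‖x‖ ^ 2 - (β i)⁻¹ ^ 2)) * inner ℝ a (v i)|
      ≤ 1 / 2 * (4 * L ^ 3 * h * B⁻¹ ^ 2) * 1 := by
    rw [abs_mul, abs_mul, abs_neg, abs_of_pos (by norm_num : (0 : ℝ) < 1 / 2)]
    gcongr
  have t3 : |c * (inner ℝ a x - y0) - (1 - c) * y0|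
      ≤ 1 * (L * h * B⁻¹ ^ 2) + L ^ 3 * h * B⁻¹ ^ 2 := by
    refine (abs_sub _ _).trans (add_le_add ?_ ?_)
    · rw [abs_mul, abs_of_pos hc]
      gcongr
    · rw [abs_mul, abs_of_nonneg (by linarith)]
      calc (1 - c) * |y0| ≤ (‖x‖ ^ 2 / 2) * (L * B⁻¹ * (2 * h)) := by gcongr
        _ ≤ ((L * B⁻¹) ^ 2 / 2) * (L * B⁻¹ * (2 * h)) := by gcongr
        _ = L ^ 3 * h * B⁻¹ ^ 2 * B⁻¹ := by ring
        _ ≤ L ^ 3 * h * B⁻¹ ^ 2 * 1 := by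
            have := H.inv_B_le_one
            gcongr
        _ = _ := by ring
  have hq : 0 ≤ h * B⁻¹ ^ 2 := by positivity
  have l1 : L * (h * B⁻¹ ^ 2) ≤ L ^ 4 * (h * B⁻¹ ^ 2) :=
    mul_le_mul_of_nonneg_right (le_self_pow₀ hL (by norm_num)) hq
  have l3 : L ^ 3 * (h * B⁻¹ ^ 2) ≤ L ^ 4 * (h * B⁻¹ ^ 2) :=
    mul_le_mul_of_nonneg_right (pow_le_pow_right₀ hL (by norm_num)) hq
  nlinarith

/-- The value of the tensor at a tangent perturbation of the spike. -/
lemma abs_inner_add_contract_sub_le (H : NearSpike β v Z i a B h L) {x : Vec n}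
    (hx0 : inner ℝ x (v i) = 0) (hx' : ‖x‖ ≤ L * B⁻¹)
    (hx : ‖x - (β i)⁻¹ • perp (v i) (contract Z (v i))‖ ≤ L * B⁻¹ ^ 2) :
    |inner ℝ (v i + x) (contract (spiked k β v Z) (v i + x))
        - (β i + inner ℝ (contract Z (v i)) (v i) + (β i)⁻¹)|
      ≤ (4 * r + 9) * L ^ 3 * (h * B⁻¹) := by
  have hL := H.one_le_L
  have hB := H.six_le_B
  have hB0 : 0 < B := by linarith
  have hBi : 0 < B⁻¹ := inv_pos.2 hB0
  have hh := H.h_pos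
  have hk3 := H.three_le
  have hk1 : 1 ≤ k := by omega
  set ξ := contract Z (v i) with hξ
  set X := spiked k β v Z with hX
  set b := β i with hb
  set ω : ℝ := inner ℝ ξ (v i) with hω
  have hx1 : ‖x‖ ≤ 1 := by linarith [H.L_div_B_le]
  have hβ := H.inv_beta_le
  have hBh : B⁻¹ ^ 2 ≤ h * B⁻¹ := H.inv_B_sq_le
  have hB1 := H.inv_B_le_one
  have hspikes : |∑ j ∈ Finset.univ.erase i, β j * inner ℝ (v i + x) (v j) ^ k|
      ≤ 4 * r * L ^ 2 * h * B⁻¹ := by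
    refine (Finset.abs_sum_le_sum_abs _ _).trans ?_
    calc _ ≤ ∑ _j ∈ Finset.univ.erase i, B * (2 * L * h * B⁻¹) ^ 2 := by
          refine Finset.sum_le_sum fun j hj => ?_
          have hji := Finset.ne_of_mem_erase hj
          rw [inner_add_left, H.orth.2 hji.symm, zero_add, abs_mul, abs_pow]
          have h3 : |inner ℝ x (v j)| ≤ 1 := by
            refine (abs_real_inner_le_norm _ _).trans ?_
            rw [H.orth.1 j, mul_one]
            exact hx1
          refine mul_le_mul (H.beta_le j) ?_ (by positivity) hB0.le
          refine (pow_le_pow_of_le_one (abs_nonneg _) h3 (by omega : 2 ≤ k)).trans ?_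
          have := H.abs_inner_tangent_le hx hji
          gcongr
      _ ≤ ∑ _j : Fin r, B * (2 * L * h * B⁻¹) ^ 2 :=
          Finset.sum_le_sum_of_subset_of_nonneg (Finset.erase_subset _ _)
            fun _ _ _ => by positivity
      _ = 4 * r * L ^ 2 * (h * h) * B⁻¹ := by
          simp only [Finset.sum_const, Finset.card_univ, Fintype.card_fin, nsmul_eq_mul]
          field_simp
          ring
      _ ≤ 4 * r * L ^ 2 * (h * 1) * B⁻¹ := by
          have := H.h_le
          gcongr
      _ = _ := by ring
  -- The tangent vector is correlated with the noise that produced it: `x` is close to `b⁻¹ ξ^⊥` and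
  -- `‖ξ^⊥‖²` to `1`.
  have hxξ : |inner ℝ x ξ - b⁻¹| ≤ 3 * L ^ 2 * (h * B⁻¹) := by
    have hpp : inner ℝ (perp (v i) ξ) ξ = ‖perp (v i) ξ‖ ^ 2 := by
      have : ξ = perp (v i) ξ + ω • v i := by
        rw [perp]
        abel
      nth_rw 2 [this]
      rw [inner_add_right, real_inner_smul_right, inner_perp_self (H.orth.1 i),
        real_inner_self_eq_norm_sq]
      ring
    have e1 : inner ℝ x ξ - b⁻¹ = inner ℝ (x - b⁻¹ • perp (v i) ξ) ξ
        + b⁻¹ * (‖perp (v i) ξ‖ ^ 2 - 1) := by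
      rw [inner_sub_left, real_inner_smul_left, hpp]
      ring
    rw [e1]
    refine (abs_add_le _ _).trans ?_
    have h3 : |inner ℝ (x - b⁻¹ • perp (v i) ξ) ξ| ≤ L * B⁻¹ ^ 2 * L :=
      (abs_real_inner_le_norm _ _).trans
        (mul_le_mul hx H.norm_noise (norm_nonneg _) (by positivity))
    have h4 : |b⁻¹ * (‖perp (v i) ξ‖ ^ 2 - 1)| ≤ L * B⁻¹ * (2 * h) := by
      rw [abs_mul, abs_inv]
      exact mul_le_mul hβ H.abs_norm_perp_sq_sub_le (abs_nonneg _) (by positivity)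
    have h5 : L * B⁻¹ ^ 2 * L ≤ L ^ 2 * (h * B⁻¹) := by
      calc L * B⁻¹ ^ 2 * L = L ^ 2 * B⁻¹ ^ 2 := by ring
        _ ≤ _ := by gcongr
    have h6 : L * (h * B⁻¹) ≤ L ^ 2 * (h * B⁻¹) := by
      have : L ≤ L ^ 2 := by nlinarith
      gcongr
    linarith
  have hww := H.abs_inner_noise_sub_le hx' hx (H.orth.1 i).le H.slot_self
  have hxZ : |inner ℝ x (contract Z (v i + x) - ξ)| ≤ 2 * L ^ 3 * (h * B⁻¹) := by
    refine (abs_real_inner_le_norm _ _).trans ?_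
    calc ‖x‖ * ‖contract Z (v i + x) - ξ‖ ≤ (L * B⁻¹) * (2 * L * (L * B⁻¹)) := by
          have := H.norm_noise_sub_le hx1
          have : 2 * L * ‖x‖ ≤ 2 * L * (L * B⁻¹) := by gcongr
          refine mul_le_mul hx' (by linarith) (norm_nonneg _) (by positivity)
      _ = 2 * L ^ 3 * B⁻¹ ^ 2 := by ring
      _ ≤ _ := by gcongr
  have e1 : inner ℝ (v i + x) (contract X (v i + x)) - (b + ω + b⁻¹)
      = ∑ j ∈ Finset.univ.erase i, β j * inner ℝ (v i + x) (v j) ^ k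
        + inner ℝ (v i) (contract Z (v i + x) - ξ)
        + ((inner ℝ x ξ - b⁻¹) + inner ℝ x (contract Z (v i + x) - ξ)) := by
    rw [powerVal_eq hk1, ← Finset.add_sum_erase _ _ (Finset.mem_univ i), inner_add_left (v i) x (v i),
      inner_add_left (v i) x (contract Z (v i + x)), hx0, real_inner_self_eq_norm_sq, H.orth.1 i, inner_sub_right,
      inner_sub_right, hω, real_inner_comm ξ (v i)]
    ring
  rw [e1]
  refine (abs_add_three _ _ _).trans ?_
  have h3 := abs_add_le (inner ℝ x ξ - b⁻¹) (inner ℝ x (contract Z (v i + x) - ξ))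
  have hq : 0 ≤ h * B⁻¹ := by positivity
  have l2 : L ^ 2 * (h * B⁻¹) ≤ L ^ 3 * (h * B⁻¹) :=
    mul_le_mul_of_nonneg_right (pow_le_pow_right₀ hL (by norm_num)) hq
  have l3 : (r : ℝ) * (L ^ 2 * (h * B⁻¹)) ≤ r * (L ^ 3 * (h * B⁻¹)) := by gcongr
  linarith

/-- The expansion of `X[u^{⊗k}]`. -/
lemma abs_val_sub_le (H : NearSpike β v Z i a B h L) {u : Vec n} (hu : ‖u‖ = 1)
    (hc : 0 < inner ℝ u (v i)) (hx' : ‖tanVec (v i) u‖ ≤ L * B⁻¹)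
    (hx : ‖tanVec (v i) u - (β i)⁻¹ • perp (v i) (contract Z (v i))‖ ≤ L * B⁻¹ ^ 2) :
    |inner ℝ u (contract (spiked k β v Z) u)
        - (β i + inner ℝ (contract Z (v i)) (v i) - ((k : ℝ) / 2 - 1) / β i)|
      ≤ (12 * k ^ 2 + 2 * k + 4 * r + 9) * L ^ 4 * h * B⁻¹ := by
  have hL := H.one_le_L
  have hB := H.six_le_B
  have hB0 : 0 < B := by linarith
  have hBi : 0 < B⁻¹ := inv_pos.2 hB0
  have hh := H.h_pos
  have hk3 := H.three_le
  have hk1 : 1 ≤ k := by omega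
  have hcos := H.cos_sq_mul hu hc
  have hS := H.abs_norm_sq_sub_le hx' hx
  have hS2 := H.norm_pow_four_le hx'
  have hx0 := inner_tanVec_self (H.orth.1 i) u
  have hux := eq_smul_add_tanVec hc.ne'
  set c : ℝ := inner ℝ u (v i) with hcdef
  set x := tanVec (v i) u with hxdef
  set ξ := contract Z (v i) with hξ
  set X := spiked k β v Z with hX
  set b := β i with hb
  have hb0 : b ≠ 0 := H.beta_ne
  set ω : ℝ := inner ℝ ξ (v i) with hω
  have hωh : |ω| ≤ h := by
    rw [hω, real_inner_comm]
    exact H.noise_v i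
  have hx1 : ‖x‖ ≤ 1 := by linarith [H.L_div_B_le]
  have hc1 := cos_le_one hc (sq_nonneg ‖x‖) hcos
  have h1 := abs_cos_pow_sub_le hc (sq_nonneg ‖x‖) hcos k hk1
  have hβ := H.inv_beta_le
  have hBh : B⁻¹ ^ 2 ≤ h * B⁻¹ := H.inv_B_sq_le
  have hB1 := H.inv_B_le_one
  set N := inner ℝ (v i + x) (contract X (v i + x)) with hN
  have hval : inner ℝ u (contract X u) = c ^ k * N := by
    nth_rw 1 2 [hux]
    rw [contract_smul, real_inner_smul_left, real_inner_smul_right, ← mul_assoc, ← pow_succ',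
      Nat.sub_add_cancel hk1]
  have hck : |c ^ k - (1 - k / (2 * b ^ 2))| ≤ 4 * k ^ 2 * L ^ 4 * h * B⁻¹ ^ 2 := by
    have e1 : c ^ k - (1 - k / (2 * b ^ 2))
        = (c ^ k - (1 - k * ‖x‖ ^ 2 / 2)) - k / 2 * (‖x‖ ^ 2 - b⁻¹ ^ 2) := by
      field_simp
      ring
    rw [e1]
    refine (abs_sub _ _).trans ?_
    rw [abs_mul, abs_of_nonneg (by positivity : (0 : ℝ) ≤ (k : ℝ) / 2)]
    have hkR : (1 : ℝ) ≤ k := by exact_mod_cast hk1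
    calc |c ^ k - (1 - k * ‖x‖ ^ 2 / 2)| + k / 2 * |‖x‖ ^ 2 - b⁻¹ ^ 2|
        ≤ 2 * k ^ 2 * (L ^ 4 * h * B⁻¹ ^ 2) + k / 2 * (4 * L ^ 3 * h * B⁻¹ ^ 2) := by
          refine add_le_add (h1.trans ?_) ?_ <;> gcongr
      _ = (2 * k ^ 2 * L ^ 4 + 2 * k * L ^ 3) * (h * B⁻¹ ^ 2) := by ring
      _ ≤ (2 * k ^ 2 * L ^ 4 + 2 * k ^ 2 * L ^ 4) * (h * B⁻¹ ^ 2) := by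
          have : L ^ 3 ≤ L ^ 4 := pow_le_pow_right₀ hL (by norm_num)
          have : (k : ℝ) ≤ k ^ 2 := by nlinarith
          gcongr
      _ = _ := by ring
  have hNN := H.abs_inner_add_contract_sub_le hx0 hx' hx
  have hN' : |b + ω + b⁻¹| ≤ 3 * B := by
    refine (abs_add_three _ _ _).trans ?_
    rw [abs_inv]
    have := H.beta_le i
    have := H.h_le
    have := H.L_div_B_le
    linarith
  -- The product of `1 - k / (2 b²)` and `b + ω + b⁻¹` has the `b⁻¹`-coefficient `1 - k / 2`; its
  -- terms of higher order form the last summand.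
  have e2 : inner ℝ u (contract X u) - (b + ω - ((k : ℝ) / 2 - 1) / b)
      = (c ^ k - (1 - k / (2 * b ^ 2))) * (b + ω + b⁻¹) + c ^ k * (N - (b + ω + b⁻¹))
        + (-(k / 2 * b⁻¹ ^ 2 * ω) - k / 2 * b⁻¹ ^ 3) := by
    rw [hval]
    field_simp
    ring
  rw [e2]
  refine (abs_add_three _ _ _).trans ?_
  have t1 : |(c ^ k - (1 - k / (2 * b ^ 2))) * (b + ω + b⁻¹)|
      ≤ 12 * k ^ 2 * L ^ 4 * (h * B⁻¹) := by
    rw [abs_mul]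
    calc _ ≤ (4 * k ^ 2 * L ^ 4 * h * B⁻¹ ^ 2) * (3 * B) :=
          mul_le_mul hck hN' (abs_nonneg _) (by positivity)
      _ = _ := by field_simp; ring
  have t2 : |c ^ k * (N - (b + ω + b⁻¹))| ≤ (4 * r + 9) * L ^ 3 * (h * B⁻¹) := by
    rw [abs_mul, abs_of_nonneg (pow_nonneg hc.le k)]
    exact (mul_le_of_le_one_left (abs_nonneg _) (pow_le_one₀ hc.le hc1)).trans hNN
  have t3 : |-(k / 2 * b⁻¹ ^ 2 * ω) - k / 2 * b⁻¹ ^ 3| ≤ 2 * k * L ^ 3 * (h * B⁻¹) := by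
    refine (abs_sub _ _).trans ?_
    rw [abs_neg, abs_mul, abs_mul, abs_mul, abs_of_nonneg (by positivity : (0 : ℝ) ≤ (k : ℝ) / 2),
      abs_pow, abs_pow, abs_inv]
    calc (k : ℝ) / 2 * |b|⁻¹ ^ 2 * |ω| + k / 2 * |b|⁻¹ ^ 3
        ≤ k / 2 * (L * B⁻¹) ^ 2 * h + k / 2 * (L * B⁻¹) ^ 3 := by gcongr
      _ = k / 2 * L ^ 2 * (B⁻¹ * h) * B⁻¹ + k / 2 * L ^ 3 * B⁻¹ ^ 2 * B⁻¹ := by ring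
      _ ≤ k / 2 * L ^ 3 * (B⁻¹ * h) * 1 + k / 2 * L ^ 3 * (h * B⁻¹) * 1 := by
          have : L ^ 2 ≤ L ^ 3 := pow_le_pow_right₀ hL (by norm_num)
          gcongr
      _ = k * L ^ 3 * (h * B⁻¹) := by ring
      _ ≤ 2 * k * L ^ 3 * (h * B⁻¹) := by
          have : 0 ≤ k * L ^ 3 * (h * B⁻¹) := by positivity
          linarith
  have hq : 0 ≤ h * B⁻¹ := by positivity
  have l3 : L ^ 3 * (h * B⁻¹) ≤ L ^ 4 * (h * B⁻¹) :=
    mul_le_mul_of_nonneg_right (pow_le_pow_right₀ hL (by norm_num)) hq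
  have l4 : (4 * (r : ℝ) + 9 + 2 * k) * (L ^ 3 * (h * B⁻¹))
      ≤ (4 * r + 9 + 2 * k) * (L ^ 4 * (h * B⁻¹)) := by gcongr
  linarith

end NearSpike

end Expansion

/-! ### Geometric and superlinear convergence of the tangent -/

section TangentIteration

variable {k n r : ℕ} {β : Fin r → ℝ} {v : Fin r → Vec n} {Z : Tensor k n} {i : Fin r} {u : Vec n}

lemma tanRatio_le_inv {w x : Vec n} (hw : ‖w‖ = 1) (hx : ‖x‖ = 1) {m₀ : ℝ} (hm0 : 0 < m₀)
    (hm : m₀ ≤ |inner ℝ x w|) : tanRatio w x ≤ m₀⁻¹ := by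
  rw [tanRatio, div_eq_mul_inv]
  have h1 : ‖perp w x‖ ≤ 1 := (norm_perp_le hw x).trans hx.le
  have h2 : |inner ℝ x w|⁻¹ ≤ m₀⁻¹ := inv_anti₀ hm0 hm
  calc _ ≤ 1 * m₀⁻¹ := by gcongr
    _ = _ := one_mul _

/-- Geometric convergence of the tangent in the trapped phase. -/
lemma TrapData.tanRatio_iterate_le {q : Fin r → ℝ} {θ ρ Q M s m₀ : ℝ} {T : ℕ}
    (H : TrapData k β i q θ ρ Q) (hk : 2 ≤ k) (hv : Orthonormal ℝ v) (hM : ‖tensorMap Z‖ ≤ M)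
    (hm0 : 0 < m₀) (hs0 : 0 ≤ s) (hs1 : s ≤ (1 - θ) / 2) (hs : M ≤ s * (|β i| * m₀ ^ (k - 1)))
    (hT : ∀ t, T ≤ t → Trapped v i q (powerIter (spiked k β v Z) u t) ∧
      ‖powerIter (spiked k β v Z) u t‖ = 1 ∧
      m₀ ≤ |inner ℝ (powerIter (spiked k β v Z) u t) (v i)|) (t : ℕ) :
    tanRatio (v i) (powerIter (spiked k β v Z) u (T + t))
      ≤ ((1 + θ) / 2) ^ t * m₀⁻¹ + 4 * s / (1 - θ) := by
  have hθ0 := H.theta_nonneg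
  have hθ1 := H.theta_lt_one
  refine linear_recursion (y := fun t => tanRatio (v i) (powerIter (spiked k β v Z) u (T + t)))
    hθ0 hθ1 hs0 hs1 (fun t => tanRatio_nonneg _ _) ?_ (fun t => ?_) t
  · obtain ⟨-, h2, h3⟩ := hT T le_rfl
    exact tanRatio_le_inv (hv.1 i) h2 hm0 h3
  · obtain ⟨h1, h2, h3⟩ := hT (T + t) (Nat.le_add_right _ _)
    have hb : 0 < |β i| := abs_pos.2 H.beta_ne
    set x := powerIter (spiked k β v Z) u (T + t) with hx
    have hm : 0 < |inner ℝ x (v i)| := hm0.trans_le h3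
    -- This `A` is what `gap` gives in the trapped region; divided by the signal it is exactly `θ`.
    have h4 := tanRatio_powerStep_le hv hk (A := θ * (|β i| * |inner ℝ x (v i)| ^ (k - 2))) h2
      (by positivity) (fun j hj => ?_) hM hm0 h3 H.beta_ne (by linarith) hs
    · rw [mul_div_cancel_right₀ _ (by positivity)] at h4
      exact h4
    · calc |β j| * |inner ℝ x (v j)| ^ (k - 2)
          ≤ |β j| * (q j * |inner ℝ x (v i)|) ^ (k - 2) := by
            gcongr
            exact h1 j
        _ = |β j| * q j ^ (k - 2) * |inner ℝ x (v i)| ^ (k - 2) := by rw [mul_pow]; ring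
        _ ≤ θ * |β i| * |inner ℝ x (v i)| ^ (k - 2) :=
            mul_le_mul_of_nonneg_right (H.gap j hj) (by positivity)
        _ = _ := by ring

/-- Doubly exponential convergence of the tangent, once it is small. -/
lemma tanRatio_superlinear_le {M s m₀ B Λ D : ℝ} {T : ℕ} (hk : 3 ≤ k) (hv : Orthonormal ℝ v)
    (hM : ‖tensorMap Z‖ ≤ M) (hm0 : 0 < m₀) (hs0 : 0 ≤ s) (hs1 : s ≤ 1 / 2)
    (hs : M ≤ s * (|β i| * m₀ ^ (k - 1))) (hβ : β i ≠ 0) (hB : ∀ j, |β j| ≤ B) (hΛ1 : 1 ≤ Λ)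
    (hΛ : 2 * B ≤ Λ * |β i|) (hΛs : 8 * Λ * s ≤ 1)
    (hT : ∀ t, T ≤ t → ‖powerIter (spiked k β v Z) u t‖ = 1 ∧
      m₀ ≤ |inner ℝ (powerIter (spiked k β v Z) u t) (v i)|)
    (hD : 2 * (Λ * tanRatio (v i) (powerIter (spiked k β v Z) u T)) ≤ D) (t : ℕ) :
    2 * (Λ * tanRatio (v i) (powerIter (spiked k β v Z) u (T + t)))
      ≤ max (8 * Λ * s) (D ^ (k - 1) ^ t) := by
  have h := superlinear_recursion (p := k - 1) (a := 2 * Λ * s) (D := D)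
    (z := fun t => Λ * tanRatio (v i) (powerIter (spiked k β v Z) u (T + t))) (by omega)
    (by positivity) (by linarith) (fun t => mul_nonneg (by linarith) (tanRatio_nonneg _ _)) hD
    (fun t => ?_) t
  · have e : 4 * (2 * Λ * s) = 8 * Λ * s := by ring
    rw [e] at h
    exact h
  · obtain ⟨h2, h3⟩ := hT (T + t) (Nat.le_add_right _ _)
    have hb : 0 < |β i| := abs_pos.2 hβ
    have hB0 : 0 ≤ B := (abs_nonneg _).trans (hB i)
    set x := powerIter (spiked k β v Z) u (T + t) with hx
    have hm : 0 < |inner ℝ x (v i)| := hm0.trans_le h3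
    -- Now the other coordinates are bounded by the tangential part of `x`, which makes the
    -- contraction factor itself proportional to `y ^ (k - 2)`.
    have h4 := tanRatio_powerStep_le hv (by omega) (A := B * ‖perp (v i) x‖ ^ (k - 2)) h2
      (by positivity) (fun j hj => ?_) hM hm0 h3 hβ (by linarith) hs
    · have hy := tanRatio_nonneg (v i) x
      set y := tanRatio (v i) x with hyd
      have hk1 : k - 1 = (k - 2) + 1 := by omega
      have h5 : B * ‖perp (v i) x‖ ^ (k - 2) / (|β i| * |inner ℝ x (v i)| ^ (k - 2)) * y
          = B / |β i| * y ^ (k - 1) := by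
        rw [hk1, pow_succ, hyd, tanRatio, div_pow]
        field_simp
      have h6 : B / |β i| * y ^ (k - 1) ≤ Λ / 2 * y ^ (k - 1) := by
        have : B / |β i| ≤ Λ / 2 := by
          rw [div_le_div_iff₀ hb (by norm_num)]
          linarith
        gcongr
      rw [h5] at h4
      set y' := tanRatio (v i) (powerStep (spiked k β v Z) x) with hy'
      have hy'0 : 0 ≤ y' := tanRatio_nonneg _ _
      -- Division by `1 - s ≥ 1 / 2` costs a factor 2, for which `2 * B ≤ Λ * |β i|` left room.
      have h7 : y' ≤ Λ * y ^ (k - 1) + 2 * s := by nlinarith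
      have h8 : Λ * Λ ≤ Λ ^ (k - 1) := by
        rw [← sq]
        exact pow_le_pow_right₀ hΛ1 (by omega)
      change Λ * y' ≤ (Λ * y) ^ (k - 1) + 2 * Λ * s
      calc Λ * y' ≤ Λ * (Λ * y ^ (k - 1) + 2 * s) := by gcongr
        _ = Λ * Λ * y ^ (k - 1) + 2 * Λ * s := by ring
        _ ≤ Λ ^ (k - 1) * y ^ (k - 1) + 2 * Λ * s := by gcongr
        _ = _ := by rw [mul_pow]
    · have h5 : |inner ℝ x (v j)| ≤ ‖perp (v i) x‖ := by
        rw [← inner_perp_of_orthogonal (hv.2 hj.symm) x]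
        refine (abs_real_inner_le_norm _ _).trans ?_
        rw [hv.1 j, mul_one]
      exact mul_le_mul (hB j) (by gcongr) (by positivity) hB0

end TangentIteration

/-! ### From good initial conditions to trapping -/

section Initial

variable {k n r : ℕ}

/-- The initial coordinates are comparable up to `δ²`, so a spike can only be selected if its
strength is comparable to the largest one. Errors in powers of `β_i` may then be stated in powers of
`β_1`. -/
lemma abs_beta_le_of_argmax {δ : ℝ} (hδ : 0 < δ) {β : Fin r → ℝ} {v : Fin r → Vec n} {u : Vec n}
    (hu : u ∈ initGood k δ β v) {i j : Fin r} (hm : inner ℝ u (v i) ≠ 0)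
    (hi : |β j * inner ℝ u (v j) ^ (k - 2)| ≤ |β i * inner ℝ u (v i) ^ (k - 2)|) :
    |β j| * (δ ^ 2) ^ (k - 2) ≤ |β i| := by
  have h1 := hu.2.1 i j
  have h2 : 0 < |inner ℝ u (v i)| := abs_pos.2 hm
  rw [abs_mul, abs_mul, abs_pow, abs_pow] at hi
  have h3 : (|β j| * (δ ^ 2) ^ (k - 2)) * |inner ℝ u (v i)| ^ (k - 2)
      ≤ |β i| * |inner ℝ u (v i)| ^ (k - 2) := by
    refine le_trans ?_ hi
    rw [mul_assoc, ← mul_pow]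
    gcongr
  exact le_of_mul_le_mul_right h3 (by positivity)

/-- Good initial conditions make the iterates trapped. -/
lemma trapData_of_initGood (hk : 2 ≤ k) {δ : ℝ} (hδ : 0 < δ) (hδ2 : δ ≤ 1 / 2) {β : Fin r → ℝ}
    (hβ : ∀ j, β j ≠ 0) {v : Fin r → Vec n} {u : Vec n} (hu : u ∈ initGood k δ β v) {i : Fin r}
    (hm : inner ℝ u (v i) ≠ 0)
    (hi : ∀ j, |β j * inner ℝ u (v j) ^ (k - 2)| ≤ |β i * inner ℝ u (v i) ^ (k - 2)|)
    (h2 : k = 2 → ∀ j, j ≠ i → |β j| ≤ (1 - δ ^ 2) * |β i|) :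
    TrapData k β i (fun j => |inner ℝ u (v j)| / |inner ℝ u (v i)|) (1 - δ ^ 2) (δ ^ 2) (δ ^ 2)⁻¹
      where
  theta_nonneg := by nlinarith
  theta_lt_one := by nlinarith
  rho_pos := by positivity
  rho_le j := by
    rw [le_div_iff₀ (abs_pos.2 hm)]
    exact hu.2.1 i j
  le_Q j := by
    rw [div_le_iff₀ (abs_pos.2 hm), inv_mul_eq_div, le_div_iff₀ (by positivity), mul_comm]
    exact hu.2.1 j i
  self := div_self (abs_pos.2 hm).ne'
  gap j hj := by
    -- For `k = 2` the initial coordinates do not enter the selection and the gap is one of the `β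
    -- j`; for `k ≥ 3` it comes from the initial point, as `1 - δ ≤ 1 - δ²`.
    rcases hk.eq_or_lt with rfl | hk
    · simpa using h2 rfl j hj
    · have h3 := hu.2.2 hk i j hj.symm (hi j)
      rw [abs_mul, abs_mul, abs_pow, abs_pow] at h3
      rw [div_pow, mul_div_assoc', div_le_iff₀ (by have := abs_pos.2 hm; positivity)]
      refine h3.trans ?_
      rw [mul_assoc]
      refine mul_le_mul_of_nonneg_right ?_ (by positivity)
      nlinarith
  beta_ne := hβ i

lemma trapped_self {v : Fin r → Vec n} {u : Vec n} {i : Fin r} (hm : inner ℝ u (v i) ≠ 0) :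
    Trapped v i (fun j => |inner ℝ u (v j)| / |inner ℝ u (v i)|) u := fun j => by
  rw [div_mul_cancel₀ _ (abs_pos.2 hm).ne']

end Initial

/-! ### Time budget and approach to the spike -/

section Asymptotics

lemma eventually_le_rpow (A : ℝ) {p : ℝ} (hp : 0 < p) : ∀ᶠ n : ℕ in atTop, A ≤ (n : ℝ) ^ p :=
  ((tendsto_rpow_atTop hp).comp tendsto_natCast_atTop_atTop).eventually_ge_atTop A

lemma loglog_le_pow {p : ℕ} (hp : 2 ≤ p) {x : ℝ} (hx : 1 < x) {t : ℕ}
    (ht : Real.log (Real.log x) / Real.log p ≤ t) : Real.log x ≤ (p : ℝ) ^ t := by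
  have hp1 : (1 : ℝ) < p := by exact_mod_cast hp
  have hlp : 0 < Real.log p := Real.log_pos hp1
  have hlx : 0 < Real.log x := Real.log_pos hx
  rw [div_le_iff₀ hlp] at ht
  rw [← Real.log_le_log_iff hlx (by positivity), Real.log_pow]
  exact ht

/-- For `k ≥ 3` the lower bound on `B` gives `log B / log n ≥ 1 / 2 + ε`. What results pays for the
escape, geometric and superlinear phases and two further steps. -/
lemma timeBound_ge {k n : ℕ} {ε B : ℝ} (hk : 3 ≤ k) (hn : 2 ≤ n) (hε : 0 < ε)
    (hB : (n : ℝ) ^ (((k : ℝ) - 2) / 2 + ε) ≤ B) :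
    3 + 3 / (2 * ε) + Real.log (Real.log (Real.sqrt n * B)) / Real.log ((k : ℝ) - 1)
      ≤ timeBound k n ε B := by
  have hn1 : (1 : ℝ) < n := by exact_mod_cast hn
  have hln : 0 < Real.log n := Real.log_pos hn1
  have hk3 : (3 : ℝ) ≤ k := by exact_mod_cast hk
  have hn0 : (0 : ℝ) < n := by linarith
  have h1 : (1 / 2 + ε) * Real.log n ≤ Real.log B := by
    calc (1 / 2 + ε) * Real.log n ≤ (((k : ℝ) - 2) / 2 + ε) * Real.log n := by
          gcongr
          linarith
      _ = Real.log ((n : ℝ) ^ (((k : ℝ) - 2) / 2 + ε)) := (Real.log_rpow hn0 _).symm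
      _ ≤ Real.log B := Real.log_le_log (by positivity) hB
  have h2 : 1 / 2 + ε ≤ Real.log B / Real.log n := by
    rw [le_div_iff₀ hln]
    exact h1
  have h3 : 3 + 3 / (2 * ε) ≤ 1 + (1 / ε) * (1 / 2 + 2 * Real.log B / Real.log n) := by
    have h4 : (1 / ε) * (1 / 2 + 2 * (1 / 2 + ε))
        ≤ (1 / ε) * (1 / 2 + 2 * Real.log B / Real.log n) := by
      rw [mul_div_assoc]
      gcongr
    have h5 : (1 / ε) * (1 / 2 + 2 * (1 / 2 + ε)) = 3 / (2 * ε) + 2 := by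
      field_simp
      ring
    linarith
  rw [timeBound]
  linarith

/-- The number of steps after which power iteration has left the neighbourhood of its random
initialization. -/
noncomputable def escapeTime (ε : ℝ) : ℕ := ⌈1 / ε⌉₊ + 1

set_option maxHeartbeats 1600000 in
/-- From good initial conditions, and with typical noise, power iteration approaches the line of
the spike `v i` that attains the maximum of `|βⱼ ⟨u, vⱼ⟩^{k-2}|`. -/
theorem tanRatio_powerIter_le {k r : ℕ} (hk : 2 ≤ k) (hr : 0 < r) {δ : ℝ} (hδ : 0 < δ)
    (hδ2 : δ ≤ 1 / 2) :
    ∃ ε₀ : ℝ, 0 < ε₀ ∧ ∃ C : ℝ, 1 ≤ C ∧ ∀ ε : ℝ, 0 < ε → ε ≤ ε₀ → ∀ᶠ n : ℕ in atTop,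
    ∀ (v : Fin r → Vec n) (β : Fin r → ℝ) (B : ℝ), Orthonormal ℝ v → (∀ j, β j ≠ 0) →
      (∀ j, |β j| ≤ B) → (∃ j, B = |β j|) → (n : ℝ) ^ (((k : ℝ) - 2) / 2 + ε) ≤ B →
    ∀ (i : Fin r) (u : Vec n) (Z : Tensor k n), ‖u‖ = 1 → u ∈ initGood k δ β v →
      (∀ j, |β j * inner ℝ u (v j) ^ (k - 2)| ≤ |β i * inner ℝ u (v i) ^ (k - 2)|) →
      (k = 2 → ∀ j, j ≠ i → |β j| ≤ (1 - δ ^ 2) * |β i|) →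
      ‖tensorMap Z‖ ≤ injBound k →
      (∀ t < escapeTime ε, ∀ j, |inner ℝ (v j) (contract Z (powerIter (spiked k β v Z) u t))|
        ≤ (n : ℝ) ^ (-(1 / 2) + ε / 4)) →
      (∀ t, ‖powerIter (spiked k β v Z) u t‖ = 1 ∧
        inner ℝ (powerIter (spiked k β v Z) u t) (v i) ≠ 0 ∧
        SignType.sign (inner ℝ (powerIter (spiked k β v Z) u (t + 1)) (v i))
          = SignType.sign (β i)
            * SignType.sign (inner ℝ (powerIter (spiked k β v Z) u t) (v i)) ^ (k - 1)) ∧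
      (∀ᶠ t in atTop, tanRatio (v i) (powerIter (spiked k β v Z) u t) ≤ C * B⁻¹) ∧
      (3 ≤ k → ∀ t : ℕ, timeBound k n ε B ≤ t + 2 →
        tanRatio (v i) (powerIter (spiked k β v Z) u t) ≤ C * B⁻¹) ∧
      B ≤ C * |β i| := by
  set M := injBound k with hMdef
  have hM0 : 0 < M := injBound_pos k
  -- A lower bound for `|β i| / B` at the selected spike, by `abs_beta_le_of_argmax`.
  set κ₀ : ℝ := (δ ^ 2) ^ (k - 2) with hκ
  have hκ0 : 0 < κ₀ := by positivity
  have hδ21 : δ ^ 2 ≤ 1 / 4 := by nlinarith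
  have hκ1 : κ₀ ≤ 1 := pow_le_one₀ (by positivity) (by linarith)
  set Q : ℝ := (δ ^ 2)⁻¹ with hQ
  have hr' : (0 : ℝ) < r := by exact_mod_cast hr
  have hQ0 : 0 < Q := by positivity
  set m₀ : ℝ := 1 / (4 * (r * Q)) with hm₀
  have hm0 : 0 < m₀ := by positivity
  set s₀ : ℝ := δ ^ 2 * δ ^ 2 / (1 + Q) with hs₀
  have hs0 : 0 < s₀ := by positivity
  set Λ : ℝ := 2 / κ₀ with hΛ
  have hΛ1 : 1 ≤ Λ := by
    rw [hΛ, le_div_iff₀ hκ0]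
    linarith
  set Cs : ℝ := M / (κ₀ * m₀ ^ (k - 1)) with hCs
  have hCs0 : 0 < Cs := by positivity
  set θ : ℝ := 1 - δ ^ 2 with hθ
  have hθ0 : 0 ≤ (1 + θ) / 2 := by rw [hθ]; linarith
  have hθ1 : (1 + θ) / 2 < 1 := by rw [hθ]; nlinarith
  -- The length `τ` of the geometric phase depends neither on `n` nor on `ε`.
  obtain ⟨τ, hτ⟩ : ∃ τ : ℕ, ((1 + θ) / 2) ^ τ * m₀⁻¹ ≤ 1 / (12 * Λ) := by
    have h1 := (tendsto_pow_atTop_nhds_zero_of_lt_one hθ0 hθ1).mul_const m₀⁻¹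
    rw [zero_mul] at h1
    obtain ⟨τ, hτ⟩ := (h1.eventually (eventually_le_nhds
      (by positivity : (0 : ℝ) < 1 / (12 * Λ)))).exists
    exact ⟨τ, hτ⟩
  -- `ε ≤ ε₀` means `τ + 1 ≤ 1 / (2 ε)`: the geometric phase fits into the time budget. This is why
  -- `ε` must be small depending on `κ`.
  refine ⟨1 / (2 * (τ + 1)), by positivity, (4 / δ ^ 2 + 1) * Cs + 1 + κ₀⁻¹, ?_, ?_⟩
  · have : 0 ≤ (4 / δ ^ 2 + 1) * Cs := by positivity
    have : 0 < κ₀⁻¹ := by positivity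
    linarith
  intro ε hε hε0
  have hε2 : 0 < ε / 2 := by positivity
  have hε4 : 0 < ε / 4 := by positivity
  filter_upwards [eventually_le_rpow (4 * M / (κ₀ * κ₀)) hε2,
    eventually_le_rpow (1 / (s₀ * (4 * M * δ ^ 2))) hε4,
    eventually_le_rpow (M / (s₀ * (κ₀ * m₀ ^ (k - 1)))) hε,
    eventually_le_rpow (δ ^ 2 / m₀) (by norm_num : (0 : ℝ) < 1 / 2),
    eventually_le_rpow (m₀ / δ ^ 2) hε2,
    eventually_le_rpow (Cs * (48 * Λ) / δ ^ 2) hε, eventually_ge_atTop 3]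
    with n c1 c2 c3 c4 c5 c6 hn3 v β B hv hβ hβB hB0 hB i u Z hu hug hi h2 hZ hnoise
  have hn3' : (3 : ℝ) ≤ n := by exact_mod_cast hn3
  have hn0 : (0 : ℝ) < n := by linarith
  have hk2 : (2 : ℝ) ≤ k := by exact_mod_cast hk
  rw [div_le_iff₀ (by positivity)] at c1 c2 c3 c4 c5 c6
  have hnε : (n : ℝ) ^ ε ≤ B := by
    refine le_trans (Real.rpow_le_rpow_of_exponent_le (by linarith) ?_) hB
    linarith
  have hnε1 : 1 ≤ (n : ℝ) ^ ε := Real.one_le_rpow (by linarith) hε.le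
  have hB1 : 1 ≤ B := hnε1.trans hnε
  have hBpos : 0 < B := by linarith
  set X := spiked k β v Z with hX
  have hsqrt : Real.sqrt n * (n : ℝ) ^ (-(1 / 2) : ℝ) = 1 := by
    rw [Real.sqrt_eq_rpow, ← Real.rpow_add hn0]
    norm_num
  set m₁ : ℝ := δ ^ 2 * (n : ℝ) ^ (-(1 / 2) : ℝ) with hm₁
  have hm10 : 0 < m₁ := by positivity
  have hum : m₁ ≤ |inner ℝ u (v i)| := by
    have h3 := hug.1 i
    rw [hu, mul_one] at h3
    calc m₁ ≤ Real.sqrt n * |inner ℝ u (v i)| * (n : ℝ) ^ (-(1 / 2) : ℝ) := by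
          rw [hm₁]
          gcongr
      _ = |inner ℝ u (v i)| * (Real.sqrt n * (n : ℝ) ^ (-(1 / 2) : ℝ)) := by ring
      _ = _ := by rw [hsqrt, mul_one]
  have hm : inner ℝ u (v i) ≠ 0 := abs_pos.1 (hm10.trans_le hum)
  have H := trapData_of_initGood hk hδ hδ2 hβ hug hm hi h2
  have hβi : κ₀ * B ≤ |β i| := by
    obtain ⟨j, rfl⟩ := hB0
    rw [mul_comm]
    exact abs_beta_le_of_argmax hδ hug hm (hi j)
  have hm1m0 : m₁ ≤ m₀ := by
    rw [← Real.sqrt_eq_rpow] at c4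
    calc m₁ ≤ Real.sqrt n * m₀ * (n : ℝ) ^ (-(1 / 2) : ℝ) := by
          rw [hm₁]
          gcongr
      _ = m₀ * (Real.sqrt n * (n : ℝ) ^ (-(1 / 2) : ℝ)) := by ring
      _ = m₀ := by rw [hsqrt, mul_one]
  -- The signal exceeds the noise level by `n ^ ε` up to constants; half of the exponent is spent on
  -- the constants, half is the growth rate.
  set g : ℝ := (n : ℝ) ^ (ε / 2) with hg
  have hg1 : 1 ≤ g := Real.one_le_rpow (by linarith) hε2.le
  have hgg : g * g = (n : ℝ) ^ ε := by
    rw [hg, ← Real.rpow_add hn0]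
    congr 1
    ring
  have hgrow : 4 * M * g ≤ |β i| * m₁ ^ (k - 2) := by
    have h3 : m₁ ^ (k - 2) = κ₀ * (n : ℝ) ^ (-(((k : ℝ) - 2) / 2)) := by
      rw [hm₁, mul_pow, ← Real.rpow_natCast ((n : ℝ) ^ (-(1 / 2) : ℝ)), ← Real.rpow_mul hn0.le,
        Nat.cast_sub hk]
      congr 2
      push_cast
      ring
    have h4 : (n : ℝ) ^ (((k : ℝ) - 2) / 2 + ε) * (n : ℝ) ^ (-(((k : ℝ) - 2) / 2)) = g * g := by
      rw [hgg, ← Real.rpow_add hn0]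
      congr 1
      ring
    calc 4 * M * g ≤ g * (κ₀ * κ₀) * g := by gcongr
      _ = κ₀ * (n : ℝ) ^ (((k : ℝ) - 2) / 2 + ε) * (κ₀ * (n : ℝ) ^ (-(((k : ℝ) - 2) / 2))) := by
          calc g * (κ₀ * κ₀) * g = κ₀ * κ₀ * (g * g) := by ring
            _ = _ := by rw [← h4]; ring
      _ ≤ κ₀ * B * (κ₀ * (n : ℝ) ^ (-(((k : ℝ) - 2) / 2))) := by gcongr
      _ ≤ |β i| * m₁ ^ (k - 2) := by
          rw [h3]
          gcongr
  -- The adaptive noise bound `n ^ (-1/2 + ε/4)` lies below the initial signal, of order at least `n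
  -- ^ (-1/2 + ε/2)`, by a factor that absorbs constants.
  have hη : (n : ℝ) ^ (-(1 / 2) + ε / 4) ≤ s₀ * (4 * M * g * m₁) := by
    have h3 : g = (n : ℝ) ^ (ε / 4) * (n : ℝ) ^ (ε / 4) := by
      rw [hg, ← Real.rpow_add hn0]
      congr 1
      ring
    rw [Real.rpow_add hn0, hm₁]
    calc (n : ℝ) ^ (-(1 / 2) : ℝ) * (n : ℝ) ^ (ε / 4)
        = 1 * ((n : ℝ) ^ (-(1 / 2) : ℝ) * (n : ℝ) ^ (ε / 4)) := (one_mul _).symm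
      _ ≤ (n : ℝ) ^ (ε / 4) * (s₀ * (4 * M * δ ^ 2))
            * ((n : ℝ) ^ (-(1 / 2) : ℝ) * (n : ℝ) ^ (ε / 4)) := by gcongr
      _ = s₀ * (4 * M * ((n : ℝ) ^ (ε / 4) * (n : ℝ) ^ (ε / 4))
            * (δ ^ 2 * (n : ℝ) ^ (-(1 / 2) : ℝ))) := by ring
      _ = _ := by rw [← h3]
  have hM2 : M ≤ s₀ * (|β i| * m₀ ^ (k - 1)) := by
    calc M ≤ (n : ℝ) ^ ε * (s₀ * (κ₀ * m₀ ^ (k - 1))) := c3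
      _ ≤ B * (s₀ * (κ₀ * m₀ ^ (k - 1))) := by gcongr
      _ = s₀ * (κ₀ * B * m₀ ^ (k - 1)) := by ring
      _ ≤ _ := by gcongr
  -- The escape multiplies the coordinate by at least `n ^ (1/2 + ε/2)`; the surplus `n ^ (ε/2)`
  -- takes care of `m₀ / δ²`.
  have hTA : m₀ ≤ g ^ escapeTime ε * m₁ := by
    have h3 : (n : ℝ) ^ (1 / 2 + ε / 2) ≤ g ^ escapeTime ε := by
      rw [hg, ← Real.rpow_natCast, ← Real.rpow_mul hn0.le]
      refine Real.rpow_le_rpow_of_exponent_le (by linarith) ?_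
      rw [escapeTime]
      push_cast
      have h4 : 1 / ε ≤ (⌈1 / ε⌉₊ : ℝ) := Nat.le_ceil _
      have h5 : ε / 2 * (1 / ε + 1) ≤ ε / 2 * ((⌈1 / ε⌉₊ : ℝ) + 1) := by gcongr
      have h6 : ε / 2 * (1 / ε + 1) = 1 / 2 + ε / 2 := by field_simp
      linarith
    have h4 : (n : ℝ) ^ (1 / 2 + ε / 2) * (n : ℝ) ^ (-(1 / 2) : ℝ) = g := by
      rw [hg, ← Real.rpow_add hn0]
      congr 1
      ring
    calc m₀ ≤ g * δ ^ 2 := c5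
      _ = (n : ℝ) ^ (1 / 2 + ε / 2) * (δ ^ 2 * (n : ℝ) ^ (-(1 / 2) : ℝ)) := by rw [← h4]; ring
      _ ≤ _ := by gcongr
  have hs0Q : s₀ * (1 + Q) ≤ (1 - (1 - δ ^ 2)) * δ ^ 2 := by
    rw [hs₀, div_mul_cancel₀ _ (by positivity)]
    linarith
  have hit := H.iterate hk hv hs0Q hs0.le hZ hM0 hm10 hm1m0 hg1 hgrow hη hM2 hTA hnoise
    (trapped_self hm) hu hum
  have hlate : ∀ t, escapeTime ε ≤ t → m₀ ≤ |inner ℝ (powerIter X u t) (v i)| := by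
    intro t ht
    refine le_trans (le_min le_rfl (hTA.trans ?_)) (hit t).2.2.1
    have : g ^ escapeTime ε ≤ g ^ t := pow_le_pow_right₀ hg1 ht
    gcongr
  -- The noise-to-signal ratio once the coordinate is of order one. It is `O(1 / B)` and sets the
  -- final precision of the tangent.
  set s : ℝ := M / (|β i| * m₀ ^ (k - 1)) with hsdef
  have hβpos : 0 < |β i| := lt_of_lt_of_le (by positivity) hβi
  have hspos : 0 < s := by positivity
  have hsM : M ≤ s * (|β i| * m₀ ^ (k - 1)) := by
    rw [hsdef, div_mul_cancel₀ _ (by positivity)]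
  have hsC : s ≤ Cs * B⁻¹ := by
    rw [hsdef, hCs, ← div_eq_mul_inv, div_div]
    refine div_le_div_of_nonneg_left hM0.le (by positivity) ?_
    calc κ₀ * m₀ ^ (k - 1) * B = κ₀ * B * m₀ ^ (k - 1) := by ring
      _ ≤ _ := by gcongr
  have hs48 : 48 * Λ * s ≤ δ ^ 2 := by
    have h3 : Cs * (48 * Λ) ≤ B * δ ^ 2 := c6.trans (by gcongr)
    calc 48 * Λ * s ≤ 48 * Λ * (Cs * B⁻¹) := by gcongr
      _ = (Cs * (48 * Λ)) * B⁻¹ := by ring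
      _ ≤ (B * δ ^ 2) * B⁻¹ := by gcongr
      _ = δ ^ 2 := by field_simp
  have hsΛ : s ≤ Λ * s := le_mul_of_one_le_left hspos.le hΛ1
  have htan := fun t => H.tanRatio_iterate_le (T := escapeTime ε) (u := u) (s := s) hk hv hZ hm0
    hspos.le (by linarith) hsM (fun t ht => ⟨(hit t).1, (hit t).2.1, hlate t ht⟩) t
  have h1θ : 1 - (1 - δ ^ 2) = δ ^ 2 := by ring
  rw [h1θ] at htan
  have hCsB : 0 < Cs * B⁻¹ := by positivity
  have hBi : 0 < B⁻¹ := by positivity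
  have hκi : 0 < κ₀⁻¹ := by positivity
  refine ⟨fun t => ⟨(hit t).2.1, ?_, (hit t).2.2.2⟩, ?_, fun hk3 t ht => ?_, ?_⟩
  · refine abs_pos.1 (lt_of_lt_of_le ?_ (hit t).2.2.1)
    positivity
  · have h3 := (tendsto_pow_atTop_nhds_zero_of_lt_one hθ0 hθ1).mul_const m₀⁻¹
    rw [zero_mul] at h3
    have h4 := h3.eventually (eventually_le_nhds hspos)
    obtain ⟨t₀, ht₀⟩ := eventually_atTop.1 h4
    refine eventually_atTop.2 ⟨escapeTime ε + t₀, fun t ht => ?_⟩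
    obtain ⟨t', rfl⟩ := Nat.exists_eq_add_of_le (le_trans (Nat.le_add_right _ _) ht)
    refine (htan t').trans ?_
    have h5 := ht₀ t' (by omega)
    have h6 : 4 * s / δ ^ 2 + s = (4 / δ ^ 2 + 1) * s := by ring
    have h7 : (4 / δ ^ 2 + 1) * s ≤ (4 / δ ^ 2 + 1) * (Cs * B⁻¹) := by gcongr
    have h8 : 0 ≤ (1 + κ₀⁻¹) * B⁻¹ := by positivity
    linarith
  · have hstart : 2 * (Λ * tanRatio (v i) (powerIter X u (escapeTime ε + τ))) ≤ Real.exp (-1) := by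
      have h3 := htan τ
      have h4 : 4 * s / δ ^ 2 ≤ 1 / (12 * Λ) := by
        rw [div_le_div_iff₀ (by positivity) (by positivity)]
        linarith
      have h5 : tanRatio (v i) (powerIter X u (escapeTime ε + τ)) ≤ 1 / (6 * Λ) := by
        have e : 1 / (6 * Λ) = 1 / (12 * Λ) + 1 / (12 * Λ) := by
          field_simp
          norm_num
        linarith
      have h6 : (1 : ℝ) / 3 ≤ Real.exp (-1) := by
        rw [Real.exp_neg, ← one_div]
        exact one_div_le_one_div_of_le (Real.exp_pos 1) (Real.exp_one_lt_three).le
      refine le_trans ?_ h6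
      calc 2 * (Λ * tanRatio (v i) (powerIter X u (escapeTime ε + τ)))
          ≤ 2 * (Λ * (1 / (6 * Λ))) := by gcongr
        _ = 1 / 3 := by field_simp; norm_num
    have hsup := fun t => tanRatio_superlinear_le (T := escapeTime ε + τ) (u := u) hk3 hv hZ hm0
      hspos.le (by linarith) hsM (hβ i) hβB hΛ1 (by
        rw [hΛ, div_mul_eq_mul_div, le_div_iff₀ hκ0]
        linarith) (by linarith)
      (fun t ht => ⟨(hit t).2.1, hlate t (le_trans (Nat.le_add_right _ _) ht)⟩) hstart t
    have h3 := timeBound_ge hk3 (by omega) hε hB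
    set ℓ := Real.log (Real.log (Real.sqrt n * B)) / Real.log ((k : ℝ) - 1) with hℓ
    have hsn : 1 < Real.sqrt n := by
      rw [Real.lt_sqrt (by norm_num)]
      linarith
    have hx1 : Real.exp 1 < Real.sqrt n * B := by
      have h4 : (n : ℝ) ^ (1 / 2 : ℝ) ≤ B := by
        refine le_trans (Real.rpow_le_rpow_of_exponent_le (by linarith) ?_) hB
        have : (3 : ℝ) ≤ k := by exact_mod_cast hk3
        linarith
      rw [← Real.sqrt_eq_rpow] at h4
      calc Real.exp 1 < 3 := Real.exp_one_lt_three
        _ ≤ Real.sqrt n * Real.sqrt n := by rw [Real.mul_self_sqrt hn0.le]; exact hn3'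
        _ ≤ _ := by gcongr
    have hlog1 : 1 < Real.log (Real.sqrt n * B) := by
      rw [Real.lt_log_iff_exp_lt (by positivity)]
      exact hx1
    have hk1c : ((k - 1 : ℕ) : ℝ) = (k : ℝ) - 1 := by
      rw [Nat.cast_sub (by omega)]
      simp
    have hℓ0 : 0 ≤ ℓ := by
      refine div_nonneg (Real.log_nonneg hlog1.le) (Real.log_nonneg ?_)
      linarith
    have h4 : ((escapeTime ε : ℕ) : ℝ) ≤ 1 / ε + 2 := by
      rw [escapeTime]
      push_cast
      have := (Nat.ceil_lt_add_one (by positivity : 0 ≤ 1 / ε)).le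
      linarith
    have h5 : (τ : ℝ) + 1 ≤ 1 / (2 * ε) := by
      rw [le_div_iff₀ (by positivity)]
      rw [le_div_iff₀ (by positivity)] at hε0
      linarith
    have h6 : 3 / (2 * ε) = 1 / ε + 1 / (2 * ε) := by
      field_simp
      norm_num
    -- The budget `3 + 3 / (2 ε) + ℓ ≤ t + 2` covers at most `1 / ε + 2` escape steps, at most `1 /
    -- (2 ε) - 1` geometric ones, and `ℓ` superlinear ones.
    have h7 : ((escapeTime ε + τ : ℕ) : ℝ) + ℓ ≤ t := by
      push_cast
      linarith
    have h8 : escapeTime ε + τ ≤ t := by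
      have : ((escapeTime ε + τ : ℕ) : ℝ) ≤ t := by linarith
      exact_mod_cast this
    obtain ⟨t', rfl⟩ := Nat.exists_eq_add_of_le h8
    have h9 : ℓ ≤ t' := by
      push_cast at h7
      linarith
    have h10 : Real.log (Real.sqrt n * B) ≤ ((k - 1 : ℕ) : ℝ) ^ t' := by
      refine loglog_le_pow (by omega) ?_ ?_
      · exact lt_trans (Real.one_lt_exp_iff.2 one_pos) hx1
      · rw [hk1c]
        exact h9
    have h11 : Real.exp (-1) ^ (k - 1) ^ t' ≤ B⁻¹ := by
      rw [← Real.exp_nat_mul]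
      push_cast
      calc Real.exp (((k - 1 : ℕ) : ℝ) ^ t' * -1)
          ≤ Real.exp (-Real.log (Real.sqrt n * B)) := by
            refine Real.exp_le_exp.2 ?_
            linarith
        _ = (Real.sqrt n * B)⁻¹ := by rw [Real.exp_neg, Real.exp_log (by positivity)]
        _ ≤ B⁻¹ := by
            refine inv_anti₀ hBpos ?_
            exact le_mul_of_one_le_left hBpos.le hsn.le
    have h12 := hsup t'
    have h13 : max (8 * Λ * s) (Real.exp (-1) ^ (k - 1) ^ t')
        ≤ 2 * (Λ * (((4 / δ ^ 2 + 1) * Cs + 1 + κ₀⁻¹) * B⁻¹)) := by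
      refine max_le ?_ ?_
      · have h14 : 4 * (Cs * B⁻¹) ≤ (4 / δ ^ 2 + 1) * (Cs * B⁻¹) := by
          have : 4 ≤ 4 / δ ^ 2 + 1 := by
            have : 4 ≤ 4 / δ ^ 2 := by
              rw [le_div_iff₀ (by positivity)]
              linarith
            linarith
          gcongr
        have h15 : 0 ≤ (1 + κ₀⁻¹) * B⁻¹ := by positivity
        have h16 : 4 * s ≤ ((4 / δ ^ 2 + 1) * Cs + 1 + κ₀⁻¹) * B⁻¹ := by linarith
        calc 8 * Λ * s = 2 * (Λ * (4 * s)) := by ring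
          _ ≤ _ := by gcongr
      · refine h11.trans ?_
        have h14 : 0 ≤ (4 / δ ^ 2 + 1) * Cs * B⁻¹ := by positivity
        have h15 : 0 ≤ κ₀⁻¹ * B⁻¹ := by positivity
        have h16 : B⁻¹ ≤ ((4 / δ ^ 2 + 1) * Cs + 1 + κ₀⁻¹) * B⁻¹ := by linarith
        have h17 : ((4 / δ ^ 2 + 1) * Cs + 1 + κ₀⁻¹) * B⁻¹
            ≤ Λ * (((4 / δ ^ 2 + 1) * Cs + 1 + κ₀⁻¹) * B⁻¹) :=
          le_mul_of_one_le_left (hBi.le.trans h16) hΛ1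
        linarith
    have h14 := le_of_mul_le_mul_left (h12.trans h13) (by norm_num)
    exact le_of_mul_le_mul_left h14 (by linarith)
  · have h3 : B ≤ κ₀⁻¹ * |β i| := by
      rw [inv_mul_eq_div, le_div_iff₀ hκ0]
      linarith
    refine h3.trans (mul_le_mul_of_nonneg_right ?_ hβpos.le)
    have : 0 ≤ (4 / δ ^ 2 + 1) * Cs := by positivity
    linarith

end Asymptotics

/-! ### Reversing the sign of all spikes -/

section Flip

variable {k n r : ℕ}

lemma orthonormal_smul {v : Fin r → Vec n} (hv : Orthonormal ℝ v) {σ : ℝ} (hσ : |σ| = 1) :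
    Orthonormal ℝ fun j => σ • v j := by
  refine ⟨fun j => ?_, fun j l hjl => ?_⟩
  · rw [norm_smul, hv.1 j, Real.norm_eq_abs, hσ, mul_one]
  · change inner ℝ (σ • v j) (σ • v l) = 0
    rw [real_inner_smul_left, real_inner_smul_right, hv.2 hjl]
    simp

lemma tpow_smul (hk : 1 ≤ k) (σ : ℝ) (w : Vec n) : tpow k (σ • w) = σ ^ k • tpow k w := by
  funext I
  simp only [tpow, PiLp.smul_apply, smul_eq_mul, Pi.smul_apply, Finset.prod_mul_distrib,
    Finset.prod_const, Finset.card_univ, Fintype.card_fin]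
  rw [← mul_pow_sub_one (by omega : k ≠ 0) σ]
  ring

/-- Changing the sign of all spikes does not change the tensor. -/
lemma spiked_flip (hk : 1 ≤ k) {σ : ℝ} (hσ : |σ| = 1) (β : Fin r → ℝ) (v : Fin r → Vec n)
    (Z : Tensor k n) :
    spiked k (fun j => β j * σ ^ k) (fun j => σ • v j) Z = spiked k β v Z := by
  have h : σ ^ k * σ ^ k = 1 := by
    rw [← mul_pow, ← abs_mul_abs_self, hσ, mul_one, one_pow]
  simp only [spiked, tpow_smul hk, smul_smul, mul_assoc, h, mul_one]

lemma tanRatio_smul_left {σ : ℝ} (hσ : |σ| = 1) (w u : Vec n) :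
    tanRatio (σ • w) u = tanRatio w u := by
  have h : σ * σ = 1 := by rw [← abs_mul_abs_self, hσ, mul_one]
  rw [tanRatio, tanRatio, perp, perp, real_inner_smul_right, smul_smul, abs_mul, hσ, one_mul]
  congr 4
  rw [mul_right_comm, h, one_mul]

end Flip

/-! ### Expansions from typical noise -/

section Expansion

variable {k n r : ℕ}

/-- The event that the noise acts on `w` as on a typical vector. -/
def noiseGood (v : Fin r → Vec n) (a w : Vec n) (h M : ℝ) : Set (Tensor k n) :=
  {Z | |inner ℝ a (contract Z w)| ≤ h ∧ (∀ j, |inner ℝ (v j) (contract Z w)| ≤ h) ∧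
    |‖contract Z w‖ ^ 2 - 1| ≤ h ∧
    (∀ s, |inner ℝ a (tensorMap Z (Function.update (fun _ => w) s (contract Z w)))|
      ≤ (1 + M) * h) ∧
    ∀ s, |inner ℝ w (tensorMap Z (Function.update (fun _ => w) s (contract Z w)))| ≤ (1 + M) * h}

lemma abs_inner_slotDeriv_le {Z : Tensor k n} {y w x : Vec n} {c : ℝ} (hc : 0 ≤ c)
    (h : ∀ s, |inner ℝ y (tensorMap Z (Function.update (fun _ => w) s x))| ≤ c) :
    |inner ℝ y (slotDeriv Z w x)| ≤ k * c := by
  rw [slotDeriv, inner_sum]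
  refine (Finset.abs_sum_le_sum_abs _ _).trans ((Finset.sum_le_sum fun s _ => h s).trans ?_)
  simp only [Finset.sum_const, Finset.card_univ, Fintype.card_fin, nsmul_eq_mul]
  have : k - 1 ≤ k := Nat.sub_le _ _
  gcongr

lemma nearSpike_of_noiseGood {β : Fin r → ℝ} {v : Fin r → Vec n} {Z : Tensor k n} {i : Fin r}
    {a : Vec n} {B h L M : ℝ} (hv : Orthonormal ℝ v) (hk : 3 ≤ k) (hM : ‖tensorMap Z‖ ≤ M)
    (hL : 2 ^ k * k * (1 + M) ≤ L) (hβ : ∀ j, |β j| ≤ B) (hi : B ≤ L * |β i|)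
    (hB : 6 * L ^ 3 ≤ B) (hhB : 1 ≤ h * B) (hh0 : 0 ≤ h) (hh : h ≤ 1) (ha : ‖a‖ ≤ 1)
    (hZ : Z ∈ noiseGood v a (v i) h M) : NearSpike β v Z i a B h L := by
  have hM0 : 0 ≤ M := (norm_nonneg _).trans hM
  have hkR : (1 : ℝ) ≤ k := by exact_mod_cast (by omega : 1 ≤ k)
  have h2k : (1 : ℝ) ≤ 2 ^ k := one_le_pow₀ (by norm_num)
  have h2kk : (1 : ℝ) ≤ 2 ^ k * k := one_le_mul_of_one_le_of_one_le h2k hkR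
  have hL1 : 1 + M ≤ L := (le_mul_of_one_le_left (by linarith) h2kk).trans hL
  have hL2 : k * (1 + M) ≤ L := by
    refine le_trans ?_ hL
    rw [mul_assoc]
    exact le_mul_of_one_le_left (by positivity) h2k
  have hL3 : 2 ^ k * M ≤ L := by
    refine le_trans ?_ hL
    calc 2 ^ k * M = 2 ^ k * 1 * M := by ring
      _ ≤ 2 ^ k * k * (1 + M) := by gcongr; linarith
  obtain ⟨z1, z2, z3, z4, z5⟩ := hZ
  have hc : 0 ≤ (1 + M) * h := by positivity
  refine ⟨hv, hk, by linarith, hβ, hi, hB, hhB, hh, ?_, fun x => ?_, fun x hx => ?_, ha, z1, z2,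
    z3, ?_, ?_⟩
  · exact ((norm_contract_le Z (hv.1 i).le).trans hM).trans (by linarith)
  · refine (norm_slotDeriv_le Z (hv.1 i) x).trans ?_
    refine mul_le_mul_of_nonneg_right (le_trans ?_ hL2) (norm_nonneg _)
    gcongr
    linarith
  · refine (norm_contract_add_sub_le Z (hv.1 i) hx).trans ?_
    refine mul_le_mul_of_nonneg_right (le_trans ?_ hL3) (by positivity)
    gcongr
  · refine (abs_inner_slotDeriv_le hc z4).trans ?_
    rw [← mul_assoc]
    gcongr
  · refine (abs_inner_slotDeriv_le hc z5).trans ?_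
    rw [← mul_assoc]
    gcongr

/-- The error obtained is already of the order of the second summand of the rate; the other three
are only used to be nonnegative. -/
lemma div_sq_le_rateVec {B : ℝ} (hB : 0 < B) (hn : 1 ≤ n) :
    Real.log n / Real.sqrt n * B⁻¹ ^ 2 ≤ rateVec k n B := by
  have hl : 0 ≤ Real.log n := Real.log_natCast_nonneg n
  have e : Real.log n / Real.sqrt n * B⁻¹ ^ 2 = Real.log n / (B ^ 2 * Real.sqrt n) := by
    field_simp
  have h1 : 0 ≤ Real.log n / Real.sqrt n * (Real.log n / (Real.sqrt n * B)) ^ (k - 1) := by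
    positivity
  have h2 : 0 ≤ (Real.log n) ^ (3 / 2 : ℝ) / (B ^ (3 / 2 : ℝ) * (n : ℝ) ^ (3 / 4 : ℝ)) := by
    positivity
  have h3 : 0 ≤ 1 / B ^ 4 := by positivity
  rw [e, rateVec]
  linarith

lemma div_le_rateVal {B : ℝ} (hB : 0 < B) (hn : 1 ≤ n) :
    Real.log n / Real.sqrt n * B⁻¹ ≤ rateVal k n B := by
  have hl : 0 ≤ Real.log n := Real.log_natCast_nonneg n
  have e : Real.log n / Real.sqrt n * B⁻¹ = Real.log n / (B * Real.sqrt n) := by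
    field_simp
  have h1 : 0 ≤ Real.log n / Real.sqrt n * (Real.log n / (Real.sqrt n * B)) ^ (k - 1) := by
    positivity
  have h2 : 0 ≤ (Real.log n) ^ (3 / 2 : ℝ) / (B ^ (1 / 2 : ℝ) * (n : ℝ) ^ (3 / 4 : ℝ)) := by
    positivity
  have h3 : 0 ≤ 1 / B ^ 3 := by positivity
  rw [e, rateVal]
  linarith

/-- The size of the constants of the expansions after two steps. -/
noncomputable def stepConst (L : ℝ) : ℝ := 40 * (12 * L ^ 5) ^ 5

/-- The constant of the expansions. -/
noncomputable def expConst (k r : ℕ) (L : ℝ) : ℝ :=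
  (12 * k ^ 2 + 2 * k + 4 * r + 9) * stepConst L ^ 4

/-- After two more steps near the spike `v i`, the expansions hold. -/
lemma NearSpike.expansion {β : Fin r → ℝ} {v : Fin r → Vec n} {Z : Tensor k n} {i : Fin r}
    {a u : Vec n} {B L : ℝ} (H : NearSpike β v Z i a B (Real.log n / Real.sqrt n) L) {t : ℕ}
    (hB : 6 * stepConst L ^ 3 ≤ B) (hn : 1 ≤ n)
    (htan : ∀ s, t ≤ s → tanRatio (v i) (powerIter (spiked k β v Z) u s) ≤ L * B⁻¹)
    (hm : ∀ s, inner ℝ (powerIter (spiked k β v Z) u s) (v i) ≠ 0)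
    (hpos : 0 < inner ℝ (powerIter (spiked k β v Z) u (t + 2)) (v i))
    (hnorm : ‖powerIter (spiked k β v Z) u (t + 2)‖ = 1) :
    Expansion (spiked k β v Z) Z u a B (expConst k r L) (t + 2) (β i) (v i) := by
  set h := Real.log n / Real.sqrt n with hh
  set X := spiked k β v Z with hX
  set L₁ := 12 * L ^ 5 with hL₁
  set L₂ := stepConst L with hL₂
  have hL := H.one_le_L
  have hh0 := H.h_pos
  have hB0 : 0 < B := by linarith [H.six_le_B]
  have hBi : 0 < B⁻¹ := inv_pos.2 hB0
  have hLL1 : L ≤ L₁ := by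
    have : L ≤ L ^ 5 := le_self_pow₀ hL (by norm_num)
    rw [hL₁]
    linarith
  have hL11 : 1 ≤ L₁ := hL.trans hLL1
  have hL12 : 40 * L₁ ^ 5 = L₂ := rfl
  have hLL2 : L₁ ≤ L₂ := by
    have : L₁ ≤ L₁ ^ 5 := le_self_pow₀ hL11 (by norm_num)
    linarith
  have hB1 : 6 * L₁ ^ 3 ≤ B := le_trans (by gcongr) hB
  have H1 := H.mono hLL1 hB1 hh0.le
  have H2 := H.mono (hLL1.trans hLL2) hB hh0.le
  have hx : ∀ s, t ≤ s → ‖tanVec (v i) (powerIter X u s)‖ ≤ L * B⁻¹ := fun s hs => by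
    rw [norm_tanVec]
    exact htan s hs
  have hstep : ∀ s, tanVec (v i) (powerIter X u (s + 1))
      = tanVec (v i) (contract X (v i + tanVec (v i) (powerIter X u s))) := fun s => by
    rw [powerIter_succ, tanVec_powerStep (hm s)]
  -- One step from a tangent of order `1 / B` fixes the direction of the tangent vector; the
  -- constant grows from `L` to `L₁`.
  have hdir : ∀ s, t ≤ s → ‖tanVec (v i) (powerIter X u (s + 1))
      - (β i)⁻¹ • perp (v i) (contract Z (v i))‖ ≤ L₁ * B⁻¹ ^ 2 := fun s hs => by
    rw [hstep]
    exact H.norm_tanVec_sub_le (inner_tanVec_self (H.orth.1 i) _) (hx s hs)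
  -- The second step uses that direction as input and gains the factor `h` along `a`; the constant
  -- grows to `L₂`.
  have ha := H1.abs_inner_tanVec_sub_le (inner_tanVec_self (H.orth.1 i) _)
    ((hx (t + 1) (by omega)).trans (by gcongr)) (hdir t le_rfl)
  rw [← hX, ← hstep (t + 1), hL12] at ha
  have hx2 : ‖tanVec (v i) (powerIter X u (t + 2))‖ ≤ L₂ * B⁻¹ :=
    (hx (t + 2) (by omega)).trans (by gcongr; linarith)
  have hd2 : ‖tanVec (v i) (powerIter X u (t + 2)) - (β i)⁻¹ • perp (v i) (contract Z (v i))‖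
      ≤ L₂ * B⁻¹ ^ 2 := (hdir (t + 1) (by omega)).trans (by gcongr)
  have hK : 0 ≤ L₂ ^ 4 := by positivity
  have hL20 : 0 ≤ L₂ := by linarith
  constructor
  · refine (H2.abs_inner_sub_le hnorm hpos hx2 hd2 ha).trans ?_
    have h1 := div_sq_le_rateVec (k := k) hB0 hn
    have h2 : 6 * L₂ ^ 4 ≤ expConst k r L := by
      rw [expConst, ← hL₂]
      refine mul_le_mul_of_nonneg_right ?_ hK
      have : (0 : ℝ) ≤ 12 * k ^ 2 + 2 * k + 4 * r := by positivity
      linarith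
    rw [mul_assoc]
    refine mul_le_mul h2 h1 (by positivity) ?_
    rw [expConst]
    positivity
  · rw [powerVal, tinner_tpow]
    refine (H2.abs_val_sub_le hnorm hpos hx2 hd2).trans ?_
    rw [mul_assoc]
    refine mul_le_mul_of_nonneg_left (div_le_rateVal hB0 hn) ?_
    positivity

/-- The expansions around the spike `σ v i` with the sign `σ` of `⟨u_T, v i⟩`. -/
lemma expansion_of_tanRatio {β : Fin r → ℝ} {v : Fin r → Vec n} {Z : Tensor k n} {i : Fin r}
    {a u : Vec n} {B L M σ : ℝ} (hv : Orthonormal ℝ v) (hk : 3 ≤ k) (hM : ‖tensorMap Z‖ ≤ M)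
    (hσ : |σ| = 1) (hL : 2 ^ k * k * (1 + M) ≤ L) (hβ : ∀ j, |β j| ≤ B) (hi : B ≤ L * |β i|)
    (hB : 6 * stepConst L ^ 3 ≤ B) (hn : 1 ≤ n) (hhB : 1 ≤ Real.log n / Real.sqrt n * B)
    (hh : Real.log n / Real.sqrt n ≤ 1) (ha : ‖a‖ ≤ 1)
    (hZ : Z ∈ noiseGood v a (σ • v i) (Real.log n / Real.sqrt n) M) {t : ℕ}
    (htan : ∀ s, t ≤ s → tanRatio (v i) (powerIter (spiked k β v Z) u s) ≤ L * B⁻¹)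
    (hm : ∀ s, inner ℝ (powerIter (spiked k β v Z) u s) (v i) ≠ 0)
    (hpos : 0 < σ * inner ℝ (powerIter (spiked k β v Z) u (t + 2)) (v i))
    (hnorm : ‖powerIter (spiked k β v Z) u (t + 2)‖ = 1) :
    Expansion (spiked k β v Z) Z u a B (expConst k r L) (t + 2) (β i * σ ^ k) (σ • v i) := by
  have hσ0 : σ ≠ 0 := fun h0 => by simp [h0] at hσ
  have hk1 : 1 ≤ k := by omega
  have hM0 : 0 ≤ M := (norm_nonneg _).trans hM
  have hL1 : 1 ≤ L := by
    refine le_trans ?_ hL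
    have hkR : (1 : ℝ) ≤ k := by exact_mod_cast hk1
    have h2k : (1 : ℝ) ≤ 2 ^ k := one_le_pow₀ (by norm_num)
    exact one_le_mul_of_one_le_of_one_le (one_le_mul_of_one_le_of_one_le h2k hkR) (by linarith)
  have hLs : L ≤ stepConst L := by
    have h1 : L ≤ L ^ 5 := le_self_pow₀ hL1 (by norm_num)
    have h2 : 12 * L ^ 5 ≤ (12 * L ^ 5) ^ 5 := le_self_pow₀ (by linarith) (by norm_num)
    rw [stepConst]
    linarith
  have habs : ∀ j, |β j * σ ^ k| = |β j| := fun j => by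
    rw [abs_mul, abs_pow, hσ, one_pow, mul_one]
  have H : NearSpike (fun j => β j * σ ^ k) (fun j => σ • v j) Z i a B
      (Real.log n / Real.sqrt n) L := by
    refine nearSpike_of_noiseGood (orthonormal_smul hv hσ) hk hM hL (fun j => ?_) ?_ ?_ hhB ?_ hh ha
      ⟨hZ.1, fun j => ?_, hZ.2.2⟩
    · rw [habs]
      exact hβ j
    · rw [habs]
      exact hi
    · refine le_trans ?_ hB
      gcongr
    · have := Real.log_natCast_nonneg n
      positivity
    · rw [real_inner_smul_left, abs_mul, hσ, one_mul]
      exact hZ.2.1 j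
  -- Writing the same tensor with the spikes `σ v j` makes the relevant coordinate positive, the
  -- case treated by `NearSpike.expansion`.
  rw [← spiked_flip hk1 hσ β v Z] at htan hm hpos hnorm ⊢
  refine H.expansion hB hn (fun s hs => ?_) (fun s => ?_) ?_ hnorm
  · rw [tanRatio_smul_left hσ]
    exact htan s hs
  · rw [real_inner_smul_right]
    exact mul_ne_zero hσ0 (hm s)
  · rw [real_inner_smul_right]
    exact hpos

end Expansion

/-! ### Sign dynamics and separation of the limits -/

section Signs

variable {k n r : ℕ}

/-- The side of the hyperplane orthogonal to `w` on which the `t`-th iterate lies. -/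
noncomputable def dirSign (X : Tensor k n) (u w : Vec n) (t : ℕ) : ℝ :=
  ((SignType.sign (inner ℝ (powerIter X u t) w : ℝ) : SignType) : ℝ)

/-- Power iteration follows the spike `b w^{⊗k}`, up to signs. -/
structure Follows (X : Tensor k n) (u : Vec n) (δ b : ℝ) (w : Vec n) : Prop where
  sign_eq : ∀ t, dirSign X u w t = 1 ∨ dirSign X u w t = -1
  sign_succ : ∀ t, dirSign X u w (t + 1)
    = ((SignType.sign b : SignType) : ℝ) * dirSign X u w t ^ (k - 1)
  near : ∀ᶠ t in atTop, Near X u δ (b * dirSign X u w t ^ k) (dirSign X u w t • w) t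

namespace Follows

variable {X : Tensor k n} {u w : Vec n} {δ b : ℝ}

lemma abs_sign (H : Follows X u δ b w) (t : ℕ) : |dirSign X u w t| = 1 := by
  rcases H.sign_eq t with h | h <;> simp [h]

/-- The even power `k - 1` erases the previous sign. At `t = 0` the sign is that of the random
start, hence `1 ≤ t`. -/
lemma sign_odd (H : Follows X u δ b w) (hk : Odd k) {t : ℕ} (ht : 1 ≤ t) :
    dirSign X u w t = ((SignType.sign b : SignType) : ℝ) := by
  obtain ⟨s, rfl⟩ := Nat.exists_eq_add_of_le' ht
  have hk' : Even (k - 1) := Nat.Odd.sub_odd hk odd_one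
  rw [H.sign_succ s]
  rcases H.sign_eq s with h | h
  · rw [h, one_pow, mul_one]
  · rw [h, hk'.neg_one_pow, mul_one]

/-- The odd power `k - 1` preserves the previous sign, so each step multiplies it by the sign of
`b`: the initial side is remembered, and it flips each time if `b < 0`. -/
lemma sign_even (H : Follows X u δ b w) (hk : Even k) (hk2 : 2 ≤ k) (t : ℕ) :
    dirSign X u w t = ((SignType.sign b : SignType) : ℝ) ^ t * dirSign X u w 0 := by
  have hk' : Odd (k - 1) := Nat.Even.sub_odd (by omega) hk odd_one
  induction t with
  | zero => simp
  | succ t ih =>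
    have h : dirSign X u w t ^ (k - 1) = dirSign X u w t := by
      rcases H.sign_eq t with h | h
      · rw [h, one_pow]
      · rw [h, hk'.neg_one_pow]
    rw [H.sign_succ, h, ih, pow_succ']
    ring

lemma pow_even (H : Follows X u δ b w) (hk : Even k) (t : ℕ) : dirSign X u w t ^ k = 1 := by
  rcases H.sign_eq t with h | h
  · rw [h, one_pow]
  · rw [h, hk.neg_one_pow]

lemma converges_odd_pos (H : Follows X u δ b w) (hk : Odd k) (hb : 0 < b) :
    Converges X u δ b w := by
  filter_upwards [H.near, eventually_ge_atTop 1] with t ht h1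
  rw [H.sign_odd hk h1, sign_pos hb] at ht
  simpa using ht

lemma converges_odd_neg (H : Follows X u δ b w) (hk : Odd k) (hb : b < 0) :
    Converges X u δ (-b) (-w) := by
  filter_upwards [H.near, eventually_ge_atTop 1] with t ht h1
  rw [H.sign_odd hk h1, sign_neg hb] at ht
  simpa [hk.neg_one_pow] using ht

lemma converges_even_pos (H : Follows X u δ b w) (hk : Even k) (hk2 : 2 ≤ k) (hb : 0 < b) :
    Converges X u δ b (dirSign X u w 0 • w) := by
  filter_upwards [H.near] with t ht
  rw [H.pow_even hk, H.sign_even hk hk2 t, sign_pos hb] at ht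
  simpa using ht

lemma alternates_even_neg (H : Follows X u δ b w) (hk : Even k) (hk2 : 2 ≤ k) (hb : b < 0) :
    Alternates X u δ b (dirSign X u w 0 • w) := by
  filter_upwards [H.near] with t ht
  rw [H.pow_even hk, H.sign_even hk hk2 t, sign_neg hb] at ht
  simpa [smul_smul] using ht

end Follows

/-- The lines of two different spikes are separated. -/
lemma eq_of_near_both {v : Fin r → Vec n} (hv : Orthonormal ℝ v) {i j : Fin r} {x : Vec n}
    {σ τ δ : ℝ} (hσ : |σ| = 1) (hτ : |τ| = 1) (hδ : δ ≤ 1 / 2) (h1 : ‖x - σ • v i‖ ≤ δ)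
    (h2 : ‖x - τ • v j‖ ≤ δ) : i = j ∧ σ = τ := by
  have h3 : ‖σ • v i - τ • v j‖ ≤ 1 := by
    have : σ • v i - τ • v j = (x - τ • v j) - (x - σ • v i) := by abel
    rw [this]
    refine (norm_sub_le _ _).trans ?_
    linarith
  have h4 : ‖σ • v i - τ • v j‖ ^ 2 = 2 - 2 * (σ * τ * inner ℝ (v i) (v j)) := by
    rw [norm_sub_sq_real, norm_smul, norm_smul, hv.1, hv.1, Real.norm_eq_abs, Real.norm_eq_abs, hσ,
      hτ, real_inner_smul_left, real_inner_smul_right]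
    ring
  have h5 : 2 - 2 * (σ * τ * inner ℝ (v i) (v j)) ≤ 1 := by
    rw [← h4]
    exact pow_le_one₀ (norm_nonneg _) h3
  have hij : i = j := by
    by_contra hne
    rw [hv.2 hne] at h5
    norm_num at h5
  refine ⟨hij, ?_⟩
  rw [hij, real_inner_self_eq_norm_sq, hv.1] at h5
  rcases (abs_eq zero_le_one).1 hσ with rfl | rfl <;>
    rcases (abs_eq zero_le_one).1 hτ with rfl | rfl <;> first | rfl | (exfalso; norm_num at h5)

lemma follows_of_tanRatio {β : Fin r → ℝ} {v : Fin r → Vec n} {Z : Tensor k n} {i : Fin r}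
    {u : Vec n} {B C M h δ : ℝ} (hv : Orthonormal ℝ v) (hk : 2 ≤ k) (hM : ‖tensorMap Z‖ ≤ M)
    (hβ : ∀ j, |β j| ≤ B) (hB : 0 < B) (hh : |inner ℝ (v i) (contract Z (v i))| ≤ h) (hC : 0 ≤ C)
    (hit : ∀ t, ‖powerIter (spiked k β v Z) u t‖ = 1 ∧
      inner ℝ (powerIter (spiked k β v Z) u t) (v i) ≠ 0 ∧
      SignType.sign (inner ℝ (powerIter (spiked k β v Z) u (t + 1)) (v i))
        = SignType.sign (β i)
          * SignType.sign (inner ℝ (powerIter (spiked k β v Z) u t) (v i)) ^ (k - 1))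
    (htan : ∀ᶠ t in atTop, tanRatio (v i) (powerIter (spiked k β v Z) u t) ≤ C * B⁻¹)
    (hδ : ((k + r) * C ^ 2 + 2 * k * M * C + 2 * C) * B⁻¹ + h ≤ δ) :
    Follows (spiked k β v Z) u δ (β i) (v i) := by
  refine ⟨fun t => ?_, fun t => ?_, ?_⟩
  · rcases lt_or_gt_of_ne (hit t).2.1 with h1 | h1
    · right
      simp [dirSign, sign_neg h1]
    · left
      simp [dirSign, sign_pos h1]
  · rw [dirSign, (hit t).2.2, dirSign]
    push_cast
    rfl
  · filter_upwards [htan] with t ht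
    obtain ⟨h1, h2, -⟩ := hit t
    have hM0 : 0 ≤ M := (norm_nonneg _).trans hM
    have hh0 : 0 ≤ h := (abs_nonneg _).trans hh
    have hBi : 0 < B⁻¹ := inv_pos.2 hB
    have hy := tanRatio_nonneg (v i) (powerIter (spiked k β v Z) u t)
    set y := tanRatio (v i) (powerIter (spiked k β v Z) u t) with hyd
    have p1 : 0 ≤ (k + r) * C ^ 2 * B⁻¹ := by positivity
    have p2 : 0 ≤ 2 * k * M * C * B⁻¹ := by positivity
    have p3 : 0 ≤ 2 * C * B⁻¹ := by positivity
    constructor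
    · rw [powerVal, tinner_tpow]
      refine (abs_powerVal_sub_le hv hk hβ Z h1 h2).trans ?_
      rw [← hyd]
      have t1 : (k + r) * B * y ^ 2 ≤ (k + r) * C ^ 2 * B⁻¹ := by
        calc (k + r) * B * y ^ 2 ≤ (k + r) * B * (C * B⁻¹) ^ 2 := by gcongr
          _ = _ := by field_simp
      have t2 : 2 * k * ‖tensorMap Z‖ * y ≤ 2 * k * M * C * B⁻¹ := by
        calc 2 * k * ‖tensorMap Z‖ * y ≤ 2 * k * M * (C * B⁻¹) := by gcongr
          _ = _ := by ring
      linarith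
    · refine (norm_sub_sign_smul_le (hv.1 i) h1 h2).trans ?_
      rw [← hyd]
      linarith

end Signs

/-! ### Probability of the good event -/

section GoodEvent

variable {k n r : ℕ}

/-- The rate of the failure probability of `noiseGood`. -/
noncomputable def noiseConst (k r : ℕ) (M : ℝ) : ℝ := 2 + r + varSq + 2 * k * M ^ 2

/-- A union bound. The second-order terms are only controlled where `Z[w^{⊗(k-1)}]` is bounded and
small along the test direction; the injective norm and the first-order events provide this. -/
lemma noise_diff_noiseGood_le (hn : 0 < n) {v : Fin r → Vec n} (hv : ∀ j, ‖v j‖ = 1) {a w : Vec n}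
    (ha : ‖a‖ ≤ 1) (hw : ‖w‖ = 1) {h : ℝ} (hh : 0 < h) (M : ℝ) :
    noise k n ({Z | ‖tensorMap Z‖ ≤ M} \ noiseGood v a w h M)
      ≤ ENNReal.ofReal (noiseConst k r M * (n * h ^ 2)⁻¹) := by
  set E0 : Vec n → Set (Tensor k n) := fun y => {Z | h < |inner ℝ y (contract Z w)|}
  set E3 : Set (Tensor k n) := {Z | h < |‖contract Z w‖ ^ 2 - 1|}
  set E4 : Vec n → Fin (k - 1) → Set (Tensor k n) := fun y s =>
    {Z | ‖contract Z w‖ ≤ M ∧ |inner ℝ y (contract Z w)| ≤ h ∧ (1 + M) * h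
      < |inner ℝ y (tensorMap Z (Function.update (fun _ => w) s (contract Z w)))|}
  have hsub : {Z | ‖tensorMap Z‖ ≤ M} \ noiseGood v a w h M
      ⊆ (E0 a ∪ E0 w ∪ (⋃ j, E0 (v j)) ∪ E3) ∪ ((⋃ s, E4 a s) ∪ (⋃ s, E4 w s)) := by
    rintro Z ⟨hZ, hbad⟩
    by_contra hcon
    simp only [Set.mem_union, Set.mem_iUnion, not_or, not_exists] at hcon
    obtain ⟨⟨⟨⟨h0, h1⟩, h2⟩, h3⟩, h4, h5⟩ := hcon
    have hZw : ‖contract Z w‖ ≤ M := (norm_contract_le Z hw.le).trans hZ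
    have h0' : |inner ℝ a (contract Z w)| ≤ h := not_lt.1 h0
    have h1' : |inner ℝ w (contract Z w)| ≤ h := not_lt.1 h1
    exact hbad ⟨h0', fun j => not_lt.1 (h2 j), not_lt.1 h3,
      fun s => not_lt.1 fun hs => h4 s ⟨hZw, h0', hs⟩,
      fun s => not_lt.1 fun hs => h5 s ⟨hZw, h1', hs⟩⟩
  set t : ℝ := (n * h ^ 2)⁻¹ with ht
  have ht0 : 0 ≤ t := by positivity
  have b0 : ∀ y : Vec n, ‖y‖ ≤ 1 → noise k n (E0 y) ≤ ENNReal.ofReal t := fun y hy =>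
    noise_inner_le y (fun _ => w) hy (fun _ => hw.le) hh
  have b3 : noise k n E3 ≤ ENNReal.ofReal (varSq * t) := by
    rw [ht, ← div_eq_mul_inv]
    exact noise_sq_norm_contract_le hn w hw hh
  have b4 : ∀ y : Vec n, ‖y‖ ≤ 1 → ∀ s, noise k n (E4 y s) ≤ ENNReal.ofReal (M ^ 2 * t) := by
    intro y hy s
    rw [ht, ← div_eq_mul_inv]
    exact noise_second_order_le y w hy hw s hh
  have b5 : ∀ y : Vec n, ‖y‖ ≤ 1 → noise k n (⋃ s, E4 y s) ≤ ENNReal.ofReal (k * (M ^ 2 * t)) := by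
    intro y hy
    refine (measure_iUnion_fintype_le _ _).trans ((Finset.sum_le_sum fun s _ => b4 y hy s).trans ?_)
    rw [Finset.sum_const, Finset.card_univ, Fintype.card_fin, nsmul_eq_mul,
      ENNReal.ofReal_mul (p := (k : ℝ)) k.cast_nonneg, ENNReal.ofReal_natCast]
    gcongr
    exact Nat.sub_le _ _
  have b2 : noise k n (⋃ j, E0 (v j)) ≤ ENNReal.ofReal (r * t) := by
    refine (measure_iUnion_fintype_le _ _).trans
      ((Finset.sum_le_sum fun j _ => b0 (v j) (hv j).le).trans ?_)
    rw [Finset.sum_const, Finset.card_univ, Fintype.card_fin, nsmul_eq_mul,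
      ENNReal.ofReal_mul (by positivity), ENNReal.ofReal_natCast]
  have hvar : 0 ≤ varSq := variance_nonneg _ _
  calc _ ≤ (ENNReal.ofReal t + ENNReal.ofReal t + ENNReal.ofReal (r * t)
        + ENNReal.ofReal (varSq * t))
        + (ENNReal.ofReal (k * (M ^ 2 * t)) + ENNReal.ofReal (k * (M ^ 2 * t))) := by
        refine (measure_mono hsub).trans ((measure_union_le _ _).trans (add_le_add ?_ ?_))
        · refine (measure_union_le _ _).trans (add_le_add ?_ b3)
          refine (measure_union_le _ _).trans (add_le_add ?_ b2)
          exact (measure_union_le _ _).trans (add_le_add (b0 a ha) (b0 w hw.le))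
        · exact (measure_union_le _ _).trans (add_le_add (b5 a ha) (b5 w hw.le))
    _ = _ := by
        rw [← ENNReal.ofReal_add (by positivity) (by positivity),
          ← ENNReal.ofReal_add (by positivity) (by positivity),
          ← ENNReal.ofReal_add (by positivity) (by positivity),
          ← ENNReal.ofReal_add (by positivity) (by positivity),
          ← ENNReal.ofReal_add (by positivity) (by positivity), noiseConst]
        congr 1
        ring

/-- The event on which power iteration can be followed to the spike, and expanded around
`± v i`. -/
def goodEvent (k : ℕ) {n r : ℕ} (δ ε : ℝ) (β : Fin r → ℝ) (v : Fin r → Vec n) (a : Vec n)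
    (i : Fin r) : Set (Sample k n) :=
  {ω | (ω.1 : Vec n) ∈ initGood k δ β v ∧ ‖tensorMap ω.2‖ ≤ injBound k ∧
    ω.2 ∉ noiseExceeds v (∑ j, β j • tpow k (v j)) ((n : ℝ) ^ (-(1 / 2) + ε / 4))
      (escapeTime ε) ω.1 ∧
    (∀ j, |inner ℝ (v j) (contract ω.2 (v j))| ≤ Real.log n / Real.sqrt n) ∧
    ∀ σ : ℝ, |σ| = 1 → ω.2 ∈ noiseGood v a (σ • v i) (Real.log n / Real.sqrt n) (injBound k)}

/-- The failure probability due to the noise. -/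
noncomputable def noiseFail (k r : ℕ) (ε : ℝ) (n : ℕ) : ℝ :=
  2 * Real.exp (-n) + escapeTime ε * (r * (escapeTime ε ^ 2 * ((n : ℝ) ^ (ε / 2))⁻¹))
    + (r + 2 * noiseConst k r (injBound k)) * (Real.log n ^ 2)⁻¹

lemma tendsto_noiseFail (k r : ℕ) {ε : ℝ} (hε : 0 < ε) :
    Tendsto (noiseFail k r ε) atTop (𝓝 0) := by
  have h1 : Tendsto (fun n : ℕ => 2 * Real.exp (-(n : ℝ))) atTop (𝓝 (2 * 0)) :=
    ((Real.tendsto_exp_atBot.comp tendsto_neg_atTop_atBot).comp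
      tendsto_natCast_atTop_atTop).const_mul 2
  have h2 : Tendsto (fun n : ℕ => (escapeTime ε : ℝ) * (r * (escapeTime ε ^ 2
      * ((n : ℝ) ^ (ε / 2))⁻¹))) atTop (𝓝 (escapeTime ε * (r * (escapeTime ε ^ 2 * 0)))) :=
    (((tendsto_inv_atTop_zero.comp ((tendsto_rpow_atTop (by positivity : 0 < ε / 2)).comp
      tendsto_natCast_atTop_atTop)).const_mul _).const_mul _).const_mul _
  have h3 : Tendsto (fun n : ℕ => (r + 2 * noiseConst k r (injBound k)) * (Real.log n ^ 2)⁻¹)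
      atTop (𝓝 ((r + 2 * noiseConst k r (injBound k)) * 0)) :=
    (tendsto_inv_atTop_zero.comp ((tendsto_pow_atTop two_ne_zero).comp
      (Real.tendsto_log_atTop.comp tendsto_natCast_atTop_atTop))).const_mul _
  have h := (h1.add h2).add h3
  simp only [mul_zero, add_zero] at h
  exact h

/-- A union bound over the start and the noise. The adaptive noise bound holds for each fixed start
`u`, and integrates over `u` by independence. -/
lemma law_goodEvent_compl_le (hk : 2 ≤ k) (hn : 2 ≤ n) {δ ε : ℝ} (hδ : 0 < δ) (hδ2 : δ ≤ 1 / 2)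
    {β : Fin r → ℝ} (hβ : ∀ j, β j ≠ 0) {v : Fin r → Vec n} (hv : Orthonormal ℝ v) {a : Vec n}
    (ha : ‖a‖ ≤ 1) (i : Fin r) :
    law k n (goodEvent k δ ε β v a i)ᶜ
      ≤ ENNReal.ofReal ((2 * r ^ 2 + 2 * r + 1) * δ + noiseFail k r ε n) := by
  have hn0 : 0 < n := by omega
  have hn0' : (0 : ℝ) < n := by exact_mod_cast hn0
  have := isProbabilityMeasure_unifSphere hn0
  have hlog : 0 < Real.log n := Real.log_pos (by exact_mod_cast (by omega : 1 < n))
  set M := injBound k with hM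
  set h := Real.log n / Real.sqrt n with hh
  have hh0 : 0 < h := by positivity
  have hnh : n * h ^ 2 = Real.log n ^ 2 := by
    rw [hh, div_pow, Real.sq_sqrt hn0'.le]
    field_simp
  set S : Tensor k n := ∑ j, β j • tpow k (v j)
  set T := escapeTime ε with hT
  have hT0 : (0 : ℝ) < T := by
    rw [hT, escapeTime]
    positivity
  set η := (n : ℝ) ^ (-(1 / 2) + ε / 4) with hη
  have hη0 : 0 < η := by positivity
  set U : Set (Metric.sphere (0 : Vec n) 1) := {u | (u : Vec n) ∉ initGood k δ β v}
  set N1 : Set (Tensor k n) := {Z | M < ‖tensorMap Z‖}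
  set N2 : Set (Tensor k n) := ⋃ j, {Z | h < |inner ℝ (v j) (tensorMap Z fun _ => v j)|}
  set N3 : Vec n → Set (Tensor k n) := fun w => {Z | ‖tensorMap Z‖ ≤ M} \ noiseGood v a w h M
  set W : Set (Sample k n) := {ω | ω.2 ∈ noiseExceeds v S η T ω.1}
  have hsub : (goodEvent k δ ε β v a i)ᶜ
      ⊆ Prod.fst ⁻¹' U ∪ (Prod.snd ⁻¹' N1 ∪ W ∪ Prod.snd ⁻¹' (N2 ∪ (N3 (v i) ∪ N3 (-v i)))) := by
    intro ω hω
    by_contra hcon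
    simp only [Set.mem_union, Set.mem_preimage, not_or] at hcon
    obtain ⟨h1, ⟨h2, h3⟩, h4, h5, h6⟩ := hcon
    have h2' : ‖tensorMap ω.2‖ ≤ M := not_lt.1 h2
    refine hω ⟨not_not.1 h1, h2', h3, fun j => ?_, fun σ hσ => ?_⟩
    · by_contra hj
      exact h4 (Set.mem_iUnion.2 ⟨j, not_le.1 hj⟩)
    · rcases (abs_eq zero_le_one).1 hσ with rfl | rfl
      · rw [one_smul]
        exact not_not.1 fun hZ => h5 ⟨h2', hZ⟩
      · rw [neg_one_smul]
        exact not_not.1 fun hZ => h6 ⟨h2', hZ⟩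
  have hfst : ∀ A : Set (Metric.sphere (0 : Vec n) 1),
      law k n (Prod.fst ⁻¹' A) = unifSphere n A := fun A => by
    rw [law, ← Set.prod_univ, Measure.prod_prod, measure_univ, mul_one]
  have hsnd : ∀ A : Set (Tensor k n), law k n (Prod.snd ⁻¹' A) = noise k n A := fun A => by
    rw [law, ← Set.univ_prod, Measure.prod_prod, measure_univ, one_mul]
  have hW : law k n W ≤ ENNReal.ofReal (T * (r * (T ^ 2 * ((n : ℝ) ^ (ε / 2))⁻¹))) := by
    have hWm : MeasurableSet W := by
      have h1 : Measurable fun ω : Sample k n => ((ω.1 : Vec n), ω.2) :=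
        (measurable_subtype_coe.comp measurable_fst).prodMk measurable_snd
      exact h1 (measurableSet_noiseExceeds v S η T)
    rw [law, Measure.prod_apply hWm]
    have h1 : ∀ u : Metric.sphere (0 : Vec n) 1, noise k n (Prod.mk u ⁻¹' W)
        ≤ ENNReal.ofReal (T * (r * (T ^ 2 * ((n : ℝ) ^ (ε / 2))⁻¹))) := by
      intro u
      -- An allowance of `η / T` per step accumulates to `η` over the `T` steps.
      have h2 := noise_exceeds_le (fun j => hv.1 j) S (h := η / T) (by positivity) T (u := u)
        (by simp)
      rw [mul_div_cancel₀ _ hT0.ne'] at h2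
      refine h2.trans (le_of_eq ?_)
      rw [ENNReal.ofReal_mul (by positivity), ENNReal.ofReal_mul (by positivity),
        ENNReal.ofReal_natCast, ENNReal.ofReal_natCast]
      congr 3
      have h3 : η ^ 2 = (n : ℝ)⁻¹ * (n : ℝ) ^ (ε / 2) := by
        rw [hη, ← Real.rpow_natCast, ← Real.rpow_mul hn0'.le, ← Real.rpow_neg_one,
          ← Real.rpow_add hn0']
        congr 1
        push_cast
        ring
      rw [div_pow, h3]
      have : (n : ℝ) ^ (ε / 2) ≠ 0 := by positivity
      field_simp
    refine (lintegral_mono h1).trans ?_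
    rw [lintegral_const, measure_univ, mul_one]
  have hN1 : noise k n N1 ≤ ENNReal.ofReal (2 * Real.exp (-n)) := noise_injNorm_le (by omega) hn0
  have hN2 : noise k n N2 ≤ ENNReal.ofReal (r * (Real.log n ^ 2)⁻¹) := by
    refine (measure_iUnion_fintype_le _ _).trans ((Finset.sum_le_sum fun j _ =>
      noise_inner_le (v j) (fun _ => v j) (hv.1 j).le (fun _ => (hv.1 j).le) hh0).trans ?_)
    rw [hnh, Finset.sum_const, Finset.card_univ, Fintype.card_fin, nsmul_eq_mul,
      ENNReal.ofReal_mul (by positivity), ENNReal.ofReal_natCast]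
  have hN3 : ∀ w : Vec n, ‖w‖ = 1 →
      noise k n (N3 w) ≤ ENNReal.ofReal (noiseConst k r M * (Real.log n ^ 2)⁻¹) := by
    intro w hw
    rw [← hnh]
    exact noise_diff_noiseGood_le hn0 (fun j => hv.1 j) ha hw hh0 M
  have hc : 0 ≤ noiseConst k r M := by
    have hvar : 0 ≤ varSq := variance_nonneg _ _
    rw [noiseConst]
    positivity
  have hU : unifSphere n U ≤ ENNReal.ofReal ((2 * r ^ 2 + 2 * r + 1) * δ) :=
    unifSphere_initGood_compl hn0 k hδ hδ2 hβ hv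
  calc _ ≤ ENNReal.ofReal ((2 * r ^ 2 + 2 * r + 1) * δ)
        + (ENNReal.ofReal (2 * Real.exp (-n))
          + ENNReal.ofReal (T * (r * (T ^ 2 * ((n : ℝ) ^ (ε / 2))⁻¹)))
          + (ENNReal.ofReal (r * (Real.log n ^ 2)⁻¹)
            + (ENNReal.ofReal (noiseConst k r M * (Real.log n ^ 2)⁻¹)
              + ENNReal.ofReal (noiseConst k r M * (Real.log n ^ 2)⁻¹)))) := by
        refine (measure_mono hsub).trans ((measure_union_le _ _).trans (add_le_add ?_ ?_))
        · rw [hfst]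
          exact hU
        refine (measure_union_le _ _).trans (add_le_add ?_ ?_)
        · refine (measure_union_le _ _).trans (add_le_add ?_ hW)
          rw [hsnd]
          exact hN1
        · rw [hsnd]
          refine (measure_union_le _ _).trans (add_le_add hN2 ?_)
          refine (measure_union_le _ _).trans (add_le_add (hN3 _ (hv.1 i)) (hN3 _ ?_))
          rw [norm_neg, hv.1 i]
    _ = _ := by
        rw [← ENNReal.ofReal_add (by positivity) (by positivity),
          ← ENNReal.ofReal_add (by positivity) (by positivity),
          ← ENNReal.ofReal_add (by positivity) (by positivity),
          ← ENNReal.ofReal_add (by positivity) (by positivity),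
          ← ENNReal.ofReal_add (by positivity) (by positivity), noiseFail]
        congr 1
        ring

/-- Only monotonicity and subadditivity are used, so the convergence events need not be shown to be
measurable. -/
lemma abs_measureReal_sub_le {Ω : Type*} [MeasurableSpace Ω] {μ : Measure Ω}
    [IsProbabilityMeasure μ] {F A G : Set Ω} {c : ℝ} (hc : 0 ≤ c) (hAF : A ∩ G ⊆ F)
    (hFA : F ∩ G ⊆ A) (hG : μ Gᶜ ≤ ENNReal.ofReal c) : |μ.real F - μ.real A| ≤ c := by
  have hG' : μ.real Gᶜ ≤ c := ENNReal.toReal_le_of_le_ofReal hc hG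
  have key : ∀ A B : Set Ω, A ∩ G ⊆ B → μ.real A ≤ μ.real B + μ.real Gᶜ := by
    intro A B hAB
    refine (measureReal_mono (s₂ := B ∪ Gᶜ) ?_).trans (measureReal_union_le _ _)
    intro x hx
    by_cases hxG : x ∈ G
    · exact Or.inl (hAB ⟨hx, hxG⟩)
    · exact Or.inr hxG
  rw [abs_le]
  have h1 := key A F hAF
  have h2 := key F A hFA
  constructor <;> linarith

/-- The event that `i` attains the maximum of `|βⱼ ⟨u, vⱼ⟩^{k-2}|`. -/
def argmaxSet (k : ℕ) {n r : ℕ} (β : Fin r → ℝ) (v : Fin r → Vec n) (i : Fin r) :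
    Set (Sample k n) :=
  {ω | ∀ j, |β j * inner ℝ (ω.1 : Vec n) (v j) ^ (k - 2)|
    ≤ |β i * inner ℝ (ω.1 : Vec n) (v i) ^ (k - 2)|}

lemma law_fst (A : Set (Metric.sphere (0 : Vec n) 1)) :
    (law k n).real (Prod.fst ⁻¹' A) = (unifSphere n).real A := by
  rw [measureReal_def, measureReal_def, law, ← Set.prod_univ, Measure.prod_prod, measure_univ,
    mul_one]

lemma isProbabilityMeasure_law (hn : 0 < n) : IsProbabilityMeasure (law k n) := by
  have := isProbabilityMeasure_unifSphere hn
  rw [law]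
  infer_instance

lemma law_argmaxSet (β : Fin r → ℝ) (v : Fin r → Vec n) (i : Fin r) :
    (law k n).real (argmaxSet k β v i) = argmaxProb k β v i :=
  law_fst (k := k) {u : Metric.sphere (0 : Vec n) 1 |
    ∀ j, |β j * inner ℝ (u : Vec n) (v j) ^ (k - 2)|
      ≤ |β i * inner ℝ (u : Vec n) (v i) ^ (k - 2)|}

lemma law_argmaxSet_pos (hn : 0 < n) (β : Fin r → ℝ) {v : Fin r → Vec n} (hv : Orthonormal ℝ v)
    (i : Fin r) :
    (law k n).real (argmaxSet k β v i ∩ {ω | 0 < inner ℝ (ω.1 : Vec n) (v i)})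
        = argmaxProb k β v i / 2 ∧
      (law k n).real (argmaxSet k β v i ∩ {ω | inner ℝ (ω.1 : Vec n) (v i) < 0})
        = argmaxProb k β v i / 2 := by
  have hm : Measurable fun x : Fin r → ℝ => x i := measurable_pi_apply i
  have h := gpi_argmaxCone_pos k β i
  rw [← argmaxProb_eq hn k β hv i] at h
  refine ⟨Eq.trans ?_ h.1, Eq.trans ?_ h.2⟩
  · rw [measureReal_def (gpi (Fin r) 1), ← unifSphere_coord_cone hn hv
      ((measurableSet_argmaxCone k β i).inter (measurableSet_lt measurable_const hm))
      (fun c hc x => ?_)]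
    · exact law_fst (k := k) {u : Metric.sphere (0 : Vec n) 1 |
        (∀ j, |β j * inner ℝ (u : Vec n) (v j) ^ (k - 2)|
          ≤ |β i * inner ℝ (u : Vec n) (v i) ^ (k - 2)|) ∧ 0 < inner ℝ (u : Vec n) (v i)}
    · refine and_congr (smul_mem_argmaxCone k β i c hc.ne' x) ?_
      exact mul_pos_iff_of_pos_left hc
  · rw [measureReal_def (gpi (Fin r) 1), ← unifSphere_coord_cone hn hv
      ((measurableSet_argmaxCone k β i).inter (measurableSet_lt hm measurable_const))
      (fun c hc x => ?_)]
    · exact law_fst (k := k) {u : Metric.sphere (0 : Vec n) 1 |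
        (∀ j, |β j * inner ℝ (u : Vec n) (v j) ^ (k - 2)|
          ≤ |β i * inner ℝ (u : Vec n) (v i) ^ (k - 2)|) ∧ inner ℝ (u : Vec n) (v i) < 0}
    · refine and_congr (smul_mem_argmaxCone k β i c hc.ne' x) ?_
      exact smul_neg_iff_of_pos_left (α := ℝ) (β := ℝ) hc

end GoodEvent

/-! ### From following a spike to probabilities -/

section Tracking

variable {k n r : ℕ}

/-- Outside an event of probability at most `c`, power iteration follows the spikes that attain
the maximum of `|βⱼ ⟨u, vⱼ⟩^{k-2}|`. -/
structure Tracking (G : Set (Sample k n)) (β : Fin r → ℝ) (v : Fin r → Vec n) (d c : ℝ) :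
    Prop where
  compl_le : law k n Gᶜ ≤ ENNReal.ofReal c
  follows : ∀ ω ∈ G, ∀ j, ω ∈ argmaxSet k β v j →
    Follows (spiked k β v ω.2) ω.1 d (β j) (v j)

namespace Tracking

variable {G : Set (Sample k n)} {β : Fin r → ℝ} {v : Fin r → Vec n} {d c : ℝ}

/-- Some spike attains the maximum and is followed on `G`; being close to the line of `v i` as well
forces it to be `v i`, with the same signs. This is the converse inclusion, needed for the upper
bounds on probabilities. -/
lemma mem_argmaxSet (H : Tracking G β v d c) (hv : Orthonormal ℝ v) (hd : d ≤ 1 / 2)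
    {ω : Sample k n} (hω : ω ∈ G) {i : Fin r} {τ : ℕ → ℝ} (hτ : ∀ t, |τ t| = 1)
    (hnear : ∀ᶠ t in atTop, ‖powerIter (spiked k β v ω.2) ω.1 t - τ t • v i‖ ≤ d) :
    ω ∈ argmaxSet k β v i ∧
      ∀ᶠ t in atTop, dirSign (spiked k β v ω.2) ω.1 (v i) t = τ t := by
  have : Nonempty (Fin r) := ⟨i⟩
  obtain ⟨j, hj⟩ := Finite.exists_max fun j => |β j * inner ℝ (ω.1 : Vec n) (v j) ^ (k - 2)|
  have hF := H.follows ω hω j hj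
  have hboth : ∀ᶠ t in atTop, j = i ∧ dirSign (spiked k β v ω.2) ω.1 (v j) t = τ t := by
    filter_upwards [hF.near, hnear] with t h1 h2
    exact eq_of_near_both hv (hF.abs_sign t) (hτ t) hd h1.2 h2
  obtain ⟨t, rfl, -⟩ := hboth.exists
  exact ⟨hj, hboth.mono fun t ht => ht.2⟩

/-- The sign sequence `τ` covers convergence and alternation at once. -/
lemma abs_sub_argmaxProb_le (H : Tracking G β v d c) (hn : 0 < n) (hc : 0 ≤ c)
    (hv : Orthonormal ℝ v) (hd : d ≤ 1 / 2) {i : Fin r} {F : Set (Sample k n)}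
    (hF : ∀ ω ∈ F, ∃ τ : ℕ → ℝ, (∀ t, |τ t| = 1) ∧
      ∀ᶠ t in atTop, ‖powerIter (spiked k β v ω.2) ω.1 t - τ t • v i‖ ≤ d)
    (hGF : ∀ ω ∈ G, ω ∈ argmaxSet k β v i → ω ∈ F) :
    |(law k n).real F - argmaxProb k β v i| ≤ c := by
  have := isProbabilityMeasure_law (k := k) hn
  rw [← law_argmaxSet]
  refine abs_measureReal_sub_le hc (fun ω hω => hGF ω hω.2 hω.1) ?_ H.compl_le
  rintro ω ⟨h1, h2⟩
  obtain ⟨τ, hτ, hnear⟩ := hF ω h1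
  exact (H.mem_argmaxSet hv hd h2 hτ hnear).1

lemma odd_pos (H : Tracking G β v d c) (hn : 0 < n) (hc : 0 ≤ c) (hv : Orthonormal ℝ v)
    (hd : d ≤ 1 / 2) {i : Fin r} {F : Set (Sample k n)} (hF : F ⊆ convEvent k β v d (β i) (v i))
    (hGF : ∀ ω ∈ G, ω ∈ argmaxSet k β v i → ω ∈ F) :
    |(law k n).real F - argmaxProb k β v i| ≤ c := by
  refine H.abs_sub_argmaxProb_le hn hc hv hd (fun ω hω => ⟨fun _ => 1, fun _ => abs_one, ?_⟩) hGF
  filter_upwards [hF hω] with t ht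
  rw [one_smul]
  exact ht.2

lemma odd_neg (H : Tracking G β v d c) (hn : 0 < n) (hc : 0 ≤ c) (hv : Orthonormal ℝ v)
    (hd : d ≤ 1 / 2) {i : Fin r} {F : Set (Sample k n)}
    (hF : F ⊆ convEvent k β v d (-β i) (-v i))
    (hGF : ∀ ω ∈ G, ω ∈ argmaxSet k β v i → ω ∈ F) :
    |(law k n).real F - argmaxProb k β v i| ≤ c := by
  refine H.abs_sub_argmaxProb_le hn hc hv hd
    (fun ω hω => ⟨fun _ => -1, fun _ => by simp, ?_⟩) hGF
  filter_upwards [hF hω] with t ht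
  rw [neg_one_smul]
  exact ht.2

lemma even_neg (H : Tracking G β v d c) (hn : 0 < n) (hc : 0 ≤ c) (hv : Orthonormal ℝ v)
    (hd : d ≤ 1 / 2) {i : Fin r} {F : Set (Sample k n)}
    (hF : F ⊆ altEvent k β v d (β i) (v i))
    (hGF : ∀ ω ∈ G, ω ∈ argmaxSet k β v i → ω ∈ F) :
    |(law k n).real F - argmaxProb k β v i| ≤ c := by
  refine H.abs_sub_argmaxProb_le hn hc hv hd (fun ω hω => ?_) hGF
  rcases hF hω with h | h
  · refine ⟨fun t => (-1) ^ t, fun t => by simp, ?_⟩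
    filter_upwards [h] with t ht
    exact ht.2
  · refine ⟨fun t => -(-1) ^ t, fun t => by simp, ?_⟩
    filter_upwards [h] with t ht
    rw [neg_smul, ← smul_neg]
    exact ht.2

/-- For even `k` and `β i > 0` the sign never changes, so the limit is decided by the side of the
start. By the reflection symmetry each side carries half of `p_i`. -/
lemma even_pos (H : Tracking G β v d c) (hk : Even k) (hk2 : 2 ≤ k) (hn : 0 < n) (hc : 0 ≤ c)
    (hv : Orthonormal ℝ v) (hd : d ≤ 1 / 2) {i : Fin r} (hb : 0 < β i) {σ : ℝ}
    (hσ : σ = 1 ∨ σ = -1) {F : Set (Sample k n)} (hF : F ⊆ convEvent k β v d (β i) (σ • v i))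
    (hGF : ∀ ω ∈ G, ω ∈ argmaxSet k β v i →
      dirSign (spiked k β v ω.2) ω.1 (v i) 0 = σ → ω ∈ F) :
    |(law k n).real F - argmaxProb k β v i / 2| ≤ c := by
  have := isProbabilityMeasure_law (k := k) hn
  have hA : (law k n).real (argmaxSet k β v i ∩ {ω | 0 < σ * inner ℝ (ω.1 : Vec n) (v i)})
      = argmaxProb k β v i / 2 := by
    rcases hσ with rfl | rfl
    · simpa only [one_mul] using (law_argmaxSet_pos (k := k) hn β hv i).1
    · simpa only [neg_one_mul, neg_pos] using (law_argmaxSet_pos (k := k) hn β hv i).2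
  have hpos : ∀ ω : Sample k n, dirSign (spiked k β v ω.2) ω.1 (v i) 0 = σ ↔
      0 < σ * inner ℝ (ω.1 : Vec n) (v i) := by
    intro ω
    change ((SignType.sign (inner ℝ (ω.1 : Vec n) (v i) : ℝ) : SignType) : ℝ) = σ ↔ _
    rcases lt_trichotomy (inner ℝ (ω.1 : Vec n) (v i) : ℝ) 0 with h | h | h <;>
      rcases hσ with rfl | rfl
    · rw [sign_neg h]
      norm_num
      exact h.le
    · rw [sign_neg h]
      simpa using h
    · simp [h]
    · simp [h]
    · rw [sign_pos h]
      simpa using h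
    · rw [sign_pos h]
      norm_num
      exact h.le
  have hσ1 : |σ| = 1 := by rcases hσ with rfl | rfl <;> simp
  rw [← hA]
  refine abs_measureReal_sub_le hc ?_ ?_ H.compl_le
  · rintro ω ⟨⟨h1, h2⟩, h3⟩
    exact hGF ω h3 h1 ((hpos ω).2 h2)
  · rintro ω ⟨h1, h2⟩
    obtain ⟨h3, h4⟩ := H.mem_argmaxSet hv hd h2 (τ := fun _ => σ) (fun _ => hσ1)
      ((hF h1).mono fun t ht => ht.2)
    refine ⟨h3, (hpos ω).1 ?_⟩
    obtain ⟨t, ht⟩ := h4.exists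
    rw [(H.follows ω h2 i h3).sign_even hk hk2 t, sign_pos hb] at ht
    simpa using ht

end Tracking

end Tracking

/-! ### Precision, and the dynamics on the good event -/

section Dynamics

variable {k n r : ℕ}

/-- The precision to which power iteration recovers the spikes. -/
noncomputable def precision (k r : ℕ) (C ε : ℝ) (n : ℕ) : ℝ :=
  ((k + r) * C ^ 2 + 2 * k * injBound k * C + 2 * C) * ((n : ℝ) ^ ε)⁻¹
    + Real.log n / Real.sqrt n

lemma tendsto_log_div_sqrt : Tendsto (fun n : ℕ => Real.log n / Real.sqrt n) atTop (𝓝 0) := by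
  have h := (isLittleO_log_rpow_atTop (by norm_num : (0 : ℝ) < 1 / 2)).tendsto_div_nhds_zero.comp
    tendsto_natCast_atTop_atTop
  refine h.congr fun n => ?_
  simp [Real.sqrt_eq_rpow]

lemma tendsto_precision (k r : ℕ) (C : ℝ) {ε : ℝ} (hε : 0 < ε) :
    Tendsto (precision k r C ε) atTop (𝓝 0) := by
  have h1 : Tendsto (fun n : ℕ => ((k + r) * C ^ 2 + 2 * k * injBound k * C + 2 * C)
      * ((n : ℝ) ^ ε)⁻¹) atTop (𝓝 (((k + r) * C ^ 2 + 2 * k * injBound k * C + 2 * C) * 0)) :=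
    (tendsto_inv_atTop_zero.comp ((tendsto_rpow_atTop hε).comp
      tendsto_natCast_atTop_atTop)).const_mul _
  have h := h1.add tendsto_log_div_sqrt
  rw [mul_zero, add_zero] at h
  exact h

lemma one_le_log_of_three_le (hn : 3 ≤ n) : 1 ≤ Real.log n := by
  have hn' : (3 : ℝ) ≤ n := by exact_mod_cast hn
  rw [Real.le_log_iff_exp_le (by linarith)]
  exact Real.exp_one_lt_three.le.trans hn'

/-- Allows `T` to be written as `t + 2`, the last two steps being those of the expansion. -/
lemma two_le_of_timeBound_le {ε B : ℝ} (hk : 3 ≤ k) (hn : 3 ≤ n) (hε : 0 < ε)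
    (hB : (n : ℝ) ^ (((k : ℝ) - 2) / 2 + ε) ≤ B) {T : ℕ} (hT : timeBound k n ε B ≤ T) :
    2 ≤ T := by
  have hk' : (3 : ℝ) ≤ k := by exact_mod_cast hk
  have hn' : (3 : ℝ) ≤ n := by exact_mod_cast hn
  have hsB : Real.sqrt n ≤ B := by
    rw [Real.sqrt_eq_rpow]
    exact (Real.rpow_le_rpow_of_exponent_le (by linarith) (by linarith)).trans hB
  have h1 : (n : ℝ) ≤ Real.sqrt n * B := by
    calc (n : ℝ) = Real.sqrt n * Real.sqrt n := (Real.mul_self_sqrt (by linarith)).symm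
      _ ≤ _ := by gcongr
  have h2 : 1 ≤ Real.log (Real.sqrt n * B) :=
    (one_le_log_of_three_le hn).trans (Real.log_le_log (by linarith) h1)
  have h3 : 0 ≤ Real.log (Real.log (Real.sqrt n * B)) / Real.log ((k : ℝ) - 1) :=
    div_nonneg (Real.log_nonneg h2) (Real.log_nonneg (by linarith))
  have h4 : 0 ≤ 3 / (2 * ε) := by positivity
  have h5 := timeBound_ge hk (by omega) hε hB
  have : (2 : ℝ) ≤ T := by linarith
  exact_mod_cast this

end Dynamics

/-- On the good event, power iteration follows the selected spike, and the estimators can be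
expanded. -/
lemma follows_and_expansion {k r : ℕ} (hk : 2 ≤ k) (hr : 0 < r) {κ δ : ℝ} (hκ : 1 ≤ κ)
    (hδ : 0 < δ) (hδ2 : δ ≤ 1 / 2) (hκδ : δ ^ 2 ≤ 1 / κ) :
    ∃ ε₀ : ℝ, 0 < ε₀ ∧ ∃ C K : ℝ, ∀ ε : ℝ, 0 < ε → ε ≤ ε₀ → ∀ᶠ n : ℕ in atTop,
    ∀ (v : Fin r → Vec n) (β : Fin r → ℝ), Orthonormal ℝ v → (∀ j, β j ≠ 0) →
      (∀ j, |β j| ≤ |β ⟨0, hr⟩|) → (n : ℝ) ^ (((k : ℝ) - 2) / 2 + ε) ≤ |β ⟨0, hr⟩| →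
      (k = 2 → ∀ j, j ≠ ⟨0, hr⟩ → |β j| ≤ (1 - 1 / κ) * |β ⟨0, hr⟩|) →
    ∀ (a : Vec n), ‖a‖ ≤ 1 → ∀ i, ∀ ω ∈ goodEvent k δ ε β v a i,
      (∀ j, ω ∈ argmaxSet k β v j →
        Follows (spiked k β v ω.2) ω.1 (precision k r C ε n) (β j) (v j)) ∧
      (3 ≤ k → ω ∈ argmaxSet k β v i → ∀ T : ℕ, timeBound k n ε |β ⟨0, hr⟩| ≤ T →
        Expansion (spiked k β v ω.2) ω.2 ω.1 a |β ⟨0, hr⟩| K T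
          (β i * dirSign (spiked k β v ω.2) ω.1 (v i) T ^ k)
          (dirSign (spiked k β v ω.2) ω.1 (v i) T • v i)) := by
  obtain ⟨ε₀, hε₀, C, hC, hdyn⟩ := tanRatio_powerIter_le hk hr hδ hδ2
  have hM0 : 0 ≤ injBound k := by
    rw [injBound]
    positivity
  set L := C + 2 ^ k * k * (1 + injBound k) with hL
  have hL0 : 0 ≤ (2 : ℝ) ^ k * k * (1 + injBound k) := by positivity
  have hCL : C ≤ L := by linarith
  refine ⟨ε₀, hε₀, C, expConst k r L, fun ε hε hεε₀ => ?_⟩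
  have hlarge : ∀ᶠ n : ℕ in atTop, 6 * stepConst L ^ 3 ≤ (n : ℝ) ^ ε :=
    ((tendsto_rpow_atTop hε).comp tendsto_natCast_atTop_atTop).eventually_ge_atTop _
  filter_upwards [hdyn ε hε hεε₀, hlarge, eventually_ge_atTop 3,
    tendsto_log_div_sqrt.eventually (eventually_le_nhds zero_lt_one)]
    with n hdyn hlarge hn3 hlog1 v β hv hβ hβ0 hB hgap a ha i ω hω
  obtain ⟨hinit, hinj, hnex, hdiag, hgood⟩ := hω
  set B := |β ⟨0, hr⟩| with hBdef
  have hn1 : (1 : ℝ) ≤ n := by exact_mod_cast (by omega : 1 ≤ n)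
  have hk2 : (2 : ℝ) ≤ k := by exact_mod_cast hk
  have hnB : (n : ℝ) ^ ε ≤ B :=
    (Real.rpow_le_rpow_of_exponent_le hn1 (by linarith)).trans hB
  have hn0 : 0 < (n : ℝ) ^ ε := by positivity
  have hB0 : 0 < B := hn0.trans_le hnB
  have hu : ‖(ω.1 : Vec n)‖ = 1 := by simp
  have hnoise : ∀ t < escapeTime ε, ∀ j,
      |inner ℝ (v j) (contract ω.2 (powerIter (spiked k β v ω.2) ω.1 t))|
        ≤ (n : ℝ) ^ (-(1 / 2) + ε / 4) := by
    intro t ht j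
    by_contra hcon
    exact hnex ⟨t, ht, j, not_le.1 hcon⟩
  -- For `k = 2` the maximum is that of `|β j|` itself, so only the first spike can be selected, and
  -- `δ² ≤ 1 / κ` converts the assumed gap.
  have hgap' : ∀ j, ω ∈ argmaxSet k β v j → k = 2 → ∀ l, l ≠ j → |β l| ≤ (1 - δ ^ 2) * |β j| := by
    intro j hj hk' l hl
    have hj0 : j = ⟨0, hr⟩ := by
      by_contra hne
      have h1 := hgap hk' j hne
      have h2 := hj ⟨0, hr⟩
      have hk0 : k - 2 = 0 := by omega
      rw [hk0, pow_zero, pow_zero, mul_one, mul_one, ← hBdef] at h2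
      have h3 : 0 < 1 / κ * B := by positivity
      linarith
    rw [hj0] at hl ⊢
    refine (hgap hk' l hl).trans ?_
    gcongr
  have key : ∀ j, ω ∈ argmaxSet k β v j → _ := fun j hj =>
    hdyn v β B hv hβ hβ0 ⟨_, rfl⟩ hB j ω.1 ω.2 hu hinit hj (hgap' j hj) hinj hnoise
  refine ⟨fun j hj => ?_, fun hk3 hi T hT => ?_⟩
  · obtain ⟨hit, htan, -, -⟩ := key j hj
    refine follows_of_tanRatio hv hk hinj hβ0 hB0 (hdiag j) (zero_le_one.trans hC) hit htan ?_
    rw [precision]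
    gcongr
  · obtain ⟨hit, -, htan, hBi⟩ := key i hi
    have hk3' : (3 : ℝ) ≤ k := by exact_mod_cast hk3
    have hlog := one_le_log_of_three_le hn3
    have hsB : Real.sqrt n ≤ B := by
      rw [Real.sqrt_eq_rpow]
      exact (Real.rpow_le_rpow_of_exponent_le hn1 (by linarith)).trans hB
    have hs0 : 0 < Real.sqrt n := Real.sqrt_pos.2 (by linarith)
    have hhB : 1 ≤ Real.log n / Real.sqrt n * B := by
      rw [div_mul_eq_mul_div, le_div_iff₀ hs0, one_mul]
      exact hsB.trans (le_mul_of_one_le_left hB0.le hlog)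
    have hT2 : 2 ≤ T := two_le_of_timeBound_le hk3 hn3 hε hB hT
    obtain ⟨t, rfl⟩ := Nat.exists_eq_add_of_le' hT2
    have hσ : ∀ s, |dirSign (spiked k β v ω.2) ω.1 (v i) s| = 1 ∧
        0 < dirSign (spiked k β v ω.2) ω.1 (v i) s
          * inner ℝ (powerIter (spiked k β v ω.2) ω.1 s) (v i) := by
      intro s
      rcases lt_or_gt_of_ne (hit s).2.1 with h1 | h1
      · simp [dirSign, sign_neg h1, h1]
      · simp [dirSign, sign_pos h1, h1]
    refine expansion_of_tanRatio hv hk3 hinj (hσ _).1 (L := L) (by linarith) hβ0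
      (hBi.trans (by gcongr)) (hlarge.trans hnB) (by omega) hhB hlog1 ha (hgood _ (hσ _).1)
      (fun s hs => (htan hk3 s (hT.trans ?_)).trans (by gcongr)) (fun s => (hit s).2.1) (hσ _).2
      (hit _).1
    have hs' : (t : ℝ) ≤ s := by exact_mod_cast hs
    push_cast
    linarith

end SpikedTensor
-- The main theorem
open SpikedTensor in
theorem theorem2p6 (k r : ℕ) (hk : 2 ≤ k) (hr : 0 < r) :
    ∃ C : ℝ, ∀ κ : ℝ, 1 ≤ κ → ∃ ε₀ : ℝ, 0 < ε₀ ∧ ∀ ε : ℝ, 0 < ε → ε ≤ ε₀ →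
    ∃ (K : ℝ) (δ : ℕ → ℝ) (N : ℕ), Tendsto δ atTop (𝓝 0) ∧
    ∀ n : ℕ, N ≤ n → ∀ (v : Fin r → SpikedTensor.Vec n) (β : Fin r → ℝ),
      Orthonormal ℝ v →
      (∀ j, β j ≠ 0) →
      (∀ j, |β j| ≤ |β ⟨0, hr⟩|) →
      (n : ℝ) ^ (((k : ℝ) - 2) / 2 + ε) ≤ |β ⟨0, hr⟩| →
      (k = 2 → ∀ j, j ≠ ⟨0, hr⟩ → |β j| ≤ (1 - 1 / κ) * |β ⟨0, hr⟩|) →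
      ∀ i : Fin r,
      -- the explicit formula for `p_i`
      (3 ≤ k → SpikedTensor.argmaxProb k β v i = SpikedTensor.gaussProb k β i) ∧
      -- the behaviour of power iteration
      (Odd k → 0 < β i →
        |(SpikedTensor.law k n).real (SpikedTensor.convEvent k β v (δ n) (β i) (v i))
          - SpikedTensor.argmaxProb k β v i| ≤ C / Real.sqrt κ) ∧
      (Odd k → β i < 0 →
        |(SpikedTensor.law k n).real (SpikedTensor.convEvent k β v (δ n) (-β i) (-v i))
          - SpikedTensor.argmaxProb k β v i| ≤ C / Real.sqrt κ) ∧
      (Even k → 0 < β i →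
        |(SpikedTensor.law k n).real (SpikedTensor.convEvent k β v (δ n) (β i) (v i))
          - SpikedTensor.argmaxProb k β v i / 2| ≤ C / Real.sqrt κ ∧
        |(SpikedTensor.law k n).real (SpikedTensor.convEvent k β v (δ n) (β i) (-v i))
          - SpikedTensor.argmaxProb k β v i / 2| ≤ C / Real.sqrt κ) ∧
      (Even k → β i < 0 →
        |(SpikedTensor.law k n).real (SpikedTensor.altEvent k β v (δ n) (β i) (v i))
          - SpikedTensor.argmaxProb k β v i| ≤ C / Real.sqrt κ) ∧
      -- the law of `ξ = Z[w^{⊗(k-1)}]` at the limits `w = v i` and `w = -v i`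
      (∀ w, (w = v i ∨ w = -v i) →
        (SpikedTensor.noise k n).map (fun Z => WithLp.ofLp (SpikedTensor.contract Z w))
          = Measure.pi fun _ : Fin n => gaussianReal 0 ((n : ℝ≥0)⁻¹)) ∧
      -- the expansions of the estimators
      (3 ≤ k → ∀ a : SpikedTensor.Vec n, ‖a‖ = 1 → ∀ T : ℕ,
        SpikedTensor.timeBound k n ε |β ⟨0, hr⟩| ≤ T →
        (Odd k → 0 < β i →
          |(SpikedTensor.law k n).real
              (SpikedTensor.convExpEvent k β v (δ n) a |β ⟨0, hr⟩| K T (β i) (v i))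
            - SpikedTensor.argmaxProb k β v i| ≤ C / Real.sqrt κ) ∧
        (Odd k → β i < 0 →
          |(SpikedTensor.law k n).real
              (SpikedTensor.convExpEvent k β v (δ n) a |β ⟨0, hr⟩| K T (-β i) (-v i))
            - SpikedTensor.argmaxProb k β v i| ≤ C / Real.sqrt κ) ∧
        (Even k → 0 < β i →
          |(SpikedTensor.law k n).real
              (SpikedTensor.convExpEvent k β v (δ n) a |β ⟨0, hr⟩| K T (β i) (v i))
            - SpikedTensor.argmaxProb k β v i / 2| ≤ C / Real.sqrt κ ∧
          |(SpikedTensor.law k n).real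
              (SpikedTensor.convExpEvent k β v (δ n) a |β ⟨0, hr⟩| K T (β i) (-v i))
            - SpikedTensor.argmaxProb k β v i / 2| ≤ C / Real.sqrt κ) ∧
        (Even k → β i < 0 →
          |(SpikedTensor.law k n).real
              (SpikedTensor.altExpEvent k β v (δ n) a |β ⟨0, hr⟩| K T (β i) (v i))
            - SpikedTensor.argmaxProb k β v i| ≤ C / Real.sqrt κ)) := by
  -- The bad event has probability at most `(2 r² + 2 r + 1) δ` from the start plus `δ` from the
  -- noise for large `n`, which with `δ = 1 / (2 √κ)` is `(r² + r + 1) / √κ`.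
  refine ⟨r ^ 2 + r + 1, fun κ hκ => ?_⟩
  have hs1 : 1 ≤ Real.sqrt κ := Real.one_le_sqrt.2 hκ
  have hs0 : 0 < Real.sqrt κ := by linarith
  set δ : ℝ := 1 / (2 * Real.sqrt κ) with hδ
  have hδ0 : 0 < δ := by positivity
  have hδ2 : δ ≤ 1 / 2 := by
    rw [hδ]
    gcongr
    linarith
  have hκδ : δ ^ 2 ≤ 1 / κ := by
    rw [hδ, div_pow, mul_pow, Real.sq_sqrt (by linarith)]
    gcongr
    · norm_num
    · linarith
  obtain ⟨ε₀, hε₀, C, K, hdyn⟩ := follows_and_expansion hk hr hκ hδ0 hδ2 hκδ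
  refine ⟨ε₀, hε₀, fun ε hε hεε₀ => ?_⟩
  have hev := ((hdyn ε hε hεε₀).and (((tendsto_noiseFail k r hε).eventually
    (eventually_le_nhds hδ0)).and (((tendsto_precision k r C hε).eventually
      (eventually_le_nhds (by norm_num : (0 : ℝ) < 1 / 2))).and (eventually_ge_atTop 3))))
  obtain ⟨N, hN⟩ := eventually_atTop.1 hev
  refine ⟨K, precision k r C ε, N, tendsto_precision k r C hε, ?_⟩
  intro n hn v β hv hβ hβ0 hB hgap i
  obtain ⟨hdyn, hfail, hd, hn3⟩ := hN n hn
  have hn0 : 0 < n := by omega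
  have hc : 0 ≤ ((r : ℝ) ^ 2 + r + 1) / Real.sqrt κ := by positivity
  have htrack : ∀ a : Vec n, ‖a‖ ≤ 1 → Tracking (goodEvent k δ ε β v a i) β v
      (precision k r C ε n) (((r : ℝ) ^ 2 + r + 1) / Real.sqrt κ) := by
    intro a ha
    refine ⟨(law_goodEvent_compl_le hk (by omega) hδ0 hδ2 hβ hv ha i).trans
      (ENNReal.ofReal_le_ofReal ?_), fun ω hω => (hdyn v β hv hβ hβ0 hB hgap a ha i ω hω).1⟩
    calc (2 * (r : ℝ) ^ 2 + 2 * r + 1) * δ + noiseFail k r ε n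
        ≤ (2 * (r : ℝ) ^ 2 + 2 * r + 1) * δ + δ := by gcongr
      _ = _ := by
          rw [hδ]
          field_simp
          ring
  -- The statements without expansion involve no test direction, so `a = 0` serves.
  have H := htrack 0 (by simp)
  refine ⟨fun hk3 => argmaxProb_eq_gaussProb hn0 hk3 hβ hv i, fun hko hb => ?_, fun hko hb => ?_,
    fun hke hb => ⟨?_, ?_⟩, fun hke hb => ?_, ?_, fun hk3 a ha T hT => ?_⟩
  · exact H.odd_pos hn0 hc hv hd subset_rfl
      fun ω hω hi => (H.follows ω hω i hi).converges_odd_pos hko hb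
  · exact H.odd_neg hn0 hc hv hd subset_rfl
      fun ω hω hi => (H.follows ω hω i hi).converges_odd_neg hko hb
  · refine H.even_pos hke hk hn0 hc hv hd hb (Or.inl rfl) (by rw [one_smul])
      fun ω hω hi hs => ?_
    have h := (H.follows ω hω i hi).converges_even_pos hke hk hb
    rwa [hs, one_smul] at h
  · refine H.even_pos hke hk hn0 hc hv hd hb (Or.inr rfl) (by rw [neg_one_smul])
      fun ω hω hi hs => ?_
    have h := (H.follows ω hω i hi).converges_even_pos hke hk hb
    rwa [hs, neg_one_smul] at h
  · refine H.even_neg hn0 hc hv hd subset_rfl fun ω hω hi => ?_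
    have hF := H.follows ω hω i hi
    have h := hF.alternates_even_neg hke hk hb
    rcases hF.sign_eq 0 with hs | hs
    · rw [hs, one_smul] at h
      exact Or.inl h
    · rw [hs, neg_one_smul] at h
      exact Or.inr h
  · intro w hw
    have hw1 : ‖w‖ = 1 := by
      rcases hw with rfl | rfl
      · exact hv.1 i
      · rw [norm_neg, hv.1 i]
    exact noise_map_contract w hw1
  have H := htrack a ha.le
  have hexp : ∀ ω ∈ goodEvent k δ ε β v a i, ω ∈ argmaxSet k β v i →
      Expansion (spiked k β v ω.2) ω.2 ω.1 a |β ⟨0, hr⟩| K T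
        (β i * dirSign (spiked k β v ω.2) ω.1 (v i) T ^ k)
        (dirSign (spiked k β v ω.2) ω.1 (v i) T • v i) := fun ω hω hi =>
    (hdyn v β hv hβ hβ0 hB hgap a ha.le i ω hω).2 hk3 hi T hT
  -- For odd `k` the sign at time `T` is determined by that of `β i` only after the first step.
  have hT1 : 1 ≤ T :=
    one_le_two.trans (two_le_of_timeBound_le hk3 hn3 hε hB hT)
  refine ⟨fun hko hb => ?_, fun hko hb => ?_, fun hke hb => ⟨?_, ?_⟩, fun hke hb => ?_⟩
  · refine H.odd_pos hn0 hc hv hd (fun ω hω => hω.1) fun ω hω hi => ?_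
    have hF := H.follows ω hω i hi
    refine ⟨hF.converges_odd_pos hko hb, ?_⟩
    have h := hexp ω hω hi
    rw [hF.sign_odd hko hT1, sign_pos hb] at h
    simpa using h
  · refine H.odd_neg hn0 hc hv hd (fun ω hω => hω.1) fun ω hω hi => ?_
    have hF := H.follows ω hω i hi
    refine ⟨hF.converges_odd_neg hko hb, ?_⟩
    have h := hexp ω hω hi
    rw [hF.sign_odd hko hT1, sign_neg hb] at h
    simpa [hko.neg_one_pow] using h
  · refine H.even_pos hke hk hn0 hc hv hd hb (Or.inl rfl)
      (fun ω hω => by rw [one_smul]; exact hω.1) fun ω hω hi hs => ?_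
    have hF := H.follows ω hω i hi
    have h := hF.converges_even_pos hke hk hb
    have h' := hexp ω hω hi
    rw [hF.pow_even hke, hF.sign_even hke hk T, sign_pos hb, hs] at h'
    rw [hs] at h
    exact ⟨by simpa using h, by simpa using h'⟩
  · refine H.even_pos hke hk hn0 hc hv hd hb (Or.inr rfl)
      (fun ω hω => by rw [neg_one_smul]; exact hω.1) fun ω hω hi hs => ?_
    have hF := H.follows ω hω i hi
    have h := hF.converges_even_pos hke hk hb
    have h' := hexp ω hω hi
    rw [hF.pow_even hke, hF.sign_even hke hk T, sign_pos hb, hs] at h'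
    rw [hs] at h
    exact ⟨by simpa using h, by simpa using h'⟩
  · refine H.even_neg hn0 hc hv hd ?_ fun ω hω hi => ?_
    · rintro ω ⟨w', rfl | rfl, h, -⟩
      · exact Or.inl h
      · exact Or.inr h
    · have hF := H.follows ω hω i hi
      have h' := hexp ω hω hi
      rw [hF.pow_even hke, hF.sign_even hke hk T, sign_neg hb] at h'
      refine ⟨_, ?_, hF.alternates_even_neg hke hk hb, by simpa [smul_smul] using h'⟩
      rcases hF.sign_eq 0 with hs | hs <;> simp [hs]
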